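/- **Setting.** Let $V$ be a finite-dimensional real vector space, $I$ a finite set, $(\alpha_i)_{i\in I}$ a free family in $V^*$ and $(\alpha_i^\vee)_{i\in I}$ a family in $V$ with $\alpha_i(\alpha_i^\vee)=2$. Put $r_i(v)=v-\alpha_i(v)\alpha_i^\vee$ and let $W^v\subset GL(V)$ be generated by $S=\{r_i\}$. Assume that $(W^v,S)$ is a Coxeter system. Let $\Phi=\{w\alpha_i\mid w\in W^v,\,i\in I\}$ be the set of real roots and assume that the following hold. For $\alpha=w\alpha_i\in\Phi$ the coroot $\alpha^\vee=w\alpha_i^\vee$ depends only on $\alpha$. Every $\alpha\in\Phi$ lies in $Q_+=\bigoplus_i\mathbb R_{\ge0}\alpha_i$ or in $-Q_+$. For $w\in W^v$ one has $w\alpha_i\in Q_+$ if and only if $\ell(wr_i)>\ell(w)$. Finally $\Phi\cap\mathbb R_{\ge 0}\alpha=\{\alpha\}$ for $\alpha\in\Phi$. Let $\Delta_{im}=-\Delta_{im}\subset V^*\setminus(\mathbb R\Phi\cup\{0\})$ be a set of imaginary roots such that $\Delta_{im}\subset Q_+\cup -Q_+$ and $\Delta_{im}\cap Q_+$ is stable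 under $W^v$ (moderately imaginary case). Put $\Delta=\Phi\cup\Delta_{im}$. For $J\subset I$ let $F^v(J)=\{v\mid\alpha_i(v)=0\ (i\in J),\ \alpha_i(v)>0\ (i\notin J)\}$. The sets $\varepsilon wF^v(J)$ ($w\in W^v$, $\varepsilon=\pm1$) are the vectorial facets of sign $\varepsilon$ and type $J$. They are spherical if $\langle r_i\mid i\in J\rangle$ is finite, chambers if $J=\emptyset$, and panels if $|J|=1$. The Tits cone $\mathcal T$ is the union of the positive facets; $x\le y$ means $y-x\in\mathcal T$. The model apartment $\mathbb A$ is an affine space under $V$ with a set $\mathcal M$ of affine hyperplanes (walls). The direction of each wall is $\ker\alpha$ for some $\alpha\in\Phi$, each $\alpha\in\Phi$ occurs for infinitely many walls, and the group $W$ generated by the reflections in the walls (with linear parts $v\mapsto v-\alpha(v)\alpha^\vee$) stabilizes $\mathcal M$. With an origin fixed, let $\Gamma_\alpha$ be the set of $k\in\mathbb R$ for which $\{\alpha+k=0\}$ is a wall if $\alpha\in\Phi$, and $\Gamma_\alpha=\mathbb R$ if $\alpha\in\Delta_{im}$. Put $D(\alpha,k)=\{\alpha+k\ge0\}$, $D^\circ(\alpha,k)=\{\alpha+k>0\}$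 and $D(\alpha,\infty)=D^\circ(\alpha,\infty)=\mathbb A$. A set is identified with the filter of its supersets. A filter $F$ is contained in $F'$ if every element of $F'$ is an element of $F$, and $F\cup F'$ is the filter of the sets that are elements of both. A map fixes a filter if it is the identity on one of its elements. The following filters are used. * The enclosure $cl(F)$ consists of the sets containing an element of $F$ of the form $\bigcap_{\alpha\in\Delta}D(\alpha,k_\alpha)$, with $k_\alpha\in\Gamma_\alpha\cup\{\infty\}$. * The facet $F(x,F^v)$ consists of the sets containing an intersection of half-spaces $D(\alpha,k_\alpha)$ or $D^\circ(\alpha,k_\alpha)$ (one for each $\alpha\in\Delta$, with $k_\alpha\in\Gamma_\alpha\cup\{\infty\}$) that contains the germ of $x+F^v$ at $x$. It is a chamber if $F^v$ can be taken to be a vectorial chamber, and a panel if $F^v$ can be taken to be a vectorial panel with $x+F^v$ and $x$ in a wall. A facet is dominated by a chamber $C$ if it is contained in the closure of $C$. * The chimney with base a facet $F$ and direction a vectorial facet $F^v$ is $cl(F+F^v)$. Its germ consists of the sets containing some $cl(F+\xi+F^v)$, $\xi\in\overline{F^v}$. It is splayed if $F^v$ is spherical, and solid if the direction of its support (the smallest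 affine subspace containing it) has a finite fixator in $W^v$. * A sector face is a set $x+F^v$. Its germ consists of the sets containing some $x+\xi+F^v$, $\xi\in\overline{F^v}$. It is spherical, resp. of sign $\varepsilon$, if its direction $F^v$ is so. An affine hovel of type $\mathbb A$ is a non-empty set $\mathcal I$ covered by a set $\mathcal A$ of subsets (apartments) with the following properties. * (MA1) Every $A\in\mathcal A$ has a set $\mathrm{Isom}(\mathbb A,A)$ of bijections $\mathbb A\to A$ that is of the form $f_0\circ W$. These bijections transport all the notions above to $A$. Isomorphisms $A\to A'$ are the maps $g\circ f^{-1}$ with $f\in \mathrm{Isom}(\mathbb A,A)$, $g\in \mathrm{Isom}(\mathbb A,A')$. * (MA2) Let $F$ be a point, the germ at $x$ of a half-open segment $]x,y]$ with $x\ne y$ and $x\le y$ or $y\le x$, a ray whose direction lies in a spherical vectorial facet, or a solid chimney of an apartment $A$. If an apartment $A'$ contains $F$, then $A\cap A'$ contains $cl_A(F)$, and some isomorphism $A\to A'$ fixes $cl_A(F)$. * (MA3) A germ $\mathfrak R$ of a splayed chimney and a facet or germ of a solid chimney $F$ are always contained in a common apartment. * (MA4) If $A$ and $A'$ both contain $\mathfrak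 R$ and $F$ as in (MA3), then $A\cap A'$ contains $cl_A(\mathfrak R\cup F)$, and some isomorphism $A\to A'$ fixes it. The hovel is thick if every panel of $\mathcal I$ is dominated by at least three chambers of $\mathcal I$. Two germs of spherical sector faces are parallel if in an apartment containing both they have the same direction. A germ $\mathfrak F$ dominates $\mathfrak F'$ if in an apartment containing both the direction of $\mathfrak F'$ is contained in the closure of that of $\mathfrak F$. For $\varepsilon=\pm$ let $\mathcal I^{\varepsilon\infty}$ be the set of parallelism classes of germs of spherical sector faces of sign $\varepsilon$. For $A\in\mathcal A$ let $A^{\varepsilon\infty}\subset\mathcal I^{\varepsilon\infty}$ be the set of classes with a representative contained in $A$, and let $\mathcal A^{\varepsilon\infty}=\{A^{\varepsilon\infty}\mid A\in\mathcal A\}$. **Theorem.** Let $\mathcal I$ be an affine hovel of type $\mathbb A$ and $\varepsilon\in\{+,-\}$. Parallelism is an equivalence relation on the germs of spherical sector faces of sign $\varepsilon$, and dominance induces a well-defined partial order on $\mathcal I^{\varepsilon\infty}$. With this order and the set of apartments $\mathcal A^{\varepsilon\infty}$, $\mathcal I^{\varepsilon\infty}$ is a combinatorial building of type $(W^v,S)$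 (of which only the spherical facets are kept). This means that $\mathcal A^{\varepsilon\infty}\neq\emptyset$ and that there is a type function from $\mathcal I^{\varepsilon\infty}$ to the subsets of $I$ such that: * every apartment contains with a facet all the facets it dominates, and is isomorphic, with its order and its types, to the set of cosets $wW^v_J$ with $W^v_J=\langle r_i\mid i\in J\rangle$ finite, ordered by reverse inclusion, $wW^v_J$ being of type $J$; * any two elements of $\mathcal I^{\varepsilon\infty}$ lie in a common apartment; * if two apartments both contain $a$ and $b$, there is an isomorphism between them, preserving order and types, that fixes $a$, $b$ and every element dominated by $a$ or by $b$. If $\mathcal I$ is thick, then the building $\mathcal I^{\varepsilon\infty}$ is thick: every panel (an element maximal among the non-maximal ones) is dominated by at least three chambers (maximal elements). -/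

import Mathlib

open Set Filter Topology
open scoped Pointwise

noncomputable section

/-! ## Vectorial data -/

/-- A free family of simple roots in the dual of `V` and a family of simple coroots in `V`, with
`αᵢ(αᵢ^∨) = 2`. -/
structure SimpleRoots (ι V : Type*) [AddCommGroup V] [Module ℝ V] where
  /-- the simple roots `αᵢ` -/
  root : ι → Module.Dual ℝ V
  /-- the simple coroots `αᵢ^∨` -/
  coroot : ι → V
  root_coroot : ∀ i, root i (coroot i) = 2
  root_free : LinearIndependent ℝ root

namespace SimpleRoots

variable {ι V : Type*} [AddCommGroup V] [Module ℝ V] (B : SimpleRoots ι V)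

/-- The reflection `rᵢ(v) = v - αᵢ(v) αᵢ^∨`. -/
def refl (i : ι) : V ≃ₗ[ℝ] V := Module.reflection (B.root_coroot i)

/-- The vectorial Weyl group `W^v`, a subgroup of `GL(V)`. -/
def vWeyl : Subgroup (V ≃ₗ[ℝ] V) := Subgroup.closure (range B.refl)

/-- The action of `GL(V)` on linear forms. -/
def act (w : V ≃ₗ[ℝ] V) (f : Module.Dual ℝ V) : Module.Dual ℝ V :=
  f ∘ₗ (w.symm : V →ₗ[ℝ] V)

/-- `f = w(αᵢ)` is a real root and `a = w(αᵢ^∨)` a corresponding coroot, for the same `w`, `i`.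
Then `w rᵢ w⁻¹` is the reflection `v ↦ v - f(v) a`. -/
def IsRootPair (f : Module.Dual ℝ V) (a : V) : Prop :=
  ∃ w ∈ B.vWeyl, ∃ i, f = act w (B.root i) ∧ a = w (B.coroot i)

/-- The set `Φ` of real roots. -/
def realRoots : Set (Module.Dual ℝ V) := {f | ∃ a, B.IsRootPair f a}

/-- The cone `⨁ ℝ⁺ αᵢ` in the dual of `V`. -/
def posCone [Fintype ι] : Set (Module.Dual ℝ V) :=
  {f | ∃ c : ι → ℝ, (∀ i, 0 ≤ c i) ∧ f = ∑ i, c i • B.root i}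

end SimpleRoots

/-- The vectorial datum: the simple roots and coroots, the Coxeter group `W^v`, the real roots, and
the imaginary roots in the moderately imaginary case. -/
structure VectorialDatum (ι V : Type*) [Fintype ι] [AddCommGroup V] [Module ℝ V]
    extends SimpleRoots ι V where
  /-- the Coxeter matrix of `W^v` -/
  coxeterMatrix : CoxeterMatrix ι
  /-- `W^v` is a Coxeter group, with the `rᵢ` as canonical generators -/
  cs : CoxeterSystem coxeterMatrix toSimpleRoots.vWeyl
  cs_simple : ∀ i, (cs.simple i : V ≃ₗ[ℝ] V) = toSimpleRoots.refl i
  /-- the reflection `r_α` depends only on the real root `α` -/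
  coroot_unique : ∀ f a b, toSimpleRoots.IsRootPair f a → toSimpleRoots.IsRootPair f b → a = b
  /-- every real root is positive or negative -/
  pos_or_neg : ∀ f ∈ toSimpleRoots.realRoots,
    f ∈ toSimpleRoots.posCone ∨ -f ∈ toSimpleRoots.posCone
  /-- `w(αᵢ)` is positive if and only if `ℓ(w rᵢ) > ℓ(w)` -/
  pos_iff_length : ∀ (w : toSimpleRoots.vWeyl) (i : ι),
    SimpleRoots.act (w : V ≃ₗ[ℝ] V) (root i) ∈ toSimpleRoots.posCone ↔
      cs.length w < cs.length (w * cs.simple i)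
  /-- `Φ ∩ ℝ⁺ α = {α}` for every real root `α` -/
  reduced : ∀ f ∈ toSimpleRoots.realRoots, ∀ c : ℝ, 0 ≤ c →
    c • f ∈ toSimpleRoots.realRoots → c • f = f
  /-- the set `Δ_im` of imaginary roots -/
  imag : Set (Module.Dual ℝ V)
  imag_ne_zero : ∀ f ∈ imag, f ≠ 0
  imag_disjoint : ∀ f ∈ imag, ∀ g ∈ toSimpleRoots.realRoots, ∀ c : ℝ, f ≠ c • g
  imag_neg : ∀ f ∈ imag, -f ∈ imag
  imag_pos_or_neg : ∀ f ∈ imag, f ∈ toSimpleRoots.posCone ∨ -f ∈ toSimpleRoots.posCone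
  /-- the set of positive imaginary roots is stable under `W^v` -/
  imag_pos_stable : ∀ f ∈ imag, f ∈ toSimpleRoots.posCone → ∀ w ∈ toSimpleRoots.vWeyl,
    SimpleRoots.act w f ∈ imag ∧ SimpleRoots.act w f ∈ toSimpleRoots.posCone

namespace VectorialDatum

variable {ι V : Type*} [Fintype ι] [AddCommGroup V] [Module ℝ V] (D : VectorialDatum ι V)

/-- The set `Δ = Φ ∪ Δ_im` of all roots. -/
def roots : Set (Module.Dual ℝ V) := D.realRoots ∪ D.imag

/-- The vectorial facet `F^v(J)` of the closed fundamental chamber. -/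
def stdFacet (J : Set ι) : Set V :=
  {v | (∀ i ∈ J, D.root i v = 0) ∧ ∀ i ∉ J, 0 < D.root i v}

/-- `J` is spherical: `W^v(J)` is finite. -/
def IsSpherical (J : Set ι) : Prop :=
  (Subgroup.closure (D.refl '' J) : Set (V ≃ₗ[ℝ] V)).Finite

/-- `F = ε w F^v(J)` for some `w ∈ W^v`: a vectorial facet of sign `ε` and type `J`. -/
def IsFacetOfType (ε : ℤˣ) (J : Set ι) (F : Set V) : Prop :=
  ∃ w ∈ D.vWeyl, F = (fun v => ((ε : ℤ) : ℝ) • w v) '' D.stdFacet J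

/-- Vectorial facets, positive or negative. -/
def IsVFacet (F : Set V) : Prop := ∃ ε J, D.IsFacetOfType ε J F

/-- Spherical vectorial facets of sign `ε`. -/
def IsSphericalFacet (ε : ℤˣ) (F : Set V) : Prop := ∃ J, D.IsSpherical J ∧ D.IsFacetOfType ε J F

/-- Vectorial chambers, positive or negative. -/
def IsVChamber (F : Set V) : Prop := ∃ ε, D.IsFacetOfType ε ∅ F

/-- Vectorial panels, positive or negative. -/
def IsVPanel (F : Set V) : Prop := ∃ ε i, D.IsFacetOfType ε {i} F

/-- The Tits cone: the union of the positive vectorial facets. -/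
def titsCone : Set V := {v | ∃ J F, D.IsFacetOfType 1 J F ∧ v ∈ F}

end VectorialDatum

/-! ## The model apartment -/

/-- The affine hyperplane `M(α, k)`. -/
def affWall {V : Type*} [AddCommGroup V] [Module ℝ V] (α : Module.Dual ℝ V) (k : ℝ) : Set V :=
  {x | α x + k = 0}

/-- The model affine apartment: the affine space `V` (no point of which plays a special role) with
a set of walls. -/
structure ModelApartment (ι V : Type*) [Fintype ι] [AddCommGroup V] [Module ℝ V]
    extends VectorialDatum ι V where
  /-- the set of real walls -/
  walls : Set (Set V)
  /-- the direction of a wall is the kernel of a real root -/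
  walls_dir : ∀ M ∈ walls, ∃ α ∈ toSimpleRoots.realRoots, ∃ k, M = affWall α k
  /-- there are infinitely many walls in the direction of each real root -/
  walls_infinite : ∀ α ∈ toSimpleRoots.realRoots, {M ∈ walls | ∃ k, M = affWall α k}.Infinite
  /-- the reflections in the walls permute the walls -/
  walls_stable : ∀ α a k, toSimpleRoots.IsRootPair α a → affWall α k ∈ walls →
    ∀ M ∈ walls, (fun x => x - (α x + k) • a) '' M ∈ walls

namespace ModelApartment

section Algebra

variable {ι V : Type*} [Fintype ι] [AddCommGroup V] [Module ℝ V] (𝔸 : ModelApartment ι V)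

/-- The affine Weyl group `W`, generated by the reflections in the walls. -/
def weyl : Subgroup (Equiv.Perm V) :=
  Subgroup.closure {g | ∃ α a k, 𝔸.IsRootPair α a ∧ affWall α k ∈ 𝔸.walls ∧
    ∀ x, g x = x - (α x + k) • a}

/-- The set `Γ_α` of all `k` such that `M(α, k)` is a wall, real or imaginary; it is all of `ℝ` if
`α` is imaginary. -/
def wallParams (α : Module.Dual ℝ V) : Set ℝ := {k | α ∈ 𝔸.imag ∨ affWall α k ∈ 𝔸.walls}

/-- The intersection over all `α ∈ Δ` of the half-spaces `D(α, k_α)`, or of the open half-spaces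
`D°(α, k_α)` if `α ∈ o`. The half-space is the whole space if `k_α = ∞`. -/
def halfSpaceInter (k : Module.Dual ℝ V → WithTop ℝ) (o : Set (Module.Dual ℝ V)) : Set V :=
  {x | ∀ α ∈ 𝔸.roots, ∀ r : ℝ, k α = r → 0 ≤ α x + r ∧ (α ∈ o → 0 < α x + r)}

/-- The family `k` has its values in `Γ_α ∪ {∞}`. -/
def IsAdmissible (k : Module.Dual ℝ V → WithTop ℝ) : Prop :=
  ∀ α ∈ 𝔸.roots, ∀ r : ℝ, k α = r → r ∈ 𝔸.wallParams α

lemma halfSpaceInter_inter (k k' : Module.Dual ℝ V → WithTop ℝ) (o o' : Set (Module.Dual ℝ V)) :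
    𝔸.halfSpaceInter k o ∩ 𝔸.halfSpaceInter k' o' = 𝔸.halfSpaceInter (fun α => min (k α) (k' α))
      ({α | α ∈ o ∧ k α ≤ k' α} ∪ {α | α ∈ o' ∧ k' α ≤ k α}) := by
  ext x
  simp only [halfSpaceInter, mem_inter_iff, Set.mem_ofPred_eq, ← forall_and, mem_union]
  refine forall₂_congr fun α _ => ?_
  cases hk : k α with
  | top => cases hk' : k' α with
    | top => simp
    | coe s => simp
  | coe r => cases hk' : k' α with
    | top => simp
    | coe s =>
      simp only [WithTop.coe_inj, WithTop.coe_le_coe, ← WithTop.coe_min, forall_and, forall_eq']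
      rcases lt_trichotomy r s with h | h | h
      · rw [min_eq_left h.le]
        constructor
        · rintro ⟨⟨h1, h2⟩, h3, h4⟩
          exact ⟨h1, fun h5 => h5.elim (fun h => h2 h.1) (fun h' => absurd h'.2 (not_le.2 h))⟩
        · rintro ⟨h1, h2⟩
          exact ⟨⟨h1, fun h5 => h2 (Or.inl ⟨h5, h.le⟩)⟩, by linarith, fun _ => by linarith⟩
      · subst h
        simp only [min_self, le_refl, and_true]
        tauto
      · rw [min_eq_right h.le]
        constructor
        · rintro ⟨⟨h1, h2⟩, h3, h4⟩
          exact ⟨h3, fun h5 => h5.elim (fun h' => absurd h'.2 (not_le.2 h)) (fun h => h4 h.1)⟩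
        · rintro ⟨h1, h2⟩
          exact ⟨⟨by linarith, fun _ => by linarith⟩, h1, fun h5 => h2 (Or.inr ⟨h5, h.le⟩)⟩

lemma IsAdmissible.min {𝔸 : ModelApartment ι V} {k k' : Module.Dual ℝ V → WithTop ℝ}
    (h : 𝔸.IsAdmissible k) (h' : 𝔸.IsAdmissible k') :
    𝔸.IsAdmissible (fun α => min (k α) (k' α)) := by
  intro α hα r hr
  rcases min_choice (k α) (k' α) with h1 | h1
  · exact h α hα r (h1 ▸ hr)
  · exact h' α hα r (h1 ▸ hr)

/-- The enclosure `cl(F)` of a filter `F`: the filter of all sets that contain an element of `F`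
of the form `⋂ D(α, k_α)`, with `k_α ∈ Γ_α ∪ {∞}`. -/
def cl (F : Filter V) : Filter V where
  sets := {S | ∃ k, 𝔸.IsAdmissible k ∧ 𝔸.halfSpaceInter k ∅ ∈ F ∧ 𝔸.halfSpaceInter k ∅ ⊆ S}
  univ_sets := ⟨fun _ => ⊤, by simp [IsAdmissible], by simp [halfSpaceInter], subset_univ _⟩
  sets_of_superset := by
    rintro S T ⟨k, hk, hF, hS⟩ hST
    exact ⟨k, hk, hF, hS.trans hST⟩
  inter_sets := by
    rintro S T ⟨k, hk, hF, hS⟩ ⟨k', hk', hF', hT⟩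
    have := 𝔸.halfSpaceInter_inter k k' ∅ ∅
    simp only [mem_empty_iff_false, false_and, Set.ofPred_false, union_empty] at this
    exact ⟨_, hk.min hk', this ▸ inter_mem hF hF', this ▸ inter_subset_inter hS hT⟩

/-- The support of a filter: the smallest affine subspace that contains it. -/
def supp (F : Filter V) : AffineSubspace ℝ V := sInf {E | (E : Set V) ∈ F}

/-- The direction of the support of `F` has a finite fixator in `W^v`. -/
def HasFiniteFixator (F : Filter V) : Prop :=
  {w : V ≃ₗ[ℝ] V | w ∈ 𝔸.vWeyl ∧ ∀ v ∈ (supp F).direction, w v = v}.Finite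

/-- The chimney `cl(B + F^v)` with base `B` and direction `F^v`. -/
def chimney (B : Filter V) (Fv : Set V) : Filter V := 𝔸.cl (B + 𝓟 Fv)

end Algebra

variable {ι V : Type*} [Fintype ι] [NormedAddCommGroup V] [NormedSpace ℝ V]
  (𝔸 : ModelApartment ι V)

/-- The local facet `F^ℓ(x, F^v)`: the germ at `x` of `x + F^v`. -/
def localFacet (x : V) (Fv : Set V) : Filter V := 𝓝[(fun v => x + v) '' Fv] x

/-- The facet `F(x, F^v)`: the filter of all sets that contain an intersection of half-spaces
`D(α, k_α)` or `D°(α, k_α)`, one for each `α ∈ Δ`, which contains the local facet. -/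
def facet (x : V) (Fv : Set V) : Filter V where
  sets := {S | ∃ k o, 𝔸.IsAdmissible k ∧ 𝔸.halfSpaceInter k o ∈ localFacet x Fv ∧
    𝔸.halfSpaceInter k o ⊆ S}
  univ_sets := ⟨fun _ => ⊤, ∅, by simp [IsAdmissible], by simp [halfSpaceInter], subset_univ _⟩
  sets_of_superset := by
    rintro S T ⟨k, o, hk, hF, hS⟩ hST
    exact ⟨k, o, hk, hF, hS.trans hST⟩
  inter_sets := by
    rintro S T ⟨k, o, hk, hF, hS⟩ ⟨k', o', hk', hF', hT⟩
    have := 𝔸.halfSpaceInter_inter k k' o o'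
    exact ⟨_, _, hk.min hk', this ▸ inter_mem hF hF', this ▸ inter_subset_inter hS hT⟩

/-- Facets of the apartment. -/
def IsFacet (F : Filter V) : Prop := ∃ x Fv, 𝔸.IsVFacet Fv ∧ F = 𝔸.facet x Fv

/-- Chambers of the apartment. -/
def IsChamber (F : Filter V) : Prop := ∃ x Cv, 𝔸.IsVChamber Cv ∧ F = 𝔸.facet x Cv

/-- Panels of the apartment: the facets `F(x, F^v)` with `F^v` a vectorial panel such that the
hyperplane through `x` that contains `x + F^v` is a real wall. -/
def IsPanel (F : Filter V) : Prop :=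
  ∃ x Fv, 𝔸.IsVPanel Fv ∧ (∃ M ∈ 𝔸.walls, x ∈ M ∧ ∀ v ∈ Fv, x + v ∈ M) ∧ F = 𝔸.facet x Fv

/-- The germ at `x` of the half-open segment `]x, y]`, with `x ≠ y` and `x ≤ y` or `y ≤ x`. -/
def IsPreorderedIntervalGerm (F : Filter V) : Prop :=
  ∃ x y, x ≠ y ∧ (y - x ∈ 𝔸.titsCone ∨ x - y ∈ 𝔸.titsCone) ∧
    F = 𝓝[(fun t : ℝ => x + t • (y - x)) '' Ioc 0 1] x

/-- A ray with origin `x` through `y ≠ x`, where `y - x` is in a spherical vectorial facet. -/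
def IsGenericRay (F : Filter V) : Prop :=
  ∃ x y, x ≠ y ∧ (∃ ε Fv, 𝔸.IsSphericalFacet ε Fv ∧ y - x ∈ Fv) ∧
    F = 𝓟 ((fun t : ℝ => x + t • (y - x)) '' Ici 0)

/-- Solid chimneys. -/
def IsSolidChimney (F : Filter V) : Prop :=
  ∃ B Fv, 𝔸.IsFacet B ∧ 𝔸.IsVFacet Fv ∧ 𝔸.HasFiniteFixator (𝔸.chimney B Fv) ∧
    F = 𝔸.chimney B Fv

/-- The germ of the chimney `cl(B + F^v)`: the filter of all sets that contain one of its
shortenings `cl(B + ξ + F^v)`, for `ξ` in the closure of `F^v`. -/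
def chimneyGerm (B : Filter V) (Fv : Set V) : Filter V :=
  ⨅ ξ ∈ closure Fv, 𝔸.cl (B + pure ξ + 𝓟 Fv)

/-- Germs of solid chimneys. -/
def IsSolidChimneyGerm (F : Filter V) : Prop :=
  ∃ B Fv, 𝔸.IsFacet B ∧ 𝔸.IsVFacet Fv ∧ 𝔸.HasFiniteFixator (𝔸.chimney B Fv) ∧
    F = 𝔸.chimneyGerm B Fv

/-- Germs of splayed chimneys: the direction is spherical, of any sign. -/
def IsSplayedChimneyGerm (F : Filter V) : Prop :=
  ∃ B Fv, 𝔸.IsFacet B ∧ (∃ ε, 𝔸.IsSphericalFacet ε Fv) ∧ F = 𝔸.chimneyGerm B Fv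

/-- The germ of the sector face `x + F^v`: the filter of all sets that contain one of its
shortenings `x + ξ + F^v`, for `ξ` in the closure of `F^v`. -/
def sectorFaceGerm (x : V) (Fv : Set V) : Filter V :=
  ⨅ ξ ∈ closure Fv, 𝓟 ((fun v => x + ξ + v) '' Fv)

end ModelApartment

/-! ## Affine hovels -/

/-- An affine hovel of type `𝔸` on the set `X`. The apartments are the ranges of the charts, and
the isomorphisms of `𝔸` onto an apartment `A` are the charts with range `A`. For a chart `f`, a
filter `F` on the model apartment stands for the filter `map f F` in the apartment `range f`; a set
`A` contains it if `A ∈ map f F`. An isomorphism from `range f` onto `A'` fixes `map f F` if it is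
the identity on an element of it; such isomorphisms have the form `g ∘ f⁻¹` with `g` a chart of
range `A'`. -/
structure AffineHovel {ι V : Type*} [Fintype ι] [NormedAddCommGroup V] [NormedSpace ℝ V]
    (𝔸 : ModelApartment ι V) (X : Type*) where
  /-- the isomorphisms of `𝔸` onto the apartments -/
  charts : Set (V → X)
  charts_injective : ∀ f ∈ charts, Function.Injective f
  /-- the charts onto a given apartment form one orbit of the affine Weyl group `W` -/
  charts_orbit : ∀ f ∈ charts, ∀ g : V → X,
    (g ∈ charts ∧ range g = range f) ↔ ∃ w ∈ 𝔸.weyl, g = f ∘ w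
  /-- the apartments cover `X` -/
  covering : ∀ p : X, ∃ f ∈ charts, p ∈ range f
  /-- axiom (MA2) -/
  ma2 : ∀ f ∈ charts, ∀ F : Filter V,
    ((∃ x, F = pure x) ∨ 𝔸.IsPreorderedIntervalGerm F ∨ 𝔸.IsGenericRay F ∨ 𝔸.IsSolidChimney F) →
    ∀ g ∈ charts, range g ∈ map f F →
      range g ∈ map f (𝔸.cl F) ∧
      ∃ g' ∈ charts, range g' = range g ∧ ∀ᶠ v in 𝔸.cl F, g' v = f v
  /-- axiom (MA3) -/
  ma3 : ∀ f ∈ charts, ∀ g ∈ charts, ∀ R F : Filter V,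
    𝔸.IsSplayedChimneyGerm R → (𝔸.IsFacet F ∨ 𝔸.IsSolidChimneyGerm F) →
    ∃ h ∈ charts, range h ∈ map f R ∧ range h ∈ map g F
  /-- axiom (MA4) -/
  ma4 : ∀ f ∈ charts, ∀ R F : Filter V,
    𝔸.IsSplayedChimneyGerm R → (𝔸.IsFacet F ∨ 𝔸.IsSolidChimneyGerm F) →
    ∀ g ∈ charts, range g ∈ map f R → range g ∈ map f F →
      range g ∈ map f (𝔸.cl (R ⊔ F)) ∧
      ∃ g' ∈ charts, range g' = range g ∧ ∀ᶠ v in 𝔸.cl (R ⊔ F), g' v = f v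

namespace AffineHovel

variable {ι V : Type*} [Fintype ι] [NormedAddCommGroup V] [NormedSpace ℝ V]
  {𝔸 : ModelApartment ι V} {X : Type*} (H : AffineHovel 𝔸 X)

/-- The set of apartments. -/
def apartments : Set (Set X) := range '' H.charts

/-- `C` is a chamber of the hovel that dominates the filter `P`: `P` is contained in the closure of
`C`. -/
def IsChamberDominating (P C : Filter X) : Prop :=
  ∃ g ∈ H.charts, ∃ C₀, 𝔸.IsChamber C₀ ∧ C = map g C₀ ∧ P ≤ map g (C₀.lift' closure)

/-- The hovel is thick: each of its panels is dominated by at least three chambers. -/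
def IsThick : Prop :=
  ∀ f ∈ H.charts, ∀ P, 𝔸.IsPanel P →
    ∃ C : Fin 3 → Filter X, Function.Injective C ∧ ∀ i, H.IsChamberDominating (map f P) (C i)

/-- The germs of spherical sector faces of sign `ε` in the hovel. -/
def FaceGerm (ε : ℤˣ) : Type _ :=
  {𝔉 : Filter X // ∃ f ∈ H.charts, ∃ x Fv, 𝔸.IsSphericalFacet ε Fv ∧
    𝔉 = map f (ModelApartment.sectorFaceGerm x Fv)}

/-- Two germs are parallel: they have the same direction in an apartment containing both. -/
def Parallel (ε : ℤˣ) (𝔉 𝔊 : H.FaceGerm ε) : Prop :=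
  ∃ f ∈ H.charts, ∃ x y Fv, 𝔸.IsSphericalFacet ε Fv ∧
    𝔉.1 = map f (ModelApartment.sectorFaceGerm x Fv) ∧
    𝔊.1 = map f (ModelApartment.sectorFaceGerm y Fv)

/-- `𝔉` dominates `𝔊`: in an apartment containing both, the direction of `𝔊` is contained in the
closure of the direction of `𝔉`. -/
def Dominates (ε : ℤˣ) (𝔉 𝔊 : H.FaceGerm ε) : Prop :=
  ∃ f ∈ H.charts, ∃ x y Fv Gv, 𝔸.IsSphericalFacet ε Fv ∧ 𝔸.IsSphericalFacet ε Gv ∧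
    𝔉.1 = map f (ModelApartment.sectorFaceGerm x Fv) ∧
    𝔊.1 = map f (ModelApartment.sectorFaceGerm y Gv) ∧ Gv ⊆ closure Fv

/-- The set of parallelism classes of germs of spherical sector faces of sign `ε`: the facets at
infinity of sign `ε`. -/
def Infinity (ε : ℤˣ) : Type _ := Quot (H.Parallel ε)

/-- The facet at infinity of a germ. -/
def toInfinity (ε : ℤˣ) (𝔉 : H.FaceGerm ε) : H.Infinity ε := Quot.mk _ 𝔉

/-- The relation on facets at infinity induced by dominance: `a ≤ b` if `b` dominates `a`. -/
def leInfinity (ε : ℤˣ) (a b : H.Infinity ε) : Prop :=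
  ∃ 𝔊 𝔉, H.toInfinity ε 𝔊 = a ∧ H.toInfinity ε 𝔉 = b ∧ H.Dominates ε 𝔉 𝔊

/-- The apartment at infinity of `A`: the classes with a representative in `A`. -/
def apartmentAtInfinity (ε : ℤˣ) (A : Set X) : Set (H.Infinity ε) :=
  {a | ∃ 𝔉, H.toInfinity ε 𝔉 = a ∧ A ∈ 𝔉.1}

/-- The set of apartments at infinity of sign `ε`. -/
def apartmentsAtInfinity (ε : ℤˣ) : Set (Set (H.Infinity ε)) :=
  H.apartmentAtInfinity ε '' H.apartments

end AffineHovel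

/-! ## Combinatorial buildings -/

section Building

variable {ι : Type*} {M : CoxeterMatrix ι} {W : Type*} [Group W]

/-- The standard parabolic subgroup `W_J`. -/
def CoxeterSystem.standardParabolic (cs : CoxeterSystem M W) (J : Set ι) : Subgroup W :=
  Subgroup.closure (cs.simple '' J)

/-- The cosets `w W_J` with `W_J` finite: the simplices of the Coxeter complex that have a finite
stabilizer. All the chambers and all the panels are among them. The face relation is the reverse
inclusion. -/
def CoxeterSystem.SphericalCoset (cs : CoxeterSystem M W) : Type _ :=
  {C : Set W // ∃ (w : W) (J : Set ι), (cs.standardParabolic J : Set W).Finite ∧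
    C = w • (cs.standardParabolic J : Set W)}

/-- A set `Y` of facets with a face relation `le`, a set `𝒜` of apartments and a type function `τ`
is a combinatorial building of type `(W, S)`, where only the spherical facets are kept (all of them
if `W` is finite). -/
structure IsTypedBuilding (cs : CoxeterSystem M W) {Y : Type*} (le : Y → Y → Prop)
    (𝒜 : Set (Set Y)) (τ : Y → Set ι) : Prop where
  partialOrder : IsPartialOrder Y le
  nonempty : 𝒜.Nonempty
  /-- each apartment is a subcomplex -/
  face_mem : ∀ A ∈ 𝒜, ∀ a ∈ A, ∀ b, le b a → b ∈ A
  /-- each apartment is isomorphic to the Coxeter complex, with its types -/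
  coxeter : ∀ A ∈ 𝒜, ∃ φ : A ≃ cs.SphericalCoset,
    (∀ a b : A, le a b ↔ ((φ b).1 : Set W) ⊆ (φ a).1) ∧
    ∀ a : A, ∃ w : W, (φ a).1 = w • (cs.standardParabolic (τ a) : Set W)
  /-- two facets are always contained in a common apartment -/
  common : ∀ a b : Y, ∃ A ∈ 𝒜, a ∈ A ∧ b ∈ A
  /-- if two apartments contain the facets `a` and `b`, there is an isomorphism between them that
  fixes `a`, `b` and all their faces -/
  iso : ∀ A ∈ 𝒜, ∀ A' ∈ 𝒜, ∀ a b : Y, a ∈ A → b ∈ A → a ∈ A' → b ∈ A' →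
    ∃ φ : A ≃ A', (∀ c d : A, le c d ↔ le (φ c) (φ d)) ∧ (∀ c : A, τ (φ c) = τ c) ∧
      ∀ c : A, le c a ∨ le c b → (φ c : Y) = c

/-- Combinatorial buildings of type `(W, S)`. -/
def IsCombinatorialBuilding (cs : CoxeterSystem M W) {Y : Type*} (le : Y → Y → Prop)
    (𝒜 : Set (Set Y)) : Prop :=
  ∃ τ : Y → Set ι, IsTypedBuilding cs le 𝒜 τ

/-- Chambers: the maximal facets. -/
def IsBuildingChamber {Y : Type*} (le : Y → Y → Prop) (c : Y) : Prop := ∀ d, le c d → d = c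

/-- Panels: the facets that are maximal among the non-maximal ones. -/
def IsBuildingPanel {Y : Type*} (le : Y → Y → Prop) (p : Y) : Prop :=
  ¬ IsBuildingChamber le p ∧ ∀ d, le p d → ¬ IsBuildingChamber le d → d = p

/-- The building is thick: each panel is dominated by at least three chambers. -/
def IsThickBuilding {Y : Type*} (le : Y → Y → Prop) : Prop :=
  ∀ p, IsBuildingPanel le p →
    ∃ C : Fin 3 → Y, Function.Injective C ∧ ∀ i, IsBuildingChamber le (C i) ∧ le p (C i)

end Building

end

/-!
Axioms (MA3) and (MA4) put the germs of two spherical sector faces into a common apartment and make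
the pair of their directions in it unique up to `W^v`. Parallelism and dominance are both cases of
the relation "in a common apartment, the directions are in relation `ρ`", for a `W^v`-invariant
`ρ`. The truth of this relation is locally constant as the base point of one of the sector faces
moves along a segment in an apartment. Moving the base point in this way shows that a facet at
infinity is determined by a chart and a direction `F^v`, and that any two facets at infinity have
directions in a common chart, which are unique up to `W^v`. The building axioms then follow from the
identification of the spherical vectorial facets of sign `ε` with the cosets `w W^v_J`.

For the thickness, let a panel at infinity have the direction `F^v` in some apartment, and take a
special point `x` of this apartment. The facet `F(x, F^v)` is a panel, and each chamber `C` of the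
hovel which dominates it lies in a common apartment with the germ of `x + F^v`. There, since `x` is
special, `C` is one of the two facets `F(x, C^v)` with `F^v` in the closure of the vectorial chamber
`C^v`, and `C^v` gives a chamber at infinity. Distinct chambers at `x` give distinct chambers at
infinity, because an apartment that contains the panel at `x` and the chamber at infinity contains
the chamber at `x`.
-/

/-! ## Faces of simplicial cones -/

section SimplicialCone

variable {ι V : Type*}

section Algebra

variable [AddCommGroup V] [Module ℝ V]

/-- The relatively open face on which exactly the forms `b i`, `i ∈ J`, vanish, of the simplicial
cone `{v | ∀ i, 0 ≤ b i v}`. -/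
def coneFace (b : ι → Module.Dual ℝ V) (J : Set ι) : Set V :=
  {v | (∀ i ∈ J, b i v = 0) ∧ ∀ i ∉ J, 0 < b i v}

/-- The closed face on which the forms `b i`, `i ∈ J`, vanish, of the simplicial cone
`{v | ∀ i, 0 ≤ b i v}`. -/
def closedConeFace (b : ι → Module.Dual ℝ V) (J : Set ι) : Set V :=
  {v | (∀ i ∈ J, b i v = 0) ∧ ∀ i, 0 ≤ b i v}

/-- Nonnegative combinations of a family of linear forms. For the simple roots, these are the
elements of `posCone`; the notion is needed for the simple roots of every chamber. -/
def IsNonnegComb [Fintype ι] (b : ι → Module.Dual ℝ V) (f : Module.Dual ℝ V) : Prop :=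
  ∃ c : ι → ℝ, (∀ i, 0 ≤ c i) ∧ f = ∑ i, c i • b i

variable {b : ι → Module.Dual ℝ V} {f : Module.Dual ℝ V} {J K : Set ι} {u v : V}

lemma coneFace_subset_closedConeFace : coneFace b J ⊆ closedConeFace b J := fun _ hv =>
  ⟨hv.1, fun i => (em (i ∈ J)).elim (fun hi => (hv.1 i hi).ge) fun hi => (hv.2 i hi).le⟩

lemma closedConeFace_anti (h : J ⊆ K) : closedConeFace b K ⊆ closedConeFace b J :=
  fun _ hv => ⟨fun i hi => hv.1 i (h hi), hv.2⟩

lemma zero_mem_closedConeFace : (0 : V) ∈ closedConeFace b J :=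
  ⟨fun i _ => map_zero (b i), fun i => (map_zero (b i)).ge⟩

lemma add_mem_coneFace (hu : u ∈ closedConeFace b J) (hv : v ∈ coneFace b J) :
    u + v ∈ coneFace b J :=
  ⟨fun i hi => by rw [map_add, hu.1 i hi, hv.1 i hi, add_zero],
    fun i hi => by rw [map_add]; exact add_pos_of_nonneg_of_pos (hu.2 i) (hv.2 i hi)⟩

lemma add_mem_closedConeFace (hu : u ∈ closedConeFace b J) (hv : v ∈ closedConeFace b J) :
    u + v ∈ closedConeFace b J :=
  ⟨fun i hi => by rw [map_add, hu.1 i hi, hv.1 i hi, add_zero],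
    fun i => by rw [map_add]; exact add_nonneg (hu.2 i) (hv.2 i)⟩

lemma smul_mem_coneFace {t : ℝ} (ht : 0 < t) (hv : v ∈ coneFace b J) : t • v ∈ coneFace b J :=
  ⟨fun i hi => by rw [map_smul, hv.1 i hi, smul_zero],
    fun i hi => by rw [map_smul]; exact smul_pos ht (hv.2 i hi)⟩

lemma subset_of_mem_coneFace_of_mem_closedConeFace (hJ : v ∈ coneFace b J)
    (hK : v ∈ closedConeFace b K) : K ⊆ J := fun i hi => by
  by_contra hiJ
  exact (hJ.2 i hiJ).ne' (hK.1 i hi)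

lemma IsNonnegComb.nonneg [Fintype ι] (hf : IsNonnegComb b f) (hv : v ∈ closedConeFace b J) :
    0 ≤ f v := by
  obtain ⟨c, hc, rfl⟩ := hf
  simp only [LinearMap.sum_apply, LinearMap.smul_apply, smul_eq_mul]
  exact Finset.sum_nonneg fun i _ => mul_nonneg (hc i) (hv.2 i)

lemma coeff_eq_zero_of_mem_coneFace [Fintype ι] {c : ι → ℝ} (hc : ∀ i, 0 ≤ c i)
    (hv : v ∈ coneFace b J) (hle : (∑ i, c i • b i) v ≤ 0) {i : ι} (hi : i ∉ J) : c i = 0 := by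
  simp only [LinearMap.sum_apply, LinearMap.smul_apply, smul_eq_mul] at hle
  have hterm : ∀ j ∈ Finset.univ, 0 ≤ c j * b j v := fun j _ =>
    mul_nonneg (hc j) ((coneFace_subset_closedConeFace hv).2 j)
  have hzero := (Finset.sum_eq_zero_iff_of_nonneg hterm).1
    (hle.antisymm (Finset.sum_nonneg hterm)) i (Finset.mem_univ i)
  exact (mul_eq_zero.1 hzero).resolve_right (hv.2 i hi).ne'

lemma IsNonnegComb.apply_eq_zero [Fintype ι] (hf : IsNonnegComb b f) (hv : v ∈ coneFace b J)
    (hfv : f v ≤ 0) (hu : u ∈ closedConeFace b J) : f u = 0 := by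
  obtain ⟨c, hc, rfl⟩ := hf
  rw [LinearMap.sum_apply]
  refine Finset.sum_eq_zero fun i _ => ?_
  by_cases hiJ : i ∈ J
  · rw [LinearMap.smul_apply, hu.1 i hiJ, smul_zero]
  · rw [coeff_eq_zero_of_mem_coneFace hc hv hfv hiJ, zero_smul, LinearMap.zero_apply]

lemma nonneg_on_closedConeFace [Fintype ι] (hf : IsNonnegComb b f ∨ IsNonnegComb b (-f))
    (hv : v ∈ coneFace b J) (hfv : 0 ≤ f v) (hu : u ∈ closedConeFace b J) : 0 ≤ f u := by
  rcases hf with hf | hf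
  · exact hf.nonneg hu
  · exact (neg_eq_zero.1 (hf.apply_eq_zero hv (neg_nonpos.2 hfv) hu)).ge

lemma exists_forall_dual_apply_eq {κ K E : Type*} [Finite κ] [Field K] [AddCommGroup E] [Module K E]
    {b : κ → Module.Dual K E} (hb : LinearIndependent K b) (c : κ → K) : ∃ v, ∀ i, b i v = c i := by
  classical
  have := Fintype.ofFinite κ
  have hinj : Function.Injective (LinearMap.pi b).dualMap := by
    refine (injective_iff_map_eq_zero _).2 fun φ hφ => ?_
    have hcomb : ∑ i, φ (fun j => if i = j then 1 else 0) • b i = 0 := by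
      ext v
      have hv : φ (LinearMap.pi b v) = 0 := LinearMap.congr_fun hφ v
      rw [LinearMap.pi_apply_eq_sum_univ φ] at hv
      simpa [mul_comm] using hv
    have hcoeff := Fintype.linearIndependent_iff.1 hb _ hcomb
    refine LinearMap.ext fun x => ?_
    rw [LinearMap.pi_apply_eq_sum_univ φ]
    exact Finset.sum_eq_zero fun i _ => by rw [hcoeff i, smul_zero]
  obtain ⟨v, hv⟩ := LinearMap.dualMap_injective_iff.1 hinj c
  exact ⟨v, congrFun hv⟩

lemma coneFace_nonempty [Finite ι] (hb : LinearIndependent ℝ b) (J : Set ι) :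
    (coneFace b J).Nonempty := by
  classical
  obtain ⟨v, hv⟩ := exists_forall_dual_apply_eq hb fun i => if i ∈ J then 0 else 1
  exact ⟨v, fun i hi => by rw [hv, if_pos hi], fun i hi => by rw [hv, if_neg hi]; exact one_pos⟩

end Algebra

lemma tendsto_add_smul_nhdsGT_zero [AddCommGroup V] [Module ℝ V] [TopologicalSpace V]
    [ContinuousAdd V] [ContinuousSMul ℝ V] (u v : V) :
    Tendsto (fun t : ℝ => u + t • v) (𝓝[>] 0) (𝓝 u) := by
  have hcont : Continuous fun t : ℝ => u + t • v := by fun_prop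
  simpa using (hcont.tendsto 0).mono_left nhdsWithin_le_nhds

variable [NormedAddCommGroup V] [NormedSpace ℝ V] [FiniteDimensional ℝ V]

lemma isClosed_closedConeFace (b : ι → Module.Dual ℝ V) (J : Set ι) :
    IsClosed (closedConeFace b J) := by
  have hcont : ∀ i, Continuous (b i) := fun i => (b i).continuous_of_finiteDimensional
  simp only [closedConeFace, Set.ofPred_and, Set.ofPred_forall]
  exact (isClosed_biInter fun i _ => isClosed_eq (hcont i) continuous_const).inter
    (isClosed_iInter fun i => isClosed_le continuous_const (hcont i))

lemma closure_coneFace [Finite ι] {b : ι → Module.Dual ℝ V} (hb : LinearIndependent ℝ b)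
    (J : Set ι) : closure (coneFace b J) = closedConeFace b J := by
  refine (closure_minimal coneFace_subset_closedConeFace
    (isClosed_closedConeFace b J)).antisymm fun v hv => ?_
  obtain ⟨c, hc⟩ := coneFace_nonempty hb J
  refine mem_closure_of_tendsto (tendsto_add_smul_nhdsGT_zero v c) ?_
  filter_upwards [self_mem_nhdsWithin] with t ht
  exact add_mem_coneFace hv (smul_mem_coneFace ht hc)

end SimplicialCone

/-! ## The vectorial Weyl group and its facets -/

namespace SimpleRoots

variable {ι V : Type*} [AddCommGroup V] [Module ℝ V]

lemma act_apply (w : V ≃ₗ[ℝ] V) (f : Module.Dual ℝ V) (v : V) : act w f v = f (w⁻¹ v) := rfl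

lemma act_apply_apply (w : V ≃ₗ[ℝ] V) (f : Module.Dual ℝ V) (v : V) : act w f (w v) = f v :=
  congrArg f (w.symm_apply_apply v)

lemma act_mul (u w : V ≃ₗ[ℝ] V) (f : Module.Dual ℝ V) : act (u * w) f = act u (act w f) := rfl

lemma act_neg (w : V ≃ₗ[ℝ] V) (f : Module.Dual ℝ V) : act w (-f) = -act w f := rfl

lemma act_smul (w : V ≃ₗ[ℝ] V) (c : ℝ) (f : Module.Dual ℝ V) : act w (c • f) = c • act w f := rfl

lemma act_inv_act (w : V ≃ₗ[ℝ] V) (f : Module.Dual ℝ V) : act w⁻¹ (act w f) = f := by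
  rw [← act_mul, inv_mul_cancel]
  rfl

lemma act_act_inv (w : V ≃ₗ[ℝ] V) (f : Module.Dual ℝ V) : act w (act w⁻¹ f) = f := by
  rw [← act_mul, mul_inv_cancel]
  rfl

lemma act_sum {κ : Type*} (s : Finset κ) (w : V ≃ₗ[ℝ] V) (f : κ → Module.Dual ℝ V) :
    act w (∑ i ∈ s, f i) = ∑ i ∈ s, act w (f i) :=
  map_sum w.symm.dualMap f s

variable (B : SimpleRoots ι V)

lemma refl_apply (i : ι) (v : V) : B.refl i v = v - B.root i v • B.coroot i :=
  Module.reflection_apply ..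

lemma refl_mem (i : ι) : B.refl i ∈ B.vWeyl := Subgroup.subset_closure ⟨i, rfl⟩

lemma refl_inv (i : ι) : (B.refl i)⁻¹ = B.refl i := Module.reflection_inv _

lemma refl_coroot (i : ι) : B.refl i (B.coroot i) = -B.coroot i :=
  Module.reflection_apply_self _

lemma coroot_ne_zero (i : ι) : B.coroot i ≠ 0 := fun h => by
  simpa [h] using B.root_coroot i

lemma act_refl (i : ι) (f : Module.Dual ℝ V) :
    act (B.refl i) f = f - f (B.coroot i) • B.root i := by
  ext v
  rw [act_apply, refl_inv, refl_apply]
  simp [mul_comm]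

lemma act_refl_root (i : ι) : act (B.refl i) (B.root i) = -B.root i := by
  rw [act_refl, root_coroot]
  module

lemma conj_refl_apply (w : V ≃ₗ[ℝ] V) (i : ι) (v : V) :
    (w * B.refl i * w⁻¹) v = v - act w (B.root i) v • w (B.coroot i) := by
  rw [LinearEquiv.mul_apply, LinearEquiv.mul_apply, refl_apply, map_sub, map_smul, act_apply]
  congr 1
  exact w.apply_symm_apply v

lemma root_mem_realRoots (i : ι) : B.root i ∈ B.realRoots :=
  ⟨B.coroot i, 1, one_mem _, i, rfl, rfl⟩

variable {B} {f : Module.Dual ℝ V}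

lemma act_mem_realRoots (hf : f ∈ B.realRoots) {w : V ≃ₗ[ℝ] V} (hw : w ∈ B.vWeyl) :
    act w f ∈ B.realRoots := by
  obtain ⟨_, u, hu, i, rfl, rfl⟩ := hf
  exact ⟨_, w * u, mul_mem hw hu, i, (act_mul ..).symm, rfl⟩

lemma neg_mem_realRoots (hf : f ∈ B.realRoots) : -f ∈ B.realRoots := by
  obtain ⟨_, u, hu, i, rfl, rfl⟩ := hf
  refine ⟨_, u * B.refl i, mul_mem hu (B.refl_mem i), i, ?_, rfl⟩
  rw [act_mul, act_refl_root, act_neg]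

end SimpleRoots

namespace VectorialDatum

open SimpleRoots

section Algebra

variable {ι V : Type*} [Fintype ι] [AddCommGroup V] [Module ℝ V] (D : VectorialDatum ι V)

/-- The simple roots of the chamber `ε w C`, so that the facets of sign `ε` are the sets
`coneFace (D.chamberRoot ε w) J`. -/
def chamberRoot (ε : ℤˣ) (w : V ≃ₗ[ℝ] V) (i : ι) : Module.Dual ℝ V :=
  ((ε : ℤ) : ℝ) • act w (D.root i)

/-- The subgroup `W^v(J)`, inside `GL(V)`. -/
def parabolic (J : Set ι) : Subgroup (V ≃ₗ[ℝ] V) := Subgroup.closure (D.refl '' J)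

lemma parabolic_le (J : Set ι) : D.parabolic J ≤ D.vWeyl :=
  Subgroup.closure_mono (image_subset_range _ _)

variable {D} {ε : ℤˣ} {u u' w : V ≃ₗ[ℝ] V} {J J' : Set ι} {v : V} {F : Set V}
  {f : Module.Dual ℝ V}

lemma refl_mem_parabolic {i : ι} (hi : i ∈ J) : D.refl i ∈ D.parabolic J :=
  Subgroup.subset_closure ⟨i, hi, rfl⟩

lemma sign_smul_smul (ε : ℤˣ) (v : V) : ((ε : ℤ) : ℝ) • ((ε : ℤ) : ℝ) • v = v := by
  rcases Int.units_eq_one_or ε with rfl | rfl <;> simp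

lemma chamberRoot_apply (ε : ℤˣ) (w : V ≃ₗ[ℝ] V) (i : ι) (v : V) :
    D.chamberRoot ε w i v = D.root i (((ε : ℤ) : ℝ) • w⁻¹ v) :=
  (map_smul (D.root i) _ _).symm

lemma mem_coneFace_chamberRoot :
    v ∈ coneFace (D.chamberRoot ε w) J ↔ ((ε : ℤ) : ℝ) • w⁻¹ v ∈ coneFace D.root J := by
  simp only [coneFace, Set.mem_ofPred_eq, chamberRoot_apply]

lemma mem_closedConeFace_chamberRoot :
    v ∈ closedConeFace (D.chamberRoot ε w) J ↔
      ((ε : ℤ) : ℝ) • w⁻¹ v ∈ closedConeFace D.root J := by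
  simp only [closedConeFace, Set.mem_ofPred_eq, chamberRoot_apply]

lemma image_stdFacet (ε : ℤˣ) (w : V ≃ₗ[ℝ] V) (J : Set ι) :
    (fun v => ((ε : ℤ) : ℝ) • w v) '' D.stdFacet J = coneFace (D.chamberRoot ε w) J := by
  ext v
  rw [mem_coneFace_chamberRoot]
  constructor
  · rintro ⟨x, hx, rfl⟩
    have hxw : ((ε : ℤ) : ℝ) • w⁻¹ (((ε : ℤ) : ℝ) • w x) = x := by
      rw [map_smul, sign_smul_smul]
      exact w.symm_apply_apply x
    rwa [hxw]
  · intro h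
    refine ⟨_, h, ?_⟩
    simp only [map_smul, sign_smul_smul]
    exact w.apply_symm_apply v

lemma isFacetOfType_iff :
    D.IsFacetOfType ε J F ↔ ∃ w ∈ D.vWeyl, F = coneFace (D.chamberRoot ε w) J := by
  simp only [IsFacetOfType, image_stdFacet]

lemma isFacetOfType_coneFace (ε : ℤˣ) (hu : u ∈ D.vWeyl) (J : Set ι) :
    D.IsFacetOfType ε J (coneFace (D.chamberRoot ε u) J) := isFacetOfType_iff.2 ⟨u, hu, rfl⟩

lemma linearIndependent_chamberRoot (ε : ℤˣ) (w : V ≃ₗ[ℝ] V) :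
    LinearIndependent ℝ (D.chamberRoot ε w) :=
  (D.root_free.map' _ w.symm.dualMap.ker).units_smul
    fun _ => Units.map (Int.castRingHom ℝ).toMonoidHom ε

lemma chamberRoot_neg (ε : ℤˣ) (w : V ≃ₗ[ℝ] V) : D.chamberRoot (-ε) w = -D.chamberRoot ε w := by
  ext i v
  simp [chamberRoot]

lemma image_coneFace_chamberRoot (ε : ℤˣ) (u w : V ≃ₗ[ℝ] V) (J : Set ι) :
    u '' coneFace (D.chamberRoot ε w) J = coneFace (D.chamberRoot ε (u * w)) J := by
  ext v
  rw [u.image_eq_preimage_symm, mem_preimage, mem_coneFace_chamberRoot, mem_coneFace_chamberRoot,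
    mul_inv_rev]
  rfl

lemma act_mem_imag (hf : f ∈ D.imag) (hw : w ∈ D.vWeyl) : act w f ∈ D.imag := by
  rcases D.imag_pos_or_neg f hf with h | h
  · exact (D.imag_pos_stable f hf h w hw).1
  · simpa only [act_neg, neg_neg] using
      D.imag_neg _ (D.imag_pos_stable _ (D.imag_neg f hf) h w hw).1

lemma act_mem_roots (hf : f ∈ D.roots) (hw : w ∈ D.vWeyl) : act w f ∈ D.roots :=
  hf.imp (fun h => act_mem_realRoots h hw) fun h => act_mem_imag h hw

lemma neg_mem_roots (hf : f ∈ D.roots) : -f ∈ D.roots :=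
  hf.imp neg_mem_realRoots (D.imag_neg f)

lemma mem_posCone_or_neg_mem (hf : f ∈ D.roots) : f ∈ D.posCone ∨ -f ∈ D.posCone :=
  hf.elim (D.pos_or_neg f) (D.imag_pos_or_neg f)

lemma isNonnegComb_chamberRoot (h : act w⁻¹ f ∈ D.posCone) :
    IsNonnegComb (D.chamberRoot 1 w) f := by
  obtain ⟨c, hc, hf⟩ := h
  refine ⟨c, hc, ?_⟩
  rw [← act_act_inv w f, hf, act_sum]
  simp [chamberRoot, act_smul]

lemma isNonnegComb_chamberRoot_or_neg (hf : f ∈ D.roots) (ε : ℤˣ) (hw : w ∈ D.vWeyl) :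
    IsNonnegComb (D.chamberRoot ε w) f ∨ IsNonnegComb (D.chamberRoot ε w) (-f) := by
  have hpos : IsNonnegComb (D.chamberRoot 1 w) f ∨ IsNonnegComb (D.chamberRoot 1 w) (-f) :=
    (mem_posCone_or_neg_mem (act_mem_roots hf (inv_mem hw))).imp isNonnegComb_chamberRoot
      fun h => isNonnegComb_chamberRoot (by rwa [act_neg])
  rcases Int.units_eq_one_or ε with rfl | rfl
  · exact hpos
  · have hneg : ∀ g, IsNonnegComb (D.chamberRoot 1 w) g →
        IsNonnegComb (D.chamberRoot (-1) w) (-g) :=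
      fun g ⟨c, hc, hg⟩ => ⟨c, hc, by simp [hg, chamberRoot_neg]⟩
    exact (hpos.imp (hneg _) fun h => neg_neg f ▸ hneg _ h).symm

lemma parabolic_fixes (hv : v ∈ coneFace D.root J) (hw : w ∈ D.parabolic J) : w v = v := by
  induction hw using Subgroup.closure_induction with
  | mem x hx =>
    obtain ⟨i, hi, rfl⟩ := hx
    rw [refl_apply, hv.1 i hi, zero_smul, sub_zero]
  | one => rfl
  | mul x y _ _ hx hy => rw [LinearEquiv.mul_apply, hy, hx]
  | inv x _ hx =>
    nth_rewrite 1 [← hx]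
    exact x.symm_apply_apply v

lemma exists_length_mul_simple_lt (hv : v ∈ coneFace D.root J) {w : D.vWeyl} (hw : w ≠ 1)
    (hwv : (w : V ≃ₗ[ℝ] V) v ∈ closedConeFace D.root ∅) :
    ∃ i ∈ J, D.cs.length (w * D.cs.simple i) < D.cs.length w := by
  obtain ⟨i, hi⟩ := D.cs.exists_rightDescent_of_ne_one hw
  have hdesc : D.cs.length (w * D.cs.simple i) < D.cs.length w := hi
  refine ⟨i, ?_, hdesc⟩
  have hroot : -act (w : V ≃ₗ[ℝ] V) (D.root i) ∈ D.posCone :=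
    (D.pos_or_neg _ (act_mem_realRoots (D.root_mem_realRoots i) w.2)).resolve_left
      fun h => hdesc.not_gt ((D.pos_iff_length w i).1 h)
  have hle : 0 ≤ (-act (w : V ≃ₗ[ℝ] V) (D.root i)) ((w : V ≃ₗ[ℝ] V) v) :=
    IsNonnegComb.nonneg (b := D.root) hroot hwv
  rw [LinearMap.neg_apply, act_apply_apply, neg_nonneg] at hle
  by_contra hiJ
  exact hle.not_gt (hv.2 i hiJ)

lemma mem_parabolic_of_apply_mem_closedConeFace (hv : v ∈ coneFace D.root J) (w : D.vWeyl)
    (hwv : (w : V ≃ₗ[ℝ] V) v ∈ closedConeFace D.root ∅) : (w : V ≃ₗ[ℝ] V) ∈ D.parabolic J := by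
  induction hn : D.cs.length w using Nat.strong_induction_on generalizing w with
  | _ n ih =>
    by_cases hw : w = 1
    · exact hw ▸ one_mem _
    obtain ⟨i, hiJ, hlt⟩ := exists_length_mul_simple_lt hv hw hwv
    have hri := refl_mem_parabolic (D := D) hiJ
    have hcoe : ((w * D.cs.simple i : D.vWeyl) : V ≃ₗ[ℝ] V) = w * D.refl i := by
      rw [Subgroup.coe_mul, D.cs_simple]
    have hfix : ((w * D.cs.simple i : D.vWeyl) : V ≃ₗ[ℝ] V) v = (w : V ≃ₗ[ℝ] V) v := by
      rw [hcoe, LinearEquiv.mul_apply, parabolic_fixes hv hri]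
    have hmem := ih _ (hn ▸ hlt) (w * D.cs.simple i) (by rwa [hfix]) rfl
    rwa [hcoe, Subgroup.mul_mem_cancel_right _ hri] at hmem

lemma coneFace_chamberRoot_mul (hw : w ∈ D.parabolic J) :
    coneFace (D.chamberRoot ε (u * w)) J = coneFace (D.chamberRoot ε u) J := by
  have hstable : ∀ g ∈ D.parabolic J, ∀ x ∈ coneFace D.root J, g x ∈ coneFace D.root J :=
    fun g hg x hx => by rwa [parabolic_fixes hx hg]
  ext v
  rw [mem_coneFace_chamberRoot, mem_coneFace_chamberRoot, mul_inv_rev, LinearEquiv.mul_apply,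
    ← map_smul]
  refine ⟨fun h => ?_, hstable _ (inv_mem hw) _⟩
  have := hstable w hw _ h
  rwa [← LinearEquiv.mul_apply, mul_inv_cancel, LinearEquiv.coe_one, id_eq] at this

lemma mem_parabolic_of_mem_coneFace_of_mem_closedConeFace (hu : u ∈ D.vWeyl) (hu' : u' ∈ D.vWeyl)
    (hv : v ∈ coneFace (D.chamberRoot ε u) J) (hv' : v ∈ closedConeFace (D.chamberRoot ε u') J') :
    u⁻¹ * u' ∈ D.parabolic J ∧ J' ⊆ J := by
  rw [mem_coneFace_chamberRoot] at hv
  rw [mem_closedConeFace_chamberRoot] at hv'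
  have hmap : (u'⁻¹ * u) (((ε : ℤ) : ℝ) • u⁻¹ v) = ((ε : ℤ) : ℝ) • u'⁻¹ v := by
    rw [map_smul, ← LinearEquiv.mul_apply, mul_inv_cancel_right]
  have hmem : u'⁻¹ * u ∈ D.parabolic J :=
    mem_parabolic_of_apply_mem_closedConeFace hv ⟨_, mul_mem (inv_mem hu') hu⟩
      (by rw [hmap]; exact closedConeFace_anti (empty_subset _) hv')
  rw [← hmap, parabolic_fixes hv hmem] at hv'
  exact ⟨by simpa only [mul_inv_rev, inv_inv] using inv_mem hmem,
    subset_of_mem_coneFace_of_mem_closedConeFace hv hv'⟩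

lemma coneFace_subset_closedConeFace_iff (hu : u ∈ D.vWeyl) (hu' : u' ∈ D.vWeyl) :
    coneFace (D.chamberRoot ε u) J ⊆ closedConeFace (D.chamberRoot ε u') J' ↔
      u⁻¹ * u' ∈ D.parabolic J ∧ J' ⊆ J := by
  constructor
  · intro h
    obtain ⟨v, hv⟩ := coneFace_nonempty (D.linearIndependent_chamberRoot ε u) J
    exact mem_parabolic_of_mem_coneFace_of_mem_closedConeFace hu hu' hv (h hv)
  · rintro ⟨hmem, hJ⟩
    rw [← coneFace_chamberRoot_mul hmem, mul_inv_cancel_left]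
    exact coneFace_subset_closedConeFace.trans (closedConeFace_anti hJ)

lemma coneFace_chamberRoot_eq_iff (hu : u ∈ D.vWeyl) (hu' : u' ∈ D.vWeyl) :
    coneFace (D.chamberRoot ε u) J = coneFace (D.chamberRoot ε u') J' ↔
      u⁻¹ * u' ∈ D.parabolic J ∧ J' = J := by
  constructor
  · intro h
    obtain ⟨hmem, hJ'⟩ := (coneFace_subset_closedConeFace_iff hu hu').1
      (h.le.trans coneFace_subset_closedConeFace)
    obtain ⟨_, hJ⟩ := (coneFace_subset_closedConeFace_iff hu' hu).1
      (h.ge.trans coneFace_subset_closedConeFace)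
    exact ⟨hmem, hJ'.antisymm hJ⟩
  · rintro ⟨hmem, rfl⟩
    rw [← coneFace_chamberRoot_mul hmem, mul_inv_cancel_left]

lemma IsFacetOfType.image (hF : D.IsFacetOfType ε J F) (hw : w ∈ D.vWeyl) :
    D.IsFacetOfType ε J (w '' F) := by
  obtain ⟨u, hu, rfl⟩ := isFacetOfType_iff.1 hF
  exact isFacetOfType_iff.2 ⟨w * u, mul_mem hw hu, image_coneFace_chamberRoot ..⟩

lemma IsSphericalFacet.image (hF : D.IsSphericalFacet ε F) (hw : w ∈ D.vWeyl) :
    D.IsSphericalFacet ε (w '' F) := by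
  obtain ⟨J, hJ, hF⟩ := hF
  exact ⟨J, hJ, hF.image hw⟩

lemma IsSphericalFacet.isVFacet (hF : D.IsSphericalFacet ε F) : D.IsVFacet F := by
  obtain ⟨J, _, hF⟩ := hF
  exact ⟨ε, J, hF⟩

lemma IsFacetOfType.type_unique (h : D.IsFacetOfType ε J F) (h' : D.IsFacetOfType ε J' F) :
    J = J' := by
  obtain ⟨u, hu, rfl⟩ := isFacetOfType_iff.1 h
  obtain ⟨u', hu', h'⟩ := isFacetOfType_iff.1 h'
  exact ((coneFace_chamberRoot_eq_iff hu hu').1 h').2.symm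

lemma IsSphericalFacet.finite_fixator (hF : D.IsSphericalFacet ε F) :
    {w : V ≃ₗ[ℝ] V | w ∈ D.vWeyl ∧ ∀ v ∈ F, w v = v}.Finite := by
  obtain ⟨J, hJ, hF⟩ := hF
  obtain ⟨u, hu, rfl⟩ := isFacetOfType_iff.1 hF
  have hconj : ((fun g => u * g * u⁻¹) '' (D.parabolic J : Set (V ≃ₗ[ℝ] V))).Finite :=
    Finite.image _ hJ
  refine hconj.subset fun w hw => ?_
  obtain ⟨v, hv⟩ := coneFace_nonempty (D.linearIndependent_chamberRoot ε u) J
  have hwv : v ∈ coneFace (D.chamberRoot ε (w * u)) J := by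
    rw [← image_coneFace_chamberRoot]
    exact ⟨v, hv, hw.2 v hv⟩
  exact ⟨_, (mem_parabolic_of_mem_coneFace_of_mem_closedConeFace hu (mul_mem hw.1 hu) hv
    (coneFace_subset_closedConeFace hwv)).1, by group⟩

lemma IsVFacet.exists_eq_coneFace (hF : D.IsVFacet F) :
    ∃ ε, ∃ w ∈ D.vWeyl, ∃ J, F = coneFace (D.chamberRoot ε w) J := by
  obtain ⟨ε, J, hF⟩ := hF
  obtain ⟨w, hw, hF⟩ := isFacetOfType_iff.1 hF
  exact ⟨ε, w, hw, J, hF⟩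

lemma IsVFacet.nonempty (hF : D.IsVFacet F) : F.Nonempty := by
  obtain ⟨ε, w, _, J, rfl⟩ := hF.exists_eq_coneFace
  exact coneFace_nonempty (linearIndependent_chamberRoot ε w) J

lemma IsVFacet.smul_mem (hF : D.IsVFacet F) {t : ℝ} (ht : 0 < t) (hv : v ∈ F) : t • v ∈ F := by
  obtain ⟨ε, w, _, J, rfl⟩ := hF.exists_eq_coneFace
  exact smul_mem_coneFace ht hv

lemma IsVFacet.neg (hF : D.IsVFacet F) : D.IsVFacet (-F) := by
  obtain ⟨ε, w, hw, J, rfl⟩ := hF.exists_eq_coneFace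
  refine ⟨-ε, J, isFacetOfType_iff.2 ⟨w, hw, ?_⟩⟩
  ext v
  simp [mem_coneFace_chamberRoot]

end Algebra

section Normed

variable {ι V : Type*} [Fintype ι] [NormedAddCommGroup V] [NormedSpace ℝ V]
  [FiniteDimensional ℝ V] {D : VectorialDatum ι V} {ε : ℤˣ} {J J' : Set ι} {F F' G : Set V}
  {u v : V}

lemma closure_coneFace_chamberRoot (ε : ℤˣ) (w : V ≃ₗ[ℝ] V) (J : Set ι) :
    closure (coneFace (D.chamberRoot ε w) J) = closedConeFace (D.chamberRoot ε w) J :=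
  closure_coneFace (linearIndependent_chamberRoot ε w) J

lemma IsVFacet.add_mem (hF : D.IsVFacet F) (hu : u ∈ closure F) (hv : v ∈ F) : u + v ∈ F := by
  obtain ⟨ε, w, _, J, rfl⟩ := hF.exists_eq_coneFace
  rw [closure_coneFace_chamberRoot] at hu
  exact add_mem_coneFace hu hv

lemma IsVFacet.add_mem_closure (hF : D.IsVFacet F) (hu : u ∈ closure F) (hv : v ∈ closure F) :
    u + v ∈ closure F := by
  obtain ⟨ε, w, _, J, rfl⟩ := hF.exists_eq_coneFace
  rw [closure_coneFace_chamberRoot] at *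
  exact add_mem_closedConeFace hu hv

lemma IsVFacet.zero_mem_closure (hF : D.IsVFacet F) : (0 : V) ∈ closure F := by
  obtain ⟨ε, w, _, J, rfl⟩ := hF.exists_eq_coneFace
  rw [closure_coneFace_chamberRoot]
  exact zero_mem_closedConeFace

lemma IsVFacet.nonneg (hF : D.IsVFacet F) {f : Module.Dual ℝ V} (hf : f ∈ D.roots) (hv : v ∈ F)
    (hfv : 0 ≤ f v) (hu : u ∈ closure F) : 0 ≤ f u := by
  obtain ⟨ε, w, hw, J, rfl⟩ := hF.exists_eq_coneFace
  rw [closure_coneFace_chamberRoot] at hu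
  exact nonneg_on_closedConeFace (isNonnegComb_chamberRoot_or_neg hf ε hw) hv hfv hu

lemma IsFacetOfType.eq_of_subset_closure (hF : D.IsFacetOfType ε J F)
    (hG : D.IsFacetOfType ε J' G) (h : F ⊆ closure G) (h' : G ⊆ closure F) : F = G := by
  obtain ⟨u, hu, rfl⟩ := isFacetOfType_iff.1 hF
  obtain ⟨u', hu', rfl⟩ := isFacetOfType_iff.1 hG
  rw [closure_coneFace_chamberRoot] at h h'
  obtain ⟨hmem, hJ'⟩ := (coneFace_subset_closedConeFace_iff hu hu').1 h
  obtain ⟨_, hJ⟩ := (coneFace_subset_closedConeFace_iff hu' hu).1 h'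
  exact (coneFace_chamberRoot_eq_iff hu hu').2 ⟨hmem, hJ'.antisymm hJ⟩

lemma IsFacetOfType.eq_of_subset_closure_of_type (hF : D.IsFacetOfType ε J F)
    (hF' : D.IsFacetOfType ε J F') (hG : D.IsFacetOfType ε J' G) (h : F ⊆ closure G)
    (h' : F' ⊆ closure G) : F = F' := by
  obtain ⟨u, hu, rfl⟩ := isFacetOfType_iff.1 hF
  obtain ⟨u', hu', rfl⟩ := isFacetOfType_iff.1 hF'
  obtain ⟨x, hx, rfl⟩ := isFacetOfType_iff.1 hG
  rw [closure_coneFace_chamberRoot] at h h'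
  obtain ⟨hux, _⟩ := (coneFace_subset_closedConeFace_iff hu hx).1 h
  obtain ⟨hux', _⟩ := (coneFace_subset_closedConeFace_iff hu' hx).1 h'
  refine (coneFace_chamberRoot_eq_iff hu hu').2 ⟨?_, rfl⟩
  simpa only [mul_inv_rev, inv_inv, mul_assoc, mul_inv_cancel_left]
    using mul_mem hux (inv_mem hux')

end Normed

end VectorialDatum

/-! ## Spherical facets lie in the interior of the Tits cone -/

lemma exists_invariant_posDef_form {G V : Type*} [Group G] [Finite G] [AddCommGroup V] [Module ℝ V]
    [FiniteDimensional ℝ V] (ρ : G →* (V ≃ₗ[ℝ] V)) :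
    ∃ B : LinearMap.BilinForm ℝ V, B.IsSymm ∧ (∀ v, v ≠ 0 → 0 < B v v) ∧
      ∀ g u v, B (ρ g u) (ρ g v) = B u v := by
  have := Fintype.ofFinite G
  let L : V ≃ₗ[ℝ] EuclideanSpace ℝ (Fin (Module.finrank ℝ V)) :=
    (Module.finBasis ℝ V).equivFun.trans (WithLp.linearEquiv 2 ℝ _).symm
  let B : LinearMap.BilinForm ℝ V := ∑ g : G,
    (innerₗ (EuclideanSpace ℝ (Fin (Module.finrank ℝ V)))).compl₁₂ (L ∘ₗ (ρ g : V →ₗ[ℝ] V))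
      (L ∘ₗ (ρ g : V →ₗ[ℝ] V))
  have hB : ∀ u v, B u v = ∑ g : G, inner ℝ (L (ρ g u)) (L (ρ g v)) := fun u v => by
    simp [B, LinearMap.sum_apply]
  refine ⟨B, ⟨fun u v => ?_⟩, fun v hv => ?_, fun g u v => ?_⟩
  · simp only [hB, real_inner_comm]
  · rw [hB]
    exact Finset.sum_pos (fun g _ => real_inner_self_pos.2 (by simpa using hv)) Finset.univ_nonempty
  · rw [hB, hB]
    exact Fintype.sum_equiv (Equiv.mulRight g) _ _ fun h => by
      rw [Equiv.coe_mulRight, map_mul]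
      rfl

namespace VectorialDatum

open SimpleRoots

variable {ι V : Type*} [Fintype ι] [AddCommGroup V] [Module ℝ V] [FiniteDimensional ℝ V]
  {D : VectorialDatum ι V}

-- For an invariant scalar product, a point of the orbit of `u` whose product with a point of the
-- chamber is maximal is dominant.
lemma IsSpherical.exists_dominant {J : Set ι} (hJ : D.IsSpherical J) (u : V) :
    ∃ g ∈ D.parabolic J, ∀ j ∈ J, 0 ≤ D.root j (g u) := by
  have : Finite (D.parabolic J) := hJ
  obtain ⟨B, -, hpos, hinv⟩ := exists_invariant_posDef_form (D.parabolic J).subtype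
  obtain ⟨c, hc⟩ := exists_forall_dual_apply_eq D.root_free fun _ => 1
  have hcoroot : ∀ j ∈ J, 0 < B (D.coroot j) c := fun j hj => by
    have hrefl := hinv ⟨_, refl_mem_parabolic hj⟩ (D.coroot j) c
    rw [Subgroup.subtype_apply, refl_coroot, refl_apply, hc, one_smul, map_neg, map_sub,
      LinearMap.neg_apply, LinearMap.neg_apply] at hrefl
    linarith [hpos _ (D.coroot_ne_zero j)]
  obtain ⟨g, hg⟩ := Finite.exists_max fun g : D.parabolic J => B (g.1 u) c
  refine ⟨g, g.2, fun j hj => ?_⟩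
  have hmax : B (D.refl j (g.1 u)) c ≤ B (g.1 u) c :=
    hg ((⟨D.refl j, refl_mem_parabolic hj⟩ : D.parabolic J) * g)
  rw [refl_apply, map_sub, map_smul, LinearMap.sub_apply, LinearMap.smul_apply, smul_eq_mul] at hmax
  exact nonneg_of_mul_nonneg_left (by linarith) (hcoroot j hj)

lemma IsSphericalFacet.exists_add_smul_mem {ε : ℤˣ} {F : Set V} (hF : D.IsSphericalFacet ε F)
    {v : V} (hv : v ∈ F) (u : V) : ∃ t : ℝ, 0 < t ∧ ∃ F₁, D.IsVFacet F₁ ∧ u + t • v ∈ F₁ := by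
  obtain ⟨J, hJ, hF⟩ := hF
  obtain ⟨w, hw, rfl⟩ := isFacetOfType_iff.1 hF
  rw [mem_coneFace_chamberRoot] at hv
  obtain ⟨g, hg, hdom⟩ := IsSpherical.exists_dominant hJ (((ε : ℤ) : ℝ) • w⁻¹ u)
  set v' := ((ε : ℤ) : ℝ) • w⁻¹ v
  set u' := ((ε : ℤ) : ℝ) • w⁻¹ u
  have hroot : ∀ i (t : ℝ), D.root i (g (u' + t • v')) = D.root i (g u') + t * D.root i v' :=
    fun i t => by
      rw [map_add g, map_smul g t, parabolic_fixes hv hg, map_add, map_smul (D.root i) t,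
        smul_eq_mul]
  have hlarge : ∀ᶠ t : ℝ in atTop, ∀ i, 0 ≤ D.root i (g (u' + t • v')) := by
    refine eventually_all.2 fun i => ?_
    simp only [hroot]
    by_cases hi : i ∈ J
    · simp [hv.1 i hi, hdom i hi]
    · exact (tendsto_atTop_add_const_left _ _
        (tendsto_id.atTop_mul_const (hv.2 i hi))).eventually_ge_atTop 0
  obtain ⟨t, ht, ht0⟩ := (hlarge.and (eventually_gt_atTop 0)).exists
  have hmove : ((ε : ℤ) : ℝ) • (w * g⁻¹)⁻¹ (u + t • v) = g (u' + t • v') := by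
    rw [mul_inv_rev, inv_inv, LinearEquiv.mul_apply, ← map_smul, map_add, smul_add, map_smul _ t,
      smul_comm]
  refine ⟨t, ht0, coneFace (D.chamberRoot ε (w * g⁻¹)) {i | D.root i (g (u' + t • v')) = 0},
    ⟨ε, _, isFacetOfType_coneFace ε (mul_mem hw (inv_mem (D.parabolic_le J hg))) _⟩, ?_⟩
  rw [mem_coneFace_chamberRoot, hmove]
  exact ⟨fun i hi => hi, fun i hi => (ht i).lt_of_ne' hi⟩

end VectorialDatum

/-! ## Germs of sector faces and of chimneys in the model apartment -/

section FilterAdd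

variable {V : Type*} [AddCommGroup V] {B : Filter V} {F S : Set V}

lemma mem_add_principal : S ∈ B + 𝓟 F ↔ ∃ b ∈ B, ∀ x ∈ b, ∀ v ∈ F, x + v ∈ S := by
  constructor
  · intro h
    obtain ⟨b, hb, G, hG, hsub⟩ := Filter.mem_add.1 h
    exact ⟨b, hb, fun x hx v hv => hsub (add_mem_add hx (hG hv))⟩
  · rintro ⟨b, hb, h⟩
    exact Filter.mem_add.2 ⟨b, hb, F, mem_principal_self F, add_subset_iff.2 h⟩

lemma mem_add_pure_add_principal {ξ : V} :
    S ∈ B + pure ξ + 𝓟 F ↔ ∃ b ∈ B, ∀ x ∈ b, ∀ v ∈ F, x + ξ + v ∈ S := by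
  rw [mem_add_principal, Filter.add_pure]
  constructor
  · rintro ⟨b, hb, h⟩
    exact ⟨_, hb, fun x hx => h _ hx⟩
  · rintro ⟨b, hb, h⟩
    exact ⟨_, image_mem_map hb, forall_mem_image.2 h⟩

lemma principal_image_add (x : V) (F : Set V) : 𝓟 ((fun v => x + v) '' F) = pure x + 𝓟 F := by
  rw [Filter.pure_add, map_principal]

end FilterAdd

lemma image_closure_linearEquiv {V : Type*} [NormedAddCommGroup V] [NormedSpace ℝ V]
    [FiniteDimensional ℝ V] (u : V ≃ₗ[ℝ] V) (F : Set V) : u '' closure F = closure (u '' F) :=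
  u.toContinuousLinearEquiv.image_closure F

lemma nonneg_of_forall_pos_add_mul {a b : ℝ} (h : ∀ t, 0 < t → 0 ≤ a + t * b) : 0 ≤ b := by
  by_contra! hb
  obtain ⟨t, htb, ht⟩ := (((tendsto_id.atTop_mul_const_of_neg hb).eventually_lt_atBot (-a)).and
    (eventually_gt_atTop (0 : ℝ))).exists
  rw [id_eq] at htb
  linarith [h t ht]

lemma inv_apply_add_of_linear_part {V : Type*} [AddCommGroup V] [Module ℝ V] {w : Equiv.Perm V}
    {u : V ≃ₗ[ℝ] V} (hw : ∀ x v, w (x + v) = w x + u v) (x v : V) :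
    w⁻¹ (x + v) = w⁻¹ x + u⁻¹ v := by
  apply w.injective
  have huv : u (u⁻¹ v) = v := u.apply_symm_apply v
  have hww : ∀ y, w (w⁻¹ y) = y := w.apply_symm_apply
  rw [hw, huv, hww, hww]

namespace ModelApartment

open VectorialDatum SimpleRoots

section Algebra

variable {ι V : Type*} [Fintype ι] [AddCommGroup V] [Module ℝ V] {𝔸 : ModelApartment ι V}

lemma cl_mono {F G : Filter V} (h : F ≤ G) : 𝔸.cl F ≤ 𝔸.cl G := by
  rintro S ⟨k, hk, hG, hS⟩
  exact ⟨k, hk, h hG, hS⟩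

lemma le_cl (F : Filter V) : F ≤ 𝔸.cl F := by
  rintro S ⟨k, _, hF, hS⟩
  exact mem_of_superset hF hS

lemma exists_linear_of_mem_weyl {w : Equiv.Perm V} (hw : w ∈ 𝔸.weyl) :
    ∃ u ∈ 𝔸.vWeyl, ∀ x v, w (x + v) = w x + u v := by
  induction hw using Subgroup.closure_induction with
  | mem g hg =>
    obtain ⟨α, a, k, ⟨u, hu, i, rfl, rfl⟩, _, hg⟩ := hg
    refine ⟨u * 𝔸.refl i * u⁻¹, mul_mem (mul_mem hu (𝔸.refl_mem i)) (inv_mem hu), fun x v => ?_⟩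
    rw [conj_refl_apply, hg, hg, map_add]
    module
  | one => exact ⟨1, one_mem _, fun x v => rfl⟩
  | mul x y _ _ hx hy =>
    obtain ⟨u, hu, hx⟩ := hx
    obtain ⟨u', hu', hy⟩ := hy
    refine ⟨u * u', mul_mem hu hu', fun z v => ?_⟩
    rw [Equiv.Perm.mul_apply, hy, hx]
    rfl
  | inv x _ hx =>
    obtain ⟨u, hu, hx⟩ := hx
    exact ⟨u⁻¹, inv_mem hu, inv_apply_add_of_linear_part hx⟩

end Algebra

variable {ι V : Type*} [Fintype ι] [NormedAddCommGroup V] [NormedSpace ℝ V]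
  {𝔸 : ModelApartment ι V} {F F₁ G : Set V} {x y u v ξ η : V} {k : Module.Dual ℝ V → WithTop ℝ}

lemma localFacet_le_facet (x : V) (F : Set V) : localFacet x F ≤ 𝔸.facet x F := by
  rintro S ⟨k, o, _, hlocal, hS⟩
  exact mem_of_superset hlocal hS

lemma tendsto_add_smul_localFacet (hF : 𝔸.IsVFacet F) (hη : η ∈ F) (x : V) :
    Tendsto (fun s : ℝ => x + s • η) (𝓝[>] 0) (localFacet x F) := by
  refine tendsto_nhdsWithin_iff.2 ⟨tendsto_add_smul_nhdsGT_zero x η, ?_⟩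
  filter_upwards [self_mem_nhdsWithin] with s hs
  exact ⟨s • η, hF.smul_mem hs hη, rfl⟩

variable [FiniteDimensional ℝ V]

lemma pure_add_principal_le (hF : 𝔸.IsVFacet F) (hη : η ∈ closure F) : pure η + 𝓟 F ≤ 𝓟 F := by
  rw [← principal_image_add, principal_mono]
  rintro _ ⟨v, hv, rfl⟩
  exact hF.add_mem hη hv

lemma add_pure_add_principal_le (hF : 𝔸.IsVFacet F) (B : Filter V) (ξ : V) (hη : η ∈ closure F) :
    B + pure (ξ + η) + 𝓟 F ≤ B + pure ξ + 𝓟 F := by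
  rw [← Filter.pure_add_pure, ← add_assoc, add_assoc (B + pure ξ)]
  exact add_le_add_right (pure_add_principal_le hF hη) _

lemma mem_sectorFaceGerm (hF : 𝔸.IsVFacet F) {S : Set V} :
    S ∈ sectorFaceGerm x F ↔ ∃ ξ ∈ closure F, ∀ v ∈ F, x + ξ + v ∈ S := by
  have hanti : ∀ ξ, ∀ η ∈ closure F,
      𝓟 ((fun v => x + (ξ + η) + v) '' F) ≤ 𝓟 ((fun v => x + ξ + v) '' F) := fun ξ η hη => by
    simpa only [principal_image_add, Filter.pure_add_pure] using
      add_pure_add_principal_le hF (pure x) ξ hη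
  unfold sectorFaceGerm
  rw [mem_biInf_of_directed]
  · simp only [mem_principal, subset_def, forall_mem_image]
  · exact fun ξ hξ η hη => ⟨ξ + η, hF.add_mem_closure hξ hη, hanti ξ η hη,
      add_comm ξ η ▸ hanti η ξ hξ⟩
  · exact ⟨0, hF.zero_mem_closure⟩

lemma mem_chimneyGerm {B : Filter V} (hF : 𝔸.IsVFacet F) {S : Set V} :
    S ∈ 𝔸.chimneyGerm B F ↔ ∃ ξ ∈ closure F, S ∈ 𝔸.cl (B + pure ξ + 𝓟 F) := by
  have hanti : ∀ ξ, ∀ η ∈ closure F,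
      𝔸.cl (B + pure (ξ + η) + 𝓟 F) ≤ 𝔸.cl (B + pure ξ + 𝓟 F) :=
    fun ξ η hη => cl_mono (add_pure_add_principal_le hF B ξ hη)
  unfold chimneyGerm
  rw [mem_biInf_of_directed]
  · exact fun ξ hξ η hη => ⟨ξ + η, hF.add_mem_closure hξ hη, hanti ξ η hη,
      add_comm ξ η ▸ hanti η ξ hξ⟩
  · exact ⟨0, hF.zero_mem_closure⟩

lemma sectorFaceGerm_add (hF : 𝔸.IsVFacet F) (hξ : ξ ∈ closure F) :
    sectorFaceGerm (x + ξ) F = sectorFaceGerm x F := by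
  ext S
  rw [mem_sectorFaceGerm hF, mem_sectorFaceGerm hF]
  constructor
  · rintro ⟨η, hη, h⟩
    exact ⟨ξ + η, hF.add_mem_closure hξ hη, by simpa only [add_assoc] using h⟩
  · rintro ⟨η, hη, h⟩
    refine ⟨η, hη, fun v hv => ?_⟩
    rw [add_right_comm x, add_assoc]
    exact h _ (hF.add_mem hξ hv)

lemma subset_closure_of_sectorFaceGerm_le (hF : 𝔸.IsVFacet F) (hG : 𝔸.IsVFacet G)
    (h : sectorFaceGerm y G ≤ sectorFaceGerm x F) : G ⊆ closure F := by
  have hmem : (fun v => x + v) '' F ∈ sectorFaceGerm x F :=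
    (mem_sectorFaceGerm hF).2 ⟨0, hF.zero_mem_closure, fun v hv => ⟨v, hv, by simp⟩⟩
  obtain ⟨ξ, _, hsub⟩ := (mem_sectorFaceGerm hG).1 (h hmem)
  intro v hv
  refine mem_closure_of_tendsto (tendsto_add_smul_nhdsGT_zero v (y + ξ - x)) ?_
  filter_upwards [self_mem_nhdsWithin] with t ht
  obtain ⟨f, hf, hfv⟩ := hsub (t⁻¹ • v) (hG.smul_mem (inv_pos.2 ht) hv)
  have hft : t • f = v + t • (y + ξ - x) := by
    rw [eq_sub_of_add_eq' hfv, add_sub_right_comm, smul_add, smul_inv_smul₀ (ne_of_gt ht), add_comm]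
  exact hft ▸ hF.smul_mem ht hf

lemma direction_unique {ε : ℤˣ} (hF : 𝔸.IsSphericalFacet ε F) (hG : 𝔸.IsSphericalFacet ε G)
    (h : sectorFaceGerm x F = sectorFaceGerm y G) : F = G := by
  have hFG := subset_closure_of_sectorFaceGerm_le hG.isVFacet hF.isVFacet h.le
  have hGF := subset_closure_of_sectorFaceGerm_le hF.isVFacet hG.isVFacet h.ge
  obtain ⟨_, _, hF⟩ := hF
  obtain ⟨_, _, hG⟩ := hG
  exact hF.eq_of_subset_closure hG hFG hGF

lemma map_sectorFaceGerm (hF : 𝔸.IsVFacet F) {w : V → V} {u : V ≃ₗ[ℝ] V} (hu : u ∈ 𝔸.vWeyl)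
    (hw : ∀ x v, w (x + v) = w x + u v) :
    map w (sectorFaceGerm x F) = sectorFaceGerm (w x) (u '' F) := by
  have hF' : 𝔸.IsVFacet (u '' F) := by
    obtain ⟨ε, J, h⟩ := hF
    exact ⟨ε, J, h.image hu⟩
  ext S
  rw [mem_map, mem_sectorFaceGerm hF, mem_sectorFaceGerm hF',
    ← image_closure_linearEquiv]
  simp only [mem_preimage, hw, exists_mem_image, forall_mem_image]

lemma add_mem_halfSpaceInter (hF : 𝔸.IsVFacet F) (hv : v ∈ F)
    (h : ∀ t : ℝ, 0 < t → x + t • v ∈ 𝔸.halfSpaceInter k ∅) (hy : y ∈ 𝔸.halfSpaceInter k ∅)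
    (hu : u ∈ closure F) : y + u ∈ 𝔸.halfSpaceInter k ∅ := by
  refine fun α hα r hr => ⟨?_, fun hα => hα.elim⟩
  have hαv : 0 ≤ α v := nonneg_of_forall_pos_add_mul (a := α x + r) fun t ht => by
    simpa [add_right_comm] using (h t ht α hα r hr).1
  rw [map_add, add_right_comm]
  exact add_nonneg (hy α hα r hr).1 (hF.nonneg hα hv hαv hu)

lemma isClosed_halfSpaceInter (k : Module.Dual ℝ V → WithTop ℝ) :
    IsClosed (𝔸.halfSpaceInter k ∅) := by
  have hinter : 𝔸.halfSpaceInter k ∅ =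
      ⋂ α ∈ 𝔸.roots, ⋂ r : ℝ, ⋂ (_ : k α = r), {x | 0 ≤ α x + r} := by
    ext x
    simp [halfSpaceInter]
  rw [hinter]
  exact isClosed_biInter fun α _ => isClosed_iInter fun r => isClosed_iInter fun _ =>
    isClosed_le continuous_const (α.continuous_of_finiteDimensional.add continuous_const)

lemma add_mem_of_mem_cl_sectorFace {S : Set V} (hS : S ∈ 𝔸.cl (𝓟 ((fun v => x + v) '' F)))
    (hu : u ∈ closure F) : x + u ∈ S := by
  obtain ⟨k, _, hF, hS⟩ := hS
  refine hS (closure_minimal hF (isClosed_halfSpaceInter k) ?_)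
  exact ((Homeomorph.addLeft x).image_closure F).le ⟨u, hu, rfl⟩

lemma cl_sectorFace_le_cl_ray (hF : 𝔸.IsVFacet F) (hv : v ∈ F) :
    𝔸.cl (𝓟 ((fun v => x + v) '' F)) ≤
      𝔸.cl (𝓟 ((fun t : ℝ => x + t • (x + v - x)) '' Ici 0)) := by
  rintro S ⟨k, hk, hray, hS⟩
  have hmem : ∀ t : ℝ, 0 ≤ t → x + t • v ∈ 𝔸.halfSpaceInter k ∅ := fun t ht =>
    hray ⟨t, ht, by simp⟩
  refine ⟨k, hk, ?_, hS⟩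
  rintro _ ⟨u, hu, rfl⟩
  exact add_mem_halfSpaceInter hF hv (fun t ht => hmem t ht.le) (by simpa using hmem 0 le_rfl)
    (subset_closure hu)

lemma chimneyGerm_le_cl_sectorFace (hF : 𝔸.IsVFacet F) :
    𝔸.chimneyGerm (𝔸.facet x F) F ≤ 𝔸.cl (𝓟 ((fun v => x + v) '' F)) := by
  rintro S ⟨k, hk, hsector, hS⟩
  obtain ⟨η, hη⟩ := hF.nonempty
  refine (mem_chimneyGerm hF).2 ⟨0, hF.zero_mem_closure, k, hk,
    mem_add_pure_add_principal.2 ⟨𝔸.halfSpaceInter k ∅, ?_, fun y hy v hv => ?_⟩, hS⟩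
  · exact ⟨k, ∅, hk, mem_of_superset self_mem_nhdsWithin hsector, Subset.rfl⟩
  · rw [add_zero]
    exact add_mem_halfSpaceInter hF hη (fun t ht => hsector ⟨_, hF.smul_mem ht hη, rfl⟩) hy
      (subset_closure hv)

lemma exists_forall_add_mem_of_mem_facet (hF₁ : 𝔸.IsVFacet F₁) (hη : η ∈ F₁) {b : Set V}
    (hb : b ∈ 𝔸.facet x F₁) (h : ∀ y ∈ b, ∀ v ∈ F, y + ξ + v ∈ 𝔸.halfSpaceInter k ∅) :
    ∃ δ > 0, ∀ s : ℝ, 0 ≤ s → s < δ → ∀ v ∈ F, x + s • η + ξ + v ∈ 𝔸.halfSpaceInter k ∅ := by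
  obtain ⟨δ, hδ, hδb⟩ := mem_nhdsGT_iff_exists_Ioo_subset.1
    (tendsto_add_smul_localFacet hF₁ hη x (localFacet_le_facet x F₁ hb))
  have hpos : ∀ s ∈ Ioo 0 δ, ∀ v ∈ F, x + s • η + ξ + v ∈ 𝔸.halfSpaceInter k ∅ :=
    fun s hs => h _ (hδb hs)
  refine ⟨δ, hδ, fun s hs hsδ v hv => ?_⟩
  rcases hs.eq_or_lt with rfl | hs
  · have hlim : Tendsto (fun s : ℝ => x + s • η + ξ + v) (𝓝[>] 0) (𝓝 (x + ξ + v)) :=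
      ((tendsto_add_smul_nhdsGT_zero x η).add_const ξ).add_const v
    rw [zero_smul, add_zero]
    refine (isClosed_halfSpaceInter k).mem_of_tendsto hlim ?_
    filter_upwards [Ioo_mem_nhdsGT hδ] with s hs using hpos s hs v hv
  · exact hpos s ⟨hs, hsδ⟩ v hv

lemma exists_mem_sectorFaceGerm_of_mem_chimneyGerm (hF : 𝔸.IsVFacet F) (hF₁ : 𝔸.IsVFacet F₁)
    (hη : η ∈ F₁) {S : Set V} (hS : S ∈ 𝔸.chimneyGerm (𝔸.facet x F₁) F) :
    ∃ δ > 0, ∀ s : ℝ, 0 ≤ s → s < δ → S ∈ sectorFaceGerm (x + s • η) F := by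
  obtain ⟨ξ, hξ, k, _, hchimney, hsub⟩ := (mem_chimneyGerm hF).1 hS
  obtain ⟨b, hb, h⟩ := mem_add_pure_add_principal.1 hchimney
  obtain ⟨δ, hδ, hδ'⟩ := exists_forall_add_mem_of_mem_facet hF₁ hη hb h
  exact ⟨δ, hδ, fun s hs hsδ =>
    (mem_sectorFaceGerm hF).2 ⟨ξ, hξ, fun v hv => hsub (hδ' s hs hsδ v hv)⟩⟩

lemma sectorFaceGerm_le_chimneyGerm (hF : 𝔸.IsVFacet F) (hF₁ : 𝔸.IsVFacet F₁) :
    sectorFaceGerm x F ≤ 𝔸.chimneyGerm (𝔸.facet x F₁) F := by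
  intro S hS
  obtain ⟨η, hη⟩ := hF₁.nonempty
  obtain ⟨δ, hδ, h⟩ := exists_mem_sectorFaceGerm_of_mem_chimneyGerm hF hF₁ hη hS
  simpa using h 0 le_rfl hδ

lemma hasFiniteFixator_chimney {ε : ℤˣ} (hF : 𝔸.IsSphericalFacet ε F) :
    𝔸.HasFiniteFixator (𝔸.chimney (𝔸.facet x F) F) := by
  have hF' := hF.isVFacet
  refine hF.finite_fixator.subset fun w hw => ⟨hw.1, fun v hv => hw.2 v ?_⟩
  have hsupp : ∀ v ∈ F, x + v ∈ supp (𝔸.chimney (𝔸.facet x F) F) := by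
    intro v hv
    refine (AffineSubspace.mem_sInf_iff _ _).2 fun E hE => ?_
    obtain ⟨k, _, hchimney, hsub⟩ := hE
    obtain ⟨b, hb, h⟩ := mem_add_principal.1 hchimney
    obtain ⟨δ, hδ, hδ'⟩ := exists_forall_add_mem_of_mem_facet (ξ := 0) hF' hv hb
      fun y hy v hv => by rw [add_zero]; exact h y hy v hv
    simpa using hsub (hδ' 0 le_rfl hδ v hv)
  simpa [two_smul] using
    AffineSubspace.vsub_mem_direction (hsupp _ (hF'.smul_mem two_pos hv)) (hsupp v hv)

end ModelApartment

/-! ## Relative position of germs of sector faces in a hovel -/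

namespace ModelApartment

open VectorialDatum

variable {ι V : Type*} [Fintype ι] [NormedAddCommGroup V] [NormedSpace ℝ V]
  {𝔸 : ModelApartment ι V} {F F₁ : Set V} {ε : ℤˣ} {ρ : Set V → Set V → Prop}

variable (𝔸) in
/-- A relation between vectorial facets that is invariant under the vectorial Weyl group. Equality
and the face relation, which define parallelism and dominance, are of this kind. -/
def IsInvariant (ρ : Set V → Set V → Prop) : Prop :=
  ∀ u ∈ 𝔸.vWeyl, ∀ F G, ρ F G → ρ (u '' F) (u '' G)

lemma isInvariant_eq : 𝔸.IsInvariant Eq := fun _ _ _ _ h => h ▸ rfl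

lemma IsInvariant.flip (hρ : 𝔸.IsInvariant ρ) : 𝔸.IsInvariant (flip ρ) :=
  fun u hu F G h => hρ u hu G F h

lemma isSplayedChimneyGerm_chimneyGerm (hF : 𝔸.IsSphericalFacet ε F) (hF₁ : 𝔸.IsVFacet F₁) (x : V) :
    𝔸.IsSplayedChimneyGerm (𝔸.chimneyGerm (𝔸.facet x F₁) F) :=
  ⟨_, _, ⟨_, _, hF₁, rfl⟩, ⟨ε, hF⟩, rfl⟩

variable [FiniteDimensional ℝ V]

lemma isInvariant_subset_closure : 𝔸.IsInvariant fun F G => G ⊆ closure F := fun u _ F _ h =>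
  (image_mono h).trans (image_closure_linearEquiv u F).subset

lemma isSolidChimneyGerm_chimneyGerm (hF : 𝔸.IsSphericalFacet ε F) (x : V) :
    𝔸.IsSolidChimneyGerm (𝔸.chimneyGerm (𝔸.facet x F) F) :=
  ⟨_, _, ⟨_, _, hF.isVFacet, rfl⟩, hF.isVFacet, hasFiniteFixator_chimney hF, rfl⟩

end ModelApartment

namespace AffineHovel

open ModelApartment VectorialDatum SimpleRoots

variable {ι V : Type*} [Fintype ι] [NormedAddCommGroup V] [NormedSpace ℝ V]
  {𝔸 : ModelApartment ι V} {X : Type*} {H : AffineHovel 𝔸 X} {F F₁ G K L : Set V}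
  {x x' y a b η : V} {f g h : V → X} {ε ε' : ℤˣ} {ρ : Set V → Set V → Prop}

lemma exists_weyl_of_range_eq (hf : f ∈ H.charts) (hg : g ∈ H.charts) (h : range g = range f) :
    ∃ w ∈ 𝔸.weyl, g = f ∘ w :=
  (H.charts_orbit f hf g).1 ⟨hg, h⟩

variable (H) in
/-- In some apartment the directions of the germs `𝔉` and `𝔊` are in the relation `ρ`. This is
parallelism if `ρ` is equality and dominance if `ρ` is the face relation. -/
def InPosition (ε : ℤˣ) (ρ : Set V → Set V → Prop) (𝔉 𝔊 : Filter X) : Prop :=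
  ∃ f ∈ H.charts, ∃ x y F G, 𝔸.IsSphericalFacet ε F ∧ 𝔸.IsSphericalFacet ε G ∧
    𝔉 = map f (sectorFaceGerm x F) ∧ 𝔊 = map f (sectorFaceGerm y G) ∧ ρ F G

lemma InPosition.flip {𝔉 𝔊 : Filter X} (h : H.InPosition ε ρ 𝔉 𝔊) :
    H.InPosition ε (flip ρ) 𝔊 𝔉 := by
  obtain ⟨f, hf, x, y, F, G, hF, hG, h𝔉, h𝔊, h⟩ := h
  exact ⟨f, hf, y, x, G, F, hG, hF, h𝔊, h𝔉, h⟩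

lemma parallel_iff {𝔉 𝔊 : H.FaceGerm ε} : H.Parallel ε 𝔉 𝔊 ↔ H.InPosition ε Eq 𝔉.1 𝔊.1 := by
  constructor
  · rintro ⟨f, hf, x, y, F, hF, h𝔉, h𝔊⟩
    exact ⟨f, hf, x, y, F, F, hF, hF, h𝔉, h𝔊, rfl⟩
  · rintro ⟨f, hf, x, y, F, _, hF, _, h𝔉, h𝔊, rfl⟩
    exact ⟨f, hf, x, y, F, hF, h𝔉, h𝔊⟩

lemma dominates_iff {𝔉 𝔊 : H.FaceGerm ε} :
    H.Dominates ε 𝔉 𝔊 ↔ H.InPosition ε (fun F G => G ⊆ closure F) 𝔉.1 𝔊.1 := Iff.rfl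

lemma Parallel.symm {𝔉 𝔊 : H.FaceGerm ε} (h : H.Parallel ε 𝔉 𝔊) : H.Parallel ε 𝔊 𝔉 := by
  obtain ⟨f, hf, x, y, F, hF, h𝔉, h𝔊⟩ := h
  exact ⟨f, hf, y, x, F, hF, h𝔊, h𝔉⟩

variable [FiniteDimensional ℝ V]

-- A sector face of direction `F ≠ {0}` is contained in the enclosure of any ray with the same
-- origin and direction in `F`; if `F = {0}`, it is a point. In both cases (MA2) applies.
lemma exists_chart_fixing_sectorFace (hf : f ∈ H.charts) (hg : g ∈ H.charts)
    (hF : 𝔸.IsSphericalFacet ε F) (h : range g ∈ map f (sectorFaceGerm x F)) :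
    ∃ ξ ∈ closure F, range g ∈ map f (𝔸.cl (𝓟 ((fun v => x + ξ + v) '' F))) ∧
      ∃ g' ∈ H.charts, range g' = range g ∧
        ∀ᶠ v in 𝔸.cl (𝓟 ((fun v => x + ξ + v) '' F)), g' v = f v := by
  have hF' := hF.isVFacet
  obtain ⟨ξ, hξ, h⟩ := (mem_sectorFaceGerm hF').1 h
  by_cases hne : ∃ v ∈ F, v ≠ 0
  · obtain ⟨v, hv, hv0⟩ := hne
    set z := x + (ξ + v) with hz
    have hray : 𝔸.IsGenericRay (𝓟 ((fun t : ℝ => z + t • (z + v - z)) '' Ici 0)) :=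
      ⟨z, z + v, by simpa using hv0, ⟨ε, F, hF, by simpa using hv⟩, rfl⟩
    have hmem : range g ∈ map f (𝓟 ((fun t : ℝ => z + t • (z + v - z)) '' Ici 0)) := by
      rw [mem_map, mem_principal]
      rintro _ ⟨t, ht, rfl⟩
      convert h ((1 + t) • v) (hF'.smul_mem (add_pos_of_pos_of_nonneg one_pos ht) hv) using 1
      rw [hz]
      module
    obtain ⟨hcl, g', hg', hr, hfix⟩ := H.ma2 f hf _ (Or.inr (Or.inr (Or.inl hray))) g hg hmem
    have hle := cl_sectorFace_le_cl_ray (x := z) hF' hv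
    exact ⟨ξ + v, hF'.add_mem_closure hξ (subset_closure hv), map_mono hle hcl, g', hg', hr,
      hle hfix⟩
  · push Not at hne
    have hF0 : F = {0} := by
      obtain ⟨v, hv⟩ := hF'.nonempty
      exact Subset.antisymm hne (singleton_subset_iff.2 (hne v hv ▸ hv))
    have hmem : range g ∈ map f (pure (x + ξ)) := by
      simpa using h 0 (hF0 ▸ mem_singleton 0)
    refine ⟨ξ, hξ, ?_⟩
    rw [hF0, image_singleton, add_zero, principal_singleton]
    exact H.ma2 f hf _ (Or.inl ⟨_, rfl⟩) g hg hmem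

lemma exists_chart_fixing_germs (hf : f ∈ H.charts) (hg : g ∈ H.charts)
    (hF : 𝔸.IsSphericalFacet ε F) (hG : 𝔸.IsSphericalFacet ε' G)
    (hgF : range g ∈ map f (sectorFaceGerm x F)) (hgG : range g ∈ map f (sectorFaceGerm y G)) :
    ∃ g' ∈ H.charts, range g' = range g ∧
      map g' (sectorFaceGerm x F) = map f (sectorFaceGerm x F) ∧
      map g' (sectorFaceGerm y G) = map f (sectorFaceGerm y G) := by
  have hF' := hF.isVFacet
  have hG' := hG.isVFacet
  obtain ⟨ξ, hξ, hgF, -⟩ := exists_chart_fixing_sectorFace hf hg hF hgF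
  obtain ⟨η, hη, hgG, -⟩ := exists_chart_fixing_sectorFace hf hg hG hgG
  obtain ⟨-, g', hg', hr, hfix⟩ := H.ma4 f hf _ _
    (isSplayedChimneyGerm_chimneyGerm hF hF' (x + ξ))
    (Or.inr (isSolidChimneyGerm_chimneyGerm hG (y + η))) g hg
    (map_mono (chimneyGerm_le_cl_sectorFace hF') hgF)
    (map_mono (chimneyGerm_le_cl_sectorFace hG') hgG)
  obtain ⟨hfixF, hfixG⟩ := mem_sup.1 (le_cl _ hfix)
  refine ⟨g', hg', hr, map_congr ?_, map_congr ?_⟩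
  · rw [← sectorFaceGerm_add hF' hξ]
    exact sectorFaceGerm_le_chimneyGerm hF' hF' hfixF
  · rw [← sectorFaceGerm_add hG' hη]
    exact sectorFaceGerm_le_chimneyGerm hG' hG' hfixG

lemma directions_unique (hf : f ∈ H.charts) (hg : g ∈ H.charts)
    (hF : 𝔸.IsSphericalFacet ε F) (hG : 𝔸.IsSphericalFacet ε G)
    (hK : 𝔸.IsSphericalFacet ε K) (hL : 𝔸.IsSphericalFacet ε L)
    (hFK : map f (sectorFaceGerm x F) = map g (sectorFaceGerm a K))
    (hGL : map f (sectorFaceGerm y G) = map g (sectorFaceGerm b L)) :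
    ∃ u ∈ 𝔸.vWeyl, F = u '' K ∧ G = u '' L := by
  obtain ⟨f', hf', hr, hfK, hfL⟩ := exists_chart_fixing_germs hg hf hK hL
    (hFK ▸ range_mem_map) (hGL ▸ range_mem_map)
  obtain ⟨w, hw, rfl⟩ := exists_weyl_of_range_eq hf hf' hr
  obtain ⟨u, hu, huw⟩ := exists_linear_of_mem_weyl hw
  have hinj := map_injective (H.charts_injective f hf)
  rw [← map_map, map_sectorFaceGerm hK.isVFacet hu huw, ← hFK] at hfK
  rw [← map_map, map_sectorFaceGerm hL.isVFacet hu huw, ← hGL] at hfL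
  exact ⟨u, hu, direction_unique hF (hK.image hu) (hinj hfK.symm),
    direction_unique hG (hL.image hu) (hinj hfL.symm)⟩

lemma InPosition.directions (hρ : 𝔸.IsInvariant ρ) (hf : f ∈ H.charts)
    (hF : 𝔸.IsSphericalFacet ε F) (hG : 𝔸.IsSphericalFacet ε G)
    (h : H.InPosition ε ρ (map f (sectorFaceGerm x F)) (map f (sectorFaceGerm y G))) : ρ F G := by
  obtain ⟨g, hg, a, b, K, L, hK, hL, hFK, hGL, hKL⟩ := h
  obtain ⟨u, hu, rfl, rfl⟩ := directions_unique hf hg hF hG hK hL hFK hGL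
  exact hρ u hu _ _ hKL

lemma exists_chart_near (hf : f ∈ H.charts) (hg : g ∈ H.charts) (hF : 𝔸.IsSphericalFacet ε F)
    (hG : 𝔸.IsSphericalFacet ε' G) (hF₁ : 𝔸.IsVFacet F₁) (hη : η ∈ F₁) (x y : V) :
    ∃ h ∈ H.charts, range h ∈ map g (sectorFaceGerm y G) ∧
      ∃ δ > 0, ∀ s : ℝ, 0 ≤ s → s < δ → range h ∈ map f (sectorFaceGerm (x + s • η) F) := by
  have hG' := hG.isVFacet
  obtain ⟨h, hh, hhF, hhG⟩ := H.ma3 f hf g hg _ _ (isSplayedChimneyGerm_chimneyGerm hF hF₁ x)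
    (Or.inr (isSolidChimneyGerm_chimneyGerm hG y))
  exact ⟨h, hh, map_mono (sectorFaceGerm_le_chimneyGerm hG' hG') hhG,
    exists_mem_sectorFaceGerm_of_mem_chimneyGerm hF.isVFacet hF₁ hη hhF⟩

lemma exists_eq_map_of_range_mem (hf : f ∈ H.charts) (hg : g ∈ H.charts)
    (hF : 𝔸.IsSphericalFacet ε F) (h : range g ∈ map f (sectorFaceGerm x F)) :
    ∃ y G, 𝔸.IsSphericalFacet ε G ∧ map f (sectorFaceGerm x F) = map g (sectorFaceGerm y G) := by
  obtain ⟨g', hg', hr, hfix, -⟩ := exists_chart_fixing_germs hf hg hF hF h h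
  obtain ⟨w, hw, rfl⟩ := exists_weyl_of_range_eq hg hg' hr
  obtain ⟨u, hu, huw⟩ := exists_linear_of_mem_weyl hw
  rw [← map_map, map_sectorFaceGerm hF.isVFacet hu huw] at hfix
  exact ⟨_, _, hF.image hu, hfix.symm⟩

lemma exists_common_chart_of_germs (hf : f ∈ H.charts) (hg : g ∈ H.charts)
    (hF : 𝔸.IsSphericalFacet ε F) (hG : 𝔸.IsSphericalFacet ε G) (x y : V) :
    ∃ h ∈ H.charts, ∃ x' y' F' G', 𝔸.IsSphericalFacet ε F' ∧ 𝔸.IsSphericalFacet ε G' ∧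
      map f (sectorFaceGerm x F) = map h (sectorFaceGerm x' F') ∧
      map g (sectorFaceGerm y G) = map h (sectorFaceGerm y' G') := by
  obtain ⟨η, hη⟩ := hF.isVFacet.nonempty
  obtain ⟨h, hh, hhG, δ, hδ, hhF⟩ := exists_chart_near hf hg hF hG hF.isVFacet hη x y
  obtain ⟨x', F', hF', hFF'⟩ := exists_eq_map_of_range_mem hf hh hF (by simpa using hhF 0 le_rfl hδ)
  obtain ⟨y', G', hG', hGG'⟩ := exists_eq_map_of_range_mem hg hh hG hhG
  exact ⟨h, hh, x', y', F', G', hF', hG', hFF', hGG'⟩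

lemma InPosition.of_common_chart (hρ : 𝔸.IsInvariant ρ) (hf : f ∈ H.charts) (hg : g ∈ H.charts)
    (hh : h ∈ H.charts) (hF : 𝔸.IsSphericalFacet ε F) (hG : 𝔸.IsSphericalFacet ε G)
    (hx : range h ∈ map f (sectorFaceGerm x F)) (hx' : range h ∈ map f (sectorFaceGerm x' F))
    (hy : range h ∈ map g (sectorFaceGerm y G))
    (hp : H.InPosition ε ρ (map f (sectorFaceGerm x F)) (map g (sectorFaceGerm y G))) :
    H.InPosition ε ρ (map f (sectorFaceGerm x' F)) (map g (sectorFaceGerm y G)) := by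
  obtain ⟨h', hh', hr, hfix, hfix'⟩ := exists_chart_fixing_germs hf hh hF hF hx hx'
  obtain ⟨z, K, hK, hGK⟩ := exists_eq_map_of_range_mem hg hh' hG (hr ▸ hy)
  rw [← hfix, hGK] at hp
  rw [← hfix', hGK]
  exact ⟨h', hh', _, _, _, _, hF, hK, rfl, rfl, hp.directions hρ hh' hF hK⟩

lemma exists_forall_lt_inPosition_iff (hρ : 𝔸.IsInvariant ρ) (hf : f ∈ H.charts)
    (hg : g ∈ H.charts) (hF : 𝔸.IsSphericalFacet ε F) (hG : 𝔸.IsSphericalFacet ε G)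
    (hF₁ : 𝔸.IsVFacet F₁) (hη : η ∈ F₁) (x y : V) :
    ∃ δ > 0, ∀ s : ℝ, 0 ≤ s → s < δ →
      (H.InPosition ε ρ (map f (sectorFaceGerm (x + s • η) F)) (map g (sectorFaceGerm y G)) ↔
        H.InPosition ε ρ (map f (sectorFaceGerm x F)) (map g (sectorFaceGerm y G))) := by
  obtain ⟨h, hh, hhG, δ, hδ, hhF⟩ := exists_chart_near hf hg hF hG hF₁ hη x y
  have hhF0 : range h ∈ map f (sectorFaceGerm x F) := by simpa using hhF 0 le_rfl hδ
  exact ⟨δ, hδ, fun s hs hsδ =>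
    ⟨InPosition.of_common_chart hρ hf hg hh hF hG (hhF s hs hsδ) hhF0 hhG,
      InPosition.of_common_chart hρ hf hg hh hF hG hhF0 (hhF s hs hsδ) hhG⟩⟩

lemma isLocallyConstant_inPosition (hρ : 𝔸.IsInvariant ρ) (hf : f ∈ H.charts) (hg : g ∈ H.charts)
    (hF : 𝔸.IsSphericalFacet ε F) (hG : 𝔸.IsSphericalFacet ε G) (hF₁ : 𝔸.IsVFacet F₁)
    (hη : η ∈ F₁) (x y : V) :
    IsLocallyConstant fun s : ℝ =>
      H.InPosition ε ρ (map f (sectorFaceGerm (x + s • η) F)) (map g (sectorFaceGerm y G)) := by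
  refine (IsLocallyConstant.iff_eventually_eq _).2 fun s => ?_
  obtain ⟨δ, hδ, hright⟩ :=
    exists_forall_lt_inPosition_iff hρ hf hg hF hG hF₁ hη (x + s • η) y
  obtain ⟨δ', hδ', hleft⟩ :=
    exists_forall_lt_inPosition_iff hρ hf hg hF hG hF₁.neg (neg_mem_neg.2 hη) (x + s • η) y
  filter_upwards [Ioo_mem_nhds (sub_lt_self s hδ') (lt_add_of_pos_right s hδ)] with r hr
  have hmove : x + s • η + (r - s) • η = x + r • η := by module
  have hmove' : x + s • η + (s - r) • -η = x + r • η := by module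
  rcases le_total s r with hsr | hrs
  · exact propext (hmove ▸ hright (r - s) (sub_nonneg.2 hsr) (by linarith [hr.2]))
  · exact propext (hmove' ▸ hleft (s - r) (sub_nonneg.2 hrs) (by linarith [hr.1]))

-- Since `F` is spherical, `y - x + t • v` lies in a vectorial facet for `v ∈ F` and `t` large. The
-- position is constant along the segment from `x` to `y + t • v`, where the germ is that at `y`.
lemma InPosition.of_parallel_left (hρ : 𝔸.IsInvariant ρ) {𝔉 𝔉' 𝔊 : H.FaceGerm ε}
    (hpar : H.Parallel ε 𝔉 𝔉') (h : H.InPosition ε ρ 𝔉.1 𝔊.1) :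
    H.InPosition ε ρ 𝔉'.1 𝔊.1 := by
  obtain ⟨f, hf, x, y, F, hF, h𝔉, h𝔉'⟩ := hpar
  obtain ⟨g, hg, z, G, hG, h𝔊⟩ := 𝔊.2
  obtain ⟨v, hv⟩ := hF.isVFacet.nonempty
  obtain ⟨t, ht, F₁, hF₁, hη⟩ := hF.exists_add_smul_mem hv (y - x)
  have hconst := (isLocallyConstant_inPosition (H := H) hρ hf hg hF hG hF₁ hη x z
    ).apply_eq_of_isPreconnected isPreconnected_univ (mem_univ 0) (mem_univ 1)
  have hend : sectorFaceGerm (x + (y - x + t • v)) F = sectorFaceGerm y F := by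
    rw [← add_assoc, add_sub_cancel,
      sectorFaceGerm_add hF.isVFacet (subset_closure (hF.isVFacet.smul_mem ht hv))]
  simp only [zero_smul, add_zero, one_smul, hend] at hconst
  rw [h𝔉', h𝔊, ← hconst, ← h𝔉, ← h𝔊]
  exact h

variable (H ε) in
lemma parallel_equivalence : Equivalence (H.Parallel ε) where
  refl 𝔉 := by
    obtain ⟨f, hf, x, F, hF, h⟩ := 𝔉.2
    exact ⟨f, hf, x, x, F, hF, h, h⟩
  symm := Parallel.symm
  trans h h' :=
    parallel_iff.2 (InPosition.of_parallel_left isInvariant_eq h.symm (parallel_iff.1 h'))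

lemma toInfinity_eq_iff {𝔉 𝔊 : H.FaceGerm ε} :
    H.toInfinity ε 𝔉 = H.toInfinity ε 𝔊 ↔ H.Parallel ε 𝔉 𝔊 :=
  (parallel_equivalence H ε).quot_mk_eq_iff 𝔉 𝔊

lemma InPosition.of_toInfinity_eq (hρ : 𝔸.IsInvariant ρ) {𝔉 𝔉' 𝔊 𝔊' : H.FaceGerm ε}
    (h𝔉 : H.toInfinity ε 𝔉 = H.toInfinity ε 𝔉') (h𝔊 : H.toInfinity ε 𝔊 = H.toInfinity ε 𝔊')
    (h : H.InPosition ε ρ 𝔉.1 𝔊.1) : H.InPosition ε ρ 𝔉'.1 𝔊'.1 := by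
  have h := InPosition.of_parallel_left hρ (toInfinity_eq_iff.1 h𝔉) h
  exact (InPosition.of_parallel_left hρ.flip (toInfinity_eq_iff.1 h𝔊) h.flip).flip

lemma leInfinity_toInfinity_iff {𝔉 𝔊 : H.FaceGerm ε} :
    H.leInfinity ε (H.toInfinity ε 𝔊) (H.toInfinity ε 𝔉) ↔ H.Dominates ε 𝔉 𝔊 := by
  constructor
  · rintro ⟨𝔊', 𝔉', h𝔊, h𝔉, h⟩
    exact dominates_iff.2
      (InPosition.of_toInfinity_eq isInvariant_subset_closure h𝔉 h𝔊 (dominates_iff.1 h))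
  · exact fun h => ⟨𝔊, 𝔉, rfl, rfl, h⟩

end AffineHovel

/-! ## Spherical facets and cosets -/

namespace VectorialDatum

open SimpleRoots

variable {ι V : Type*} [Fintype ι]

section Algebra

variable [AddCommGroup V] [Module ℝ V] {D : VectorialDatum ι V} {J : Set ι}

lemma mem_standardParabolic_iff {w : D.vWeyl} :
    w ∈ D.cs.standardParabolic J ↔ (w : V ≃ₗ[ℝ] V) ∈ D.parabolic J := by
  have hmap : (D.cs.standardParabolic J).map D.vWeyl.subtype = D.parabolic J := by
    rw [CoxeterSystem.standardParabolic, MonoidHom.map_closure, parabolic, image_image]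
    simp only [Subgroup.subtype_apply, D.cs_simple]
  rw [← hmap]
  exact (Subgroup.mem_map_iff_mem D.vWeyl.subtype_injective).symm

lemma isSpherical_iff_finite_standardParabolic :
    D.IsSpherical J ↔ (D.cs.standardParabolic J : Set D.vWeyl).Finite := by
  have himage : ((↑) : D.vWeyl → V ≃ₗ[ℝ] V) '' (D.cs.standardParabolic J : Set D.vWeyl) =
      (D.parabolic J : Set (V ≃ₗ[ℝ] V)) := by
    ext w
    constructor
    · rintro ⟨w, hw, rfl⟩
      exact mem_standardParabolic_iff.1 hw
    · exact fun hw => ⟨⟨w, D.parabolic_le J hw⟩, mem_standardParabolic_iff.2 hw, rfl⟩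
  rw [← finite_image_iff (Subtype.val_injective.injOn), himage]
  rfl

lemma mem_of_refl_mem_parabolic {i : ι} (h : D.refl i ∈ D.parabolic J) : i ∈ J := by
  obtain ⟨v, hv⟩ := coneFace_nonempty D.root_free J
  have hfix := parabolic_fixes hv h
  rw [refl_apply, sub_eq_self] at hfix
  by_contra hi
  exact (smul_ne_zero (hv.2 i hi).ne' (D.coroot_ne_zero i)) hfix

lemma isSpherical_empty : D.IsSpherical ∅ := by
  simp [IsSpherical]

lemma isSpherical_singleton (i : ι) : D.IsSpherical {i} := by
  rw [IsSpherical, image_singleton, ← Subgroup.zpowers_eq_closure, finite_zpowers]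
  exact isOfFinOrder_iff_pow_eq_one.2
    ⟨2, two_pos, by rw [pow_two, ← inv_eq_iff_mul_eq_one, D.refl_inv]⟩

end Algebra

variable [NormedAddCommGroup V] [NormedSpace ℝ V] {D : VectorialDatum ι V} {ε : ℤˣ} {J J' : Set ι}
  {F G : Set V} {u : V ≃ₗ[ℝ] V}

variable (D ε) in
/-- The set of all `w` such that `F` is a face of the vectorial chamber `ε w C`. It is the coset
`w W_J` if `F` is the facet of type `J` of this chamber. -/
def cosetOf (F : Set V) : Set D.vWeyl :=
  {w | F ⊆ closure (coneFace (D.chamberRoot ε w) ∅)}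

variable [FiniteDimensional ℝ V]

lemma mem_cosetOf_coneFace (hu : u ∈ D.vWeyl) {w : D.vWeyl} :
    w ∈ cosetOf D ε (coneFace (D.chamberRoot ε u) J) ↔ u⁻¹ * w ∈ D.parabolic J := by
  rw [cosetOf, Set.mem_ofPred_eq, closure_coneFace_chamberRoot,
    coneFace_subset_closedConeFace_iff hu w.2]
  simp

lemma cosetOf_coneFace (hu : u ∈ D.vWeyl) :
    cosetOf D ε (coneFace (D.chamberRoot ε u) J) =
      (⟨u, hu⟩ : D.vWeyl) • (D.cs.standardParabolic J : Set D.vWeyl) := by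
  ext w
  rw [mem_cosetOf_coneFace hu, mem_smul_set_iff_inv_smul_mem, SetLike.mem_coe,
    mem_standardParabolic_iff]
  rfl

lemma cosetOf_subset_iff (hF : D.IsFacetOfType ε J F) (hG : D.IsFacetOfType ε J' G) :
    cosetOf D ε G ⊆ cosetOf D ε F ↔ F ⊆ closure G := by
  refine ⟨fun h => ?_, fun h w hw => h.trans (closure_minimal hw isClosed_closure)⟩
  obtain ⟨u', hu', rfl⟩ := isFacetOfType_iff.1 hF
  obtain ⟨u, hu, rfl⟩ := isFacetOfType_iff.1 hG
  have hcoset : ∀ w ∈ D.parabolic J', u'⁻¹ * (u * w) ∈ D.parabolic J := fun w hw =>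
    (mem_cosetOf_coneFace hu' (w := ⟨u * w, mul_mem hu (D.parabolic_le J' hw)⟩)).1
      (h ((mem_cosetOf_coneFace hu).2 (by rwa [inv_mul_cancel_left])))
  have hbase : u'⁻¹ * u ∈ D.parabolic J := by simpa using hcoset 1 (one_mem _)
  rw [closure_coneFace_chamberRoot, coneFace_subset_closedConeFace_iff hu' hu]
  refine ⟨hbase, fun j hj => mem_of_refl_mem_parabolic (D := D) ?_⟩
  rw [← Subgroup.mul_mem_cancel_left _ hbase, mul_assoc]
  exact hcoset _ (refl_mem_parabolic hj)

lemma cosetOf_injective (hF : D.IsFacetOfType ε J F) (hG : D.IsFacetOfType ε J' G)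
    (h : cosetOf D ε F = cosetOf D ε G) : F = G :=
  hF.eq_of_subset_closure hG ((cosetOf_subset_iff hF hG).1 h.ge) ((cosetOf_subset_iff hG hF).1 h.le)

variable (D ε) in
/-- The spherical vectorial facets of sign `ε` correspond to the cosets `w W_J` with `W_J`
finite. -/
noncomputable def facetEquivCoset : {F // D.IsSphericalFacet ε F} ≃ D.cs.SphericalCoset :=
  Equiv.ofBijective
    (fun F => ⟨cosetOf D ε F.1, by
      obtain ⟨F, J, hJ, hF⟩ := F
      obtain ⟨u, hu, rfl⟩ := isFacetOfType_iff.1 hF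
      exact ⟨⟨u, hu⟩, J, isSpherical_iff_finite_standardParabolic.1 hJ, cosetOf_coneFace hu⟩⟩)
    ⟨by
      rintro ⟨F, J, hJ, hF⟩ ⟨G, J', hJ', hG⟩ h
      exact Subtype.ext (cosetOf_injective hF hG (Subtype.ext_iff.1 h)),
    by
      rintro ⟨C, w, J, hJ, rfl⟩
      exact ⟨⟨coneFace (D.chamberRoot ε w) J, J, isSpherical_iff_finite_standardParabolic.2 hJ,
        isFacetOfType_coneFace ε w.2 J⟩, Subtype.ext (cosetOf_coneFace w.2)⟩⟩

end VectorialDatum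

/-! ## The building at infinity -/

namespace AffineHovel

open ModelApartment VectorialDatum SimpleRoots

variable {ι V : Type*} [Fintype ι] [NormedAddCommGroup V] [NormedSpace ℝ V]
  {𝔸 : ModelApartment ι V} {X : Type*} {H : AffineHovel 𝔸 X}
  {F G F' G' K L : Set V} {f g : V → X} {u : V ≃ₗ[ℝ] V} {J : Set ι} {ε : ℤˣ}

/-- The germ of the sector face `x + F` in the apartment with chart `f`. -/
noncomputable def faceGerm (hf : f ∈ H.charts) (x : V) (hF : 𝔸.IsSphericalFacet ε F) :
    H.FaceGerm ε :=
  ⟨map f (sectorFaceGerm x F), f, hf, x, F, hF, rfl⟩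

/-- The facet at infinity with direction `F` in the apartment with chart `f`. -/
noncomputable def atInfinity (hf : f ∈ H.charts) (hF : 𝔸.IsSphericalFacet ε F) : H.Infinity ε :=
  H.toInfinity ε (faceGerm hf 0 hF)

lemma toInfinity_faceGerm (hf : f ∈ H.charts) (x : V) (hF : 𝔸.IsSphericalFacet ε F) :
    H.toInfinity ε (faceGerm hf x hF) = atInfinity hf hF :=
  Quot.sound ⟨f, hf, x, 0, F, hF, rfl, rfl⟩

lemma toInfinity_eq_atInfinity {𝔉 : H.FaceGerm ε} {x : V} (hf : f ∈ H.charts)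
    (hF : 𝔸.IsSphericalFacet ε F) (h : 𝔉.1 = map f (sectorFaceGerm x F)) :
    H.toInfinity ε 𝔉 = atInfinity hf hF := by
  rw [← toInfinity_faceGerm hf x hF]
  exact congrArg _ (Subtype.ext h)

/-- The action of an element of the vectorial Weyl group on the spherical vectorial facets. -/
def facetPerm (𝔸 : ModelApartment ι V) (ε : ℤˣ) (hu : u ∈ 𝔸.vWeyl) :
    {F // 𝔸.IsSphericalFacet ε F} ≃ {F // 𝔸.IsSphericalFacet ε F} where
  toFun F := ⟨u '' F.1, F.2.image hu⟩
  invFun F := ⟨u.symm '' F.1, F.2.image (inv_mem hu)⟩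
  left_inv F := Subtype.ext (u.toEquiv.symm_image_image F.1)
  right_inv F := Subtype.ext (u.toEquiv.image_symm_image F.1)

variable [FiniteDimensional ℝ V]

lemma exists_common_chart (a b : H.Infinity ε) :
    ∃ f, ∃ hf : f ∈ H.charts, ∃ F, ∃ hF : 𝔸.IsSphericalFacet ε F, ∃ G,
      ∃ hG : 𝔸.IsSphericalFacet ε G, a = atInfinity hf hF ∧ b = atInfinity hf hG := by
  induction a using Quot.ind with | _ 𝔉 =>
  induction b using Quot.ind with | _ 𝔊 =>
  obtain ⟨f, hf, x, F, hF, h𝔉⟩ := 𝔉.2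
  obtain ⟨g, hg, y, G, hG, h𝔊⟩ := 𝔊.2
  obtain ⟨h, hh, x', y', F', G', hF', hG', hFF', hGG'⟩ :=
    exists_common_chart_of_germs hf hg hF hG x y
  exact ⟨h, hh, F', hF', G', hG', toInfinity_eq_atInfinity hh hF' (h𝔉.trans hFF'),
    toInfinity_eq_atInfinity hh hG' (h𝔊.trans hGG')⟩

lemma exists_eq_atInfinity (a : H.Infinity ε) :
    ∃ f, ∃ hf : f ∈ H.charts, ∃ F, ∃ hF : 𝔸.IsSphericalFacet ε F, a = atInfinity hf hF := by
  obtain ⟨f, hf, F, hF, _, _, h, -⟩ := exists_common_chart a a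
  exact ⟨f, hf, F, hF, h⟩

lemma exists_image_eq_of_atInfinity_eq {hf : f ∈ H.charts} {hg : g ∈ H.charts}
    {hF : 𝔸.IsSphericalFacet ε F} {hG : 𝔸.IsSphericalFacet ε G}
    {hF' : 𝔸.IsSphericalFacet ε F'} {hG' : 𝔸.IsSphericalFacet ε G'}
    (hFF' : atInfinity hf hF = atInfinity hg hF') (hGG' : atInfinity hf hG = atInfinity hg hG') :
    ∃ u ∈ 𝔸.vWeyl, F' = u '' F ∧ G' = u '' G := by
  have hρ : 𝔸.IsInvariant fun K L => ∃ u ∈ 𝔸.vWeyl, K = u '' F ∧ L = u '' G := by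
    rintro u hu _ _ ⟨u', hu', rfl, rfl⟩
    exact ⟨u * u', mul_mem hu hu', image_image _ _ _, image_image _ _ _⟩
  refine InPosition.directions hρ hg hF' hG' (InPosition.of_toInfinity_eq hρ hFF' hGG' ?_)
  exact ⟨f, hf, 0, 0, F, G, hF, hG, rfl, rfl, 1, one_mem _, (image_id F).symm, (image_id G).symm⟩

lemma atInfinity_eq_iff {hf : f ∈ H.charts} {hF : 𝔸.IsSphericalFacet ε F}
    {hG : 𝔸.IsSphericalFacet ε G} : atInfinity hf hF = atInfinity hf hG ↔ F = G := by
  refine ⟨fun h => ?_, fun h => by subst h; rfl⟩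
  exact InPosition.directions isInvariant_eq hf hF hG (parallel_iff.1 (toInfinity_eq_iff.1 h))

lemma leInfinity_atInfinity_iff {hf : f ∈ H.charts} {hF : 𝔸.IsSphericalFacet ε F}
    {hG : 𝔸.IsSphericalFacet ε G} :
    H.leInfinity ε (atInfinity hf hF) (atInfinity hf hG) ↔ F ⊆ closure G := by
  rw [atInfinity, atInfinity, leInfinity_toInfinity_iff, dominates_iff]
  exact ⟨InPosition.directions isInvariant_subset_closure hf hG hF,
    fun h => ⟨f, hf, 0, 0, G, F, hG, hF, rfl, rfl, h⟩⟩

lemma mem_apartmentAtInfinity_iff (hf : f ∈ H.charts) {a : H.Infinity ε} :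
    a ∈ H.apartmentAtInfinity ε (range f) ↔
      ∃ F, ∃ hF : 𝔸.IsSphericalFacet ε F, a = atInfinity hf hF := by
  constructor
  · rintro ⟨𝔉, rfl, h⟩
    obtain ⟨g, hg, x, F, hF, h𝔉⟩ := 𝔉.2
    rw [h𝔉] at h
    obtain ⟨y, G, hG, hFG⟩ := exists_eq_map_of_range_mem hg hf hF h
    exact ⟨G, hG, toInfinity_eq_atInfinity hf hG (h𝔉.trans hFG)⟩
  · rintro ⟨F, hF, rfl⟩
    exact ⟨_, rfl, range_mem_map⟩

-- An apartment which contains the germ of a sector face contains the enclosure, hence the closure,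
-- of a smaller sector face.
lemma exists_eq_atInfinity_of_le {hf : f ∈ H.charts} {hF : 𝔸.IsSphericalFacet ε F}
    {b : H.Infinity ε} (h : H.leInfinity ε b (atInfinity hf hF)) :
    ∃ G, ∃ hG : 𝔸.IsSphericalFacet ε G, b = atInfinity hf hG := by
  induction b using Quot.ind with | _ 𝔊 =>
  obtain ⟨g, hg, x, y, F', G', hF', hG', hFF', h𝔊, hsub⟩ :=
    dominates_iff.1 (leInfinity_toInfinity_iff.1 h)
  have hmem : range f ∈ map g (sectorFaceGerm x F') := hFF' ▸ range_mem_map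
  obtain ⟨ξ, _, -, f', hf', hrange, hfix⟩ := exists_chart_fixing_sectorFace hg hf hF' hmem
  have hgerm : map f' (sectorFaceGerm (x + ξ) G') = map g (sectorFaceGerm (x + ξ) G') := by
    refine map_congr
      ((mem_sectorFaceGerm hG'.isVFacet).2 ⟨0, hG'.isVFacet.zero_mem_closure, fun v hv => ?_⟩)
    rw [add_zero]
    exact add_mem_of_mem_cl_sectorFace hfix (hsub hv)
  have hinfty : Quot.mk _ 𝔊 = atInfinity hf' hG' := by
    rw [← toInfinity_eq_atInfinity (𝔉 := faceGerm hg (x + ξ) hG') hf' hG' hgerm.symm,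
      toInfinity_faceGerm]
    exact toInfinity_eq_atInfinity hg hG' h𝔊
  exact (mem_apartmentAtInfinity_iff hf).1
    (hrange ▸ (mem_apartmentAtInfinity_iff hf').2 ⟨G', hG', hinfty⟩)

variable (H ε) in
lemma isPartialOrder_leInfinity : IsPartialOrder (H.Infinity ε) (H.leInfinity ε) where
  refl a := by
    obtain ⟨f, hf, F, hF, rfl⟩ := exists_eq_atInfinity a
    exact leInfinity_atInfinity_iff.2 subset_closure
  trans a b c hab hbc := by
    obtain ⟨f, hf, F, hF, G, hG, rfl, rfl⟩ := exists_common_chart b c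
    obtain ⟨K, hK, rfl⟩ := exists_eq_atInfinity_of_le hab
    rw [leInfinity_atInfinity_iff] at hab hbc ⊢
    exact hab.trans (closure_minimal hbc isClosed_closure)
  antisymm a b hab hba := by
    obtain ⟨f, hf, F, hF, G, hG, rfl, rfl⟩ := exists_common_chart a b
    rw [leInfinity_atInfinity_iff] at hab hba
    rw [atInfinity_eq_iff]
    obtain ⟨_, _, hF⟩ := hF
    obtain ⟨_, _, hG⟩ := hG
    exact hF.eq_of_subset_closure hG hab hba

lemma exists_typeAtInfinity (a : H.Infinity ε) : ∃ J : Set ι, ∃ f, ∃ hf : f ∈ H.charts, ∃ F,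
    ∃ hF : 𝔸.IsSphericalFacet ε F, 𝔸.IsFacetOfType ε J F ∧ a = atInfinity hf hF := by
  obtain ⟨f, hf, F, hF, rfl⟩ := exists_eq_atInfinity a
  obtain ⟨J, _, hJ⟩ := id hF
  exact ⟨J, f, hf, F, hF, hJ, rfl⟩

/-- The type of a facet at infinity: the type of its direction in any apartment. -/
noncomputable def typeAtInfinity (a : H.Infinity ε) : Set ι := (exists_typeAtInfinity a).choose

lemma typeAtInfinity_eq {hf : f ∈ H.charts} {hF : 𝔸.IsSphericalFacet ε F}
    (hJ : 𝔸.IsFacetOfType ε J F) : typeAtInfinity (atInfinity hf hF) = J := by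
  obtain ⟨g, hg, G, hG, hGtype, hFG⟩ := (exists_typeAtInfinity (atInfinity hf hF)).choose_spec
  obtain ⟨u, hu, rfl, -⟩ := exists_image_eq_of_atInfinity_eq hFG hFG
  exact IsFacetOfType.type_unique hGtype (hJ.image hu)

/-- The facets at infinity of the apartment with chart `f` correspond to the spherical vectorial
facets. -/
noncomputable def facetEquivApartment (ε : ℤˣ) (hf : f ∈ H.charts) :
    {F // 𝔸.IsSphericalFacet ε F} ≃ H.apartmentAtInfinity ε (range f) :=
  Equiv.ofBijective
    (fun F => ⟨atInfinity hf F.2, (mem_apartmentAtInfinity_iff hf).2 ⟨F.1, F.2, rfl⟩⟩)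
    ⟨fun F G h => Subtype.ext (atInfinity_eq_iff.1 (Subtype.ext_iff.1 h)), fun a => by
      obtain ⟨F, hF, h⟩ := (mem_apartmentAtInfinity_iff hf).1 a.2
      exact ⟨⟨F, hF⟩, Subtype.ext h.symm⟩⟩

lemma coe_facetEquivApartment (hf : f ∈ H.charts) (F : {F // 𝔸.IsSphericalFacet ε F}) :
    (facetEquivApartment ε hf F : H.Infinity ε) = atInfinity hf F.2 := rfl

lemma exists_equiv_sphericalCoset (hf : f ∈ H.charts) :
    ∃ φ : H.apartmentAtInfinity ε (range f) ≃ 𝔸.cs.SphericalCoset,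
      (∀ a b : H.apartmentAtInfinity ε (range f), H.leInfinity ε a b ↔ (φ b).1 ⊆ (φ a).1) ∧
      ∀ a, ∃ w : 𝔸.vWeyl,
        (φ a).1 = w • (𝔸.cs.standardParabolic (typeAtInfinity a.1) : Set 𝔸.vWeyl) := by
  have hsurj := (facetEquivApartment ε hf).surjective
  refine ⟨(facetEquivApartment ε hf).symm.trans (facetEquivCoset 𝔸.toVectorialDatum ε),
    hsurj.forall₂.2 ?_, hsurj.forall.2 ?_⟩
  · rintro ⟨F, hF⟩ ⟨G, hG⟩
    simp only [Equiv.trans_apply, Equiv.symm_apply_apply, coe_facetEquivApartment,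
      leInfinity_atInfinity_iff]
    obtain ⟨_, _, hF⟩ := hF
    obtain ⟨_, _, hG⟩ := hG
    exact (cosetOf_subset_iff hF hG).symm
  · rintro ⟨F, J, hJ, hF⟩
    simp only [Equiv.trans_apply, Equiv.symm_apply_apply, coe_facetEquivApartment]
    rw [typeAtInfinity_eq hF]
    obtain ⟨u, hu, rfl⟩ := isFacetOfType_iff.1 hF
    exact ⟨⟨u, hu⟩, cosetOf_coneFace hu⟩

-- A face of `u L` is determined by its type.
lemma atInfinity_image_eq_of_le {hf : f ∈ H.charts} {hg : g ∈ H.charts} (hu : u ∈ 𝔸.vWeyl)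
    {hK : 𝔸.IsSphericalFacet ε K} {hL : 𝔸.IsSphericalFacet ε L}
    (hle : H.leInfinity ε (atInfinity hf hK) (atInfinity hf hL))
    (heq : atInfinity hf hL = atInfinity hg (hL.image hu)) :
    atInfinity hg (hK.image hu) = atInfinity hf hK := by
  have hle' := heq ▸ hle
  obtain ⟨K', hK', hKK'⟩ := exists_eq_atInfinity_of_le hle'
  rw [hKK', leInfinity_atInfinity_iff] at hle'
  rw [leInfinity_atInfinity_iff] at hle
  rw [hKK', atInfinity_eq_iff]
  obtain ⟨J, _, hJ⟩ := id hK
  obtain ⟨J', _, hJ'⟩ := id hK'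
  obtain ⟨_, _, hLtype⟩ := id hL
  obtain rfl : J = J' := by
    rw [← typeAtInfinity_eq (hf := hf) (hF := hK) hJ, hKK', typeAtInfinity_eq hJ']
  exact IsFacetOfType.eq_of_subset_closure_of_type (hJ.image hu) hJ' (hLtype.image hu)
    ((image_mono hle).trans (image_closure_linearEquiv u L).subset) hle'

lemma exists_equiv_apartmentAtInfinity (hf : f ∈ H.charts) (hg : g ∈ H.charts)
    {a b : H.Infinity ε} (ha : a ∈ H.apartmentAtInfinity ε (range f))
    (hb : b ∈ H.apartmentAtInfinity ε (range f)) (ha' : a ∈ H.apartmentAtInfinity ε (range g))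
    (hb' : b ∈ H.apartmentAtInfinity ε (range g)) :
    ∃ φ : H.apartmentAtInfinity ε (range f) ≃ H.apartmentAtInfinity ε (range g),
      (∀ c d : H.apartmentAtInfinity ε (range f),
        H.leInfinity ε c d ↔ H.leInfinity ε (φ c) (φ d)) ∧
      (∀ c, typeAtInfinity (φ c).1 = typeAtInfinity c.1) ∧
      ∀ c : H.apartmentAtInfinity ε (range f),
        H.leInfinity ε c a ∨ H.leInfinity ε c b → (φ c : H.Infinity ε) = c := by
  obtain ⟨F, hF, rfl⟩ := (mem_apartmentAtInfinity_iff hf).1 ha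
  obtain ⟨G, hG, rfl⟩ := (mem_apartmentAtInfinity_iff hf).1 hb
  obtain ⟨F', hF', hFF'⟩ := (mem_apartmentAtInfinity_iff hg).1 ha'
  obtain ⟨G', hG', hGG'⟩ := (mem_apartmentAtInfinity_iff hg).1 hb'
  obtain ⟨u, hu, rfl, rfl⟩ := exists_image_eq_of_atInfinity_eq hFF' hGG'
  have hsurj := (facetEquivApartment ε hf).surjective
  refine ⟨(facetEquivApartment ε hf).symm.trans ((facetPerm 𝔸 ε hu).trans
    (facetEquivApartment ε hg)), hsurj.forall₂.2 ?_, hsurj.forall.2 ?_, hsurj.forall.2 ?_⟩ <;>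
  simp only [Equiv.trans_apply, Equiv.symm_apply_apply, coe_facetEquivApartment]
  · rintro ⟨K, hK⟩ ⟨L, hL⟩
    rw [leInfinity_atInfinity_iff, leInfinity_atInfinity_iff]
    change K ⊆ closure L ↔ u '' K ⊆ closure (u '' L)
    rw [← image_closure_linearEquiv, image_subset_image_iff u.injective]
  · rintro ⟨K, J, hJ, hK⟩
    rw [typeAtInfinity_eq hK]
    exact typeAtInfinity_eq (hK.image hu)
  · rintro ⟨K, hK⟩ (hc | hc)
    · exact atInfinity_image_eq_of_le hu hc hFF'
    · exact atInfinity_image_eq_of_le hu hc hGG'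

variable (H ε) in
theorem isTypedBuilding_infinity [Nonempty X] :
    IsTypedBuilding 𝔸.cs (H.leInfinity ε) (H.apartmentsAtInfinity ε) typeAtInfinity where
  partialOrder := isPartialOrder_leInfinity H ε
  nonempty := by
    obtain ⟨f, hf, -⟩ := H.covering (Classical.arbitrary X)
    exact ⟨_, _, ⟨f, hf, rfl⟩, rfl⟩
  face_mem := by
    rintro _ ⟨_, ⟨f, hf, rfl⟩, rfl⟩ a ha b hba
    obtain ⟨F, hF, rfl⟩ := (mem_apartmentAtInfinity_iff hf).1 ha
    exact (mem_apartmentAtInfinity_iff hf).2 (exists_eq_atInfinity_of_le hba)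
  coxeter := by
    rintro _ ⟨_, ⟨f, hf, rfl⟩, rfl⟩
    exact exists_equiv_sphericalCoset hf
  common := by
    intro a b
    obtain ⟨f, hf, F, hF, G, hG, rfl, rfl⟩ := exists_common_chart a b
    exact ⟨_, ⟨_, ⟨f, hf, rfl⟩, rfl⟩, (mem_apartmentAtInfinity_iff hf).2 ⟨F, hF, rfl⟩,
      (mem_apartmentAtInfinity_iff hf).2 ⟨G, hG, rfl⟩⟩
  iso := by
    rintro _ ⟨_, ⟨f, hf, rfl⟩, rfl⟩ _ ⟨_, ⟨g, hg, rfl⟩, rfl⟩ a b ha hb ha' hb'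
    exact exists_equiv_apartmentAtInfinity hf hg ha hb ha' hb'

end AffineHovel

/-! ## Facets of the model apartment -/

namespace VectorialDatum

open SimpleRoots

variable {ι V : Type*} [Fintype ι] [AddCommGroup V] [Module ℝ V] {D : VectorialDatum ι V}

lemma ne_zero_of_mem_roots {f : Module.Dual ℝ V} (hf : f ∈ D.roots) : f ≠ 0 := by
  rcases hf with ⟨a, u, -, i, rfl, rfl⟩ | hf
  · intro hzero
    have htwo : act u (D.root i) (u (D.coroot i)) = 2 := by
      rw [act_apply_apply, D.root_coroot]
    rw [hzero, LinearMap.zero_apply] at htwo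
    exact two_ne_zero htwo.symm
  · exact D.imag_ne_zero f hf

lemma chamberRoot_mem_realRoots (ε : ℤˣ) {w : V ≃ₗ[ℝ] V} (hw : w ∈ D.vWeyl) (i : ι) :
    D.chamberRoot ε w i ∈ D.realRoots := by
  have hmem := act_mem_realRoots (D.root_mem_realRoots i) hw
  rcases Int.units_eq_one_or ε with rfl | rfl
  · simpa [chamberRoot] using hmem
  · have hneg : D.chamberRoot (-1) w i = -act w (D.root i) := by ext v; simp [chamberRoot]
    exact hneg ▸ neg_mem_realRoots hmem

lemma pos_of_mem_coneFace_empty {f : Module.Dual ℝ V} (hf : f ∈ D.roots)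
    {b : ι → Module.Dual ℝ V} (hfb : IsNonnegComb b f) {v : V} (hv : v ∈ coneFace b ∅) :
    0 < f v := by
  refine (hfb.nonneg (coneFace_subset_closedConeFace hv)).lt_of_ne fun hzero =>
    ne_zero_of_mem_roots hf ?_
  obtain ⟨c, hc, rfl⟩ := hfb
  exact Finset.sum_eq_zero fun i _ => by
    rw [coeff_eq_zero_of_mem_coneFace hc hv hzero.ge (notMem_empty i), zero_smul]

end VectorialDatum

namespace ModelApartment

open VectorialDatum SimpleRoots

section Weyl

variable {ι V : Type*} [Fintype ι] [AddCommGroup V] [Module ℝ V] {𝔸 : ModelApartment ι V}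
  {α : Module.Dual ℝ V} {a : V}

/-- The reflection in the wall `M(α, k)`, for a real root `α` with coroot `a`. -/
def wallReflection (h : 𝔸.IsRootPair α a) (k : ℝ) : Equiv.Perm V :=
  Function.Involutive.toPerm (fun x => x - (α x + k) • a) <| by
    intro x
    obtain ⟨u, -, i, rfl, rfl⟩ := h
    simp only [map_sub, map_smul, act_apply_apply, 𝔸.root_coroot, smul_eq_mul]
    module

lemma wallReflection_apply (h : 𝔸.IsRootPair α a) (k : ℝ) (x : V) :
    wallReflection h k x = x - (α x + k) • a := rfl

lemma wallReflection_mem_weyl (h : 𝔸.IsRootPair α a) {k : ℝ} (hk : affWall α k ∈ 𝔸.walls) :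
    wallReflection h k ∈ 𝔸.weyl :=
  Subgroup.subset_closure ⟨α, a, k, h, hk, fun _ => rfl⟩

lemma weyl_le_stabilizer_walls : 𝔸.weyl ≤ MulAction.stabilizer (Equiv.Perm V) 𝔸.walls := by
  refine (Subgroup.closure_le _).2 ?_
  rintro g ⟨α, a, k, h, hk, hg⟩
  obtain rfl : g = wallReflection h k := Equiv.ext hg
  have hsubset : wallReflection h k • 𝔸.walls ⊆ 𝔸.walls := by
    rintro _ ⟨M, hM, rfl⟩
    exact 𝔸.walls_stable α a k h hk M hM
  have hinv : (wallReflection h k)⁻¹ = wallReflection h k := rfl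
  refine MulAction.mem_stabilizer_iff.2 (hsubset.antisymm ?_)
  rwa [Set.subset_smul_set_iff, hinv]

lemma preimage_mem_walls_iff {w : Equiv.Perm V} (hw : w ∈ 𝔸.weyl) {M : Set V} :
    w ⁻¹' M ∈ 𝔸.walls ↔ M ∈ 𝔸.walls := by
  have hsmul : w⁻¹ • M = w ⁻¹' M := (Set.preimage_smul w M).symm
  rw [← hsmul, ← Set.mem_smul_set_iff_inv_smul_mem,
    MulAction.mem_stabilizer_iff.1 (weyl_le_stabilizer_walls hw)]

lemma act_apply_of_linear_part {w : V → V} {u : V ≃ₗ[ℝ] V} (hw : ∀ x v, w (x + v) = w x + u v)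
    (α : Module.Dual ℝ V) (x z : V) : act u α (w z) = α z + (act u α (w x) - α x) := by
  have hz := hw x (z - x)
  rw [add_sub_cancel] at hz
  rw [hz, map_add, act_apply_apply, map_sub]
  ring

lemma affWall_act_mem_walls_iff {w : Equiv.Perm V} (hw : w ∈ 𝔸.weyl) {u : V ≃ₗ[ℝ] V}
    (hu : ∀ x v, w (x + v) = w x + u v) (α : Module.Dual ℝ V) (x : V) (r : ℝ) :
    affWall (act u α) r ∈ 𝔸.walls ↔ affWall α (r + (act u α (w x) - α x)) ∈ 𝔸.walls := by
  have hpreimage : w ⁻¹' affWall (act u α) r = affWall α (r + (act u α (w x) - α x)) := by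
    ext z
    simp only [affWall, mem_preimage, Set.mem_ofPred_eq, act_apply_of_linear_part hu α x z]
    rw [add_assoc, add_comm r]
  rw [← hpreimage, preimage_mem_walls_iff hw]

lemma affWall_neg (α : Module.Dual ℝ V) (k : ℝ) : affWall (-α) (-k) = affWall α k := by
  ext x
  simp only [affWall, Set.mem_ofPred_eq, LinearMap.neg_apply, ← neg_add, neg_eq_zero]

lemma neg_mem_wallParams {r : ℝ} (h : r ∈ 𝔸.wallParams α) : -r ∈ 𝔸.wallParams (-α) :=
  h.imp (𝔸.imag_neg α) fun h => by rwa [affWall_neg]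

/-- The coefficients of the preimage of an intersection of half-spaces with coefficients `k` under
an affine map with linear part `u` that sends `0` to `v`. -/
def pullbackCoeff (u : V ≃ₗ[ℝ] V) (v : V) (k : Module.Dual ℝ V → WithTop ℝ)
    (α : Module.Dual ℝ V) : WithTop ℝ :=
  (k (act u α)).map (· + act u α v)

lemma pullbackCoeff_eq_coe_iff {u : V ≃ₗ[ℝ] V} {v : V} {k : Module.Dual ℝ V → WithTop ℝ} {r : ℝ} :
    pullbackCoeff u v k α = r ↔ k (act u α) = ((r - act u α v : ℝ) : WithTop ℝ) := by
  unfold pullbackCoeff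
  cases k (act u α) with
  | top => exact ⟨fun h => (WithTop.top_ne_coe h).elim, fun h => (WithTop.top_ne_coe h).elim⟩
  | coe s => rw [WithTop.map_coe, WithTop.coe_inj, WithTop.coe_inj, eq_sub_iff_add_eq]

lemma IsAdmissible.pullbackCoeff {w : Equiv.Perm V} (hw : w ∈ 𝔸.weyl) {u : V ≃ₗ[ℝ] V}
    (hu : u ∈ 𝔸.vWeyl) (hwu : ∀ x v, w (x + v) = w x + u v) {k : Module.Dual ℝ V → WithTop ℝ}
    (hk : 𝔸.IsAdmissible k) : 𝔸.IsAdmissible (pullbackCoeff u (w 0) k) := by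
  intro α hα r hr
  refine (hk _ (act_mem_roots hα hu) _ (pullbackCoeff_eq_coe_iff.1 hr)).imp (fun himag => ?_)
    fun hwall => ?_
  · simpa only [act_inv_act] using act_mem_imag himag (inv_mem hu)
  · rw [affWall_act_mem_walls_iff hw hwu α 0] at hwall
    simpa using hwall

lemma preimage_halfSpaceInter {w : V → V} {u : V ≃ₗ[ℝ] V} (hu : u ∈ 𝔸.vWeyl)
    (hwu : ∀ x v, w (x + v) = w x + u v) (k : Module.Dual ℝ V → WithTop ℝ)
    (o : Set (Module.Dual ℝ V)) :
    w ⁻¹' 𝔸.halfSpaceInter k o = 𝔸.halfSpaceInter (pullbackCoeff u (w 0) k) (act u ⁻¹' o) := by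
  have hroot : ∀ (α : Module.Dual ℝ V) (z : V) (r : ℝ),
      act u α (w z) + (r - act u α (w 0)) = α z + r := fun α z r => by
    rw [act_apply_of_linear_part hwu α 0 z, map_zero α]
    ring
  ext z
  constructor
  · intro hz α hα r hr
    have hineq := hz _ (act_mem_roots hα hu) _ (pullbackCoeff_eq_coe_iff.1 hr)
    rwa [hroot] at hineq
  · intro hz α hα r hr
    obtain ⟨β, rfl⟩ : ∃ β, act u β = α := ⟨_, act_act_inv u α⟩
    have hβ : β ∈ 𝔸.roots := by simpa only [act_inv_act] using act_mem_roots hα (inv_mem hu)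
    have hineq := hz β hβ (r + act u β (w 0)) (pullbackCoeff_eq_coe_iff.2 (by simpa using hr))
    rwa [← hroot, add_sub_cancel_right] at hineq

section SingleHalfSpace

open scoped Classical in
lemma isAdmissible_update_top {r : ℝ} (hr : r ∈ 𝔸.wallParams α) :
    𝔸.IsAdmissible (Function.update ⊤ α (r : WithTop ℝ)) := by
  intro β _ s hs
  rcases eq_or_ne β α with rfl | hβ
  · rw [Function.update_self, WithTop.coe_inj] at hs
    exact hs ▸ hr
  · simp [hβ] at hs

open scoped Classical in
lemma halfSpaceInter_update_top (hα : α ∈ 𝔸.roots) (r : ℝ) (o : Set (Module.Dual ℝ V)) :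
    𝔸.halfSpaceInter (Function.update ⊤ α (r : WithTop ℝ)) o =
      {z | 0 ≤ α z + r ∧ (α ∈ o → 0 < α z + r)} := by
  ext z
  refine ⟨fun hz => hz α hα r (Function.update_self ..), fun hz β _ s hs => ?_⟩
  rcases eq_or_ne β α with rfl | hβ
  · rw [Function.update_self, WithTop.coe_inj] at hs
    exact hs ▸ hz
  · simp [hβ] at hs

end SingleHalfSpace

end Weyl

section LocalFacet

variable {V : Type*} [NormedAddCommGroup V] {F S : Set V} {x : V}

lemma mem_localFacet_iff : S ∈ localFacet x F ↔ ∀ᶠ η in 𝓝[F] 0, x + η ∈ S := by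
  have hmap := (Homeomorph.addLeft x).isEmbedding.map_nhdsWithin_eq F 0
  simp only [Homeomorph.coe_addLeft, add_zero] at hmap
  rw [localFacet, ← hmap]
  rfl

end LocalFacet

variable {ι V : Type*} [Fintype ι] [NormedAddCommGroup V] [NormedSpace ℝ V]
  {𝔸 : ModelApartment ι V} {F G S : Set V} {x y ξ : V} {α : Module.Dual ℝ V} {r : ℝ}

lemma localFacet_neBot (hF : 𝔸.IsVFacet F) (x : V) : (localFacet x F).NeBot := by
  obtain ⟨η, hη⟩ := hF.nonempty
  exact (tendsto_add_smul_localFacet hF hη x).neBot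

lemma facet_neBot (hF : 𝔸.IsVFacet F) (x : V) : (𝔸.facet x F).NeBot :=
  (localFacet_neBot hF x).mono (localFacet_le_facet x F)

lemma mem_closure_of_mem_localFacet (hF : 𝔸.IsVFacet F) (hS : S ∈ localFacet x F) :
    x ∈ closure S := by
  have := localFacet_neBot hF x
  exact mem_closure_of_tendsto (f := id) (b := localFacet x F)
    (tendsto_id.mono_left nhdsWithin_le_nhds) hS

lemma halfSpace_mem_facet (hα : α ∈ 𝔸.roots) (hr : r ∈ 𝔸.wallParams α)
    (h : {z | 0 ≤ α z + r} ∈ localFacet y F) : {z | 0 ≤ α z + r} ∈ 𝔸.facet y F := by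
  have hinter := halfSpaceInter_update_top hα r ∅
  simp only [notMem_empty, false_imp_iff, and_true] at hinter
  exact ⟨_, ∅, isAdmissible_update_top hr, hinter ▸ h, hinter.le⟩

lemma openHalfSpace_mem_facet (hα : α ∈ 𝔸.roots) (hr : r ∈ 𝔸.wallParams α)
    (h : {z | 0 < α z + r} ∈ localFacet y F) : {z | 0 < α z + r} ∈ 𝔸.facet y F := by
  have hinter := halfSpaceInter_update_top hα r univ
  simp only [mem_univ, true_imp_iff, and_iff_right_of_imp le_of_lt] at hinter
  exact ⟨_, univ, isAdmissible_update_top hr, hinter ▸ h, hinter.le⟩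

variable [FiniteDimensional ℝ V]

lemma continuous_dual_add_const (α : Module.Dual ℝ V) (r : ℝ) : Continuous fun z => α z + r :=
  α.continuous_of_finiteDimensional.add continuous_const

lemma nonneg_of_mem_localFacet (hF : 𝔸.IsVFacet F) (hS : S ∈ localFacet x F)
    (h : ∀ z ∈ S, 0 ≤ α z + r) : 0 ≤ α x + r :=
  closure_minimal h (isClosed_le continuous_const (continuous_dual_add_const α r))
    (mem_closure_of_mem_localFacet hF hS)

lemma openHalfSpace_mem_localFacet_of_pos (h : 0 < α y + r) :
    {z | 0 < α z + r} ∈ localFacet y F :=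
  mem_nhdsWithin_of_mem_nhds
    ((continuous_dual_add_const α r).continuousAt.eventually_const_lt h)

lemma continuous_of_linear_part {w : V → V} {u : V ≃ₗ[ℝ] V} (hw : ∀ x v, w (x + v) = w x + u v) :
    Continuous w := by
  have heq : w = fun v => w 0 + u v := funext fun v => by rw [← hw, zero_add]
  rw [heq]
  exact continuous_const.add u.toLinearMap.continuous_of_finiteDimensional

lemma map_facet_le {w : Equiv.Perm V} (hw : w ∈ 𝔸.weyl) {u : V ≃ₗ[ℝ] V} (hu : u ∈ 𝔸.vWeyl)
    (hwu : ∀ x v, w (x + v) = w x + u v) (x : V) (F : Set V) :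
    map w (𝔸.facet x F) ≤ 𝔸.facet (w x) (u '' F) := by
  rintro S ⟨k, o, hk, hmem, hS⟩
  have hpreimage := preimage_halfSpaceInter hu hwu k o
  refine ⟨_, _, hk.pullbackCoeff hw hu hwu, ?_, hpreimage ▸ preimage_mono hS⟩
  have hlocal : Tendsto w (localFacet x F) (localFacet (w x) (u '' F)) := by
    refine ((continuous_of_linear_part hwu).continuousWithinAt).tendsto_nhdsWithin ?_
    rintro _ ⟨v, hv, rfl⟩
    exact ⟨u v, ⟨v, hv, rfl⟩, (hwu x v).symm⟩
  exact hpreimage ▸ hlocal hmem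

lemma map_facet {w : Equiv.Perm V} (hw : w ∈ 𝔸.weyl) {u : V ≃ₗ[ℝ] V} (hu : u ∈ 𝔸.vWeyl)
    (hwu : ∀ x v, w (x + v) = w x + u v) :
    map w (𝔸.facet x F) = 𝔸.facet (w x) (u '' F) := by
  refine (map_facet_le hw hu hwu x F).antisymm ?_
  have hinv := map_facet_le (inv_mem hw) (inv_mem hu) (inv_apply_add_of_linear_part hwu)
    (w x) (u '' F)
  have hpoint : (w⁻¹ : Equiv.Perm V) (w x) = x := w.symm_apply_apply x
  have hdirection : (u⁻¹ : V ≃ₗ[ℝ] V) '' (u '' F) = F := u.symm_image_image F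
  have hcancel : (w ∘ (w⁻¹ : Equiv.Perm V)) = id := funext w.apply_symm_apply
  rw [hpoint, hdirection] at hinv
  simpa only [map_map, hcancel, map_id] using map_mono (m := w) hinv

lemma eventually_sub_mem (hF : 𝔸.IsVFacet F) (hξ : ξ ∈ F) : ∀ᶠ η in 𝓝[F] (0 : V), ξ - η ∈ F := by
  obtain ⟨ε, J, hF⟩ := hF
  obtain ⟨w, -, rfl⟩ := isFacetOfType_iff.1 hF
  have hpos : ∀ᶠ η in 𝓝 (0 : V), ∀ i, i ∉ J → 0 < 𝔸.chamberRoot ε w i (ξ - η) := by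
    refine eventually_all.2 fun i => ?_
    by_cases hi : i ∈ J
    · simp [hi]
    · have hcont : Continuous fun η => 𝔸.chamberRoot ε w i (ξ - η) :=
        (𝔸.chamberRoot ε w i).continuous_of_finiteDimensional.comp (by fun_prop)
      have hlt := (hcont.tendsto 0).eventually_const_lt (u := 0) (by simpa using hξ.2 i hi)
      filter_upwards [hlt] with η hη _ using hη
  filter_upwards [mem_nhdsWithin_of_mem_nhds hpos, self_mem_nhdsWithin] with η hη hηF
  exact ⟨fun i hi => by rw [map_sub, hξ.1 i hi, hηF.1 i hi, sub_zero], hη⟩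

lemma halfSpaceInter_mem_localFacet (hF : 𝔸.IsVFacet F) (hξ : ξ ∈ F)
    {k : Module.Dual ℝ V → WithTop ℝ} (hx : x ∈ 𝔸.halfSpaceInter k ∅)
    (hxξ : x + ξ ∈ 𝔸.halfSpaceInter k ∅) : 𝔸.halfSpaceInter k ∅ ∈ localFacet x F := by
  rw [mem_localFacet_iff]
  filter_upwards [eventually_sub_mem hF hξ, self_mem_nhdsWithin] with η hsub hη
  refine fun α hα r hr => ⟨?_, fun h => h.elim⟩
  have hx := (hx α hα r hr).1
  have hxξ := (hxξ α hα r hr).1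
  rw [map_add] at hxξ ⊢
  by_cases hαη : 0 ≤ α η
  · linarith
  · have hneg := hF.nonneg (neg_mem_roots hα) hη (by rw [LinearMap.neg_apply]; linarith)
      (subset_closure hsub)
    rw [LinearMap.neg_apply, map_sub] at hneg
    linarith

lemma openHalfSpace_or_halfSpace_neg_mem_localFacet (hF : 𝔸.IsVFacet F) (hα : α ∈ 𝔸.roots)
    (y : V) (r : ℝ) :
    {z | 0 < α z + r} ∈ localFacet y F ∨ {z | 0 ≤ (-α) z + -r} ∈ localFacet y F := by
  rcases lt_trichotomy (α y + r) 0 with hneg | hzero | hpos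
  · right
    have hneg : 0 < (-α) y + -r := by rw [LinearMap.neg_apply]; linarith
    exact mem_of_superset (openHalfSpace_mem_localFacet_of_pos hneg)
      fun z (hz : 0 < (-α) z + -r) => hz.le
  · simp only [mem_localFacet_iff, Set.mem_ofPred_eq, map_add, LinearMap.neg_apply]
    by_cases hv : ∃ v ∈ F, α v ≤ 0
    · right
      obtain ⟨v, hv, hαv⟩ := hv
      filter_upwards [self_mem_nhdsWithin] with η hη
      have hαη := hF.nonneg (neg_mem_roots hα) hv (by simpa using hαv) (subset_closure hη)
      rw [LinearMap.neg_apply] at hαη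
      linarith
    · left
      push Not at hv
      filter_upwards [self_mem_nhdsWithin] with η hη
      linarith [hv η hη]
  · exact Or.inl (openHalfSpace_mem_localFacet_of_pos hpos)

lemma openHalfSpace_or_openHalfSpace_neg_mem_localFacet {ε : ℤˣ} {w : V ≃ₗ[ℝ] V}
    (hw : w ∈ 𝔸.vWeyl) (hα : α ∈ 𝔸.roots) (y : V) (r : ℝ) :
    {z | 0 < α z + r} ∈ localFacet y (coneFace (𝔸.chamberRoot ε w) ∅) ∨
      {z | 0 < (-α) z + -r} ∈ localFacet y (coneFace (𝔸.chamberRoot ε w) ∅) := by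
  rcases lt_trichotomy (α y + r) 0 with hneg | hzero | hpos
  · exact Or.inr (openHalfSpace_mem_localFacet_of_pos (by rw [LinearMap.neg_apply]; linarith))
  · simp only [mem_localFacet_iff, Set.mem_ofPred_eq, map_add]
    refine (isNonnegComb_chamberRoot_or_neg hα ε hw).imp (fun hcomb => ?_) fun hcomb => ?_
    · filter_upwards [self_mem_nhdsWithin] with η hη
      linarith [pos_of_mem_coneFace_empty hα hcomb hη]
    · filter_upwards [self_mem_nhdsWithin] with η hη
      have hαη := pos_of_mem_coneFace_empty (neg_mem_roots hα) hcomb hη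
      simp only [LinearMap.neg_apply] at hαη ⊢
      linarith
  · exact Or.inl (openHalfSpace_mem_localFacet_of_pos hpos)

lemma halfSpace_mem_of_facet_le (hF : 𝔸.IsVFacet F) (hG : 𝔸.IsVFacet G)
    (hle : 𝔸.facet x F ≤ 𝔸.facet y G) (hα : α ∈ 𝔸.roots) (hr : r ∈ 𝔸.wallParams α)
    (h : {z | 0 ≤ α z + r} ∈ localFacet x F) : {z | 0 ≤ α z + r} ∈ 𝔸.facet y G := by
  rcases openHalfSpace_or_halfSpace_neg_mem_localFacet hG (neg_mem_roots hα) y (-r) with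
    hopposite | hmem
  · exfalso
    have hopposite := hle (openHalfSpace_mem_facet (neg_mem_roots hα) (neg_mem_wallParams hr)
      hopposite)
    have := facet_neBot hF x
    obtain ⟨z, hlt, hle⟩ :=
      Filter.nonempty_of_mem (inter_mem hopposite (halfSpace_mem_facet hα hr h))
    simp only [Set.mem_ofPred_eq, LinearMap.neg_apply] at hlt hle
    linarith
  · simp only [neg_neg] at hmem
    exact halfSpace_mem_facet hα hr hmem

lemma openHalfSpace_mem_of_facet_le (hF : 𝔸.IsVFacet F) (hG : 𝔸.IsVFacet G)
    (hle : 𝔸.facet x F ≤ 𝔸.facet y G) (hα : α ∈ 𝔸.roots) (hr : r ∈ 𝔸.wallParams α)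
    (h : {z | 0 < α z + r} ∈ localFacet x F) : {z | 0 < α z + r} ∈ 𝔸.facet y G := by
  rcases openHalfSpace_or_halfSpace_neg_mem_localFacet hG hα y r with hmem | hopposite
  · exact openHalfSpace_mem_facet hα hr hmem
  · exfalso
    have hopposite := hle (halfSpace_mem_facet (neg_mem_roots hα) (neg_mem_wallParams hr)
      hopposite)
    have := facet_neBot hF x
    obtain ⟨z, hle, hlt⟩ :=
      Filter.nonempty_of_mem (inter_mem hopposite (openHalfSpace_mem_facet hα hr h))
    simp only [Set.mem_ofPred_eq, LinearMap.neg_apply] at hlt hle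
    linarith

end ModelApartment

/-! ## Special points -/

section SimplicialCone

variable {ι V : Type*} [Fintype ι] [AddCommGroup V] [Module ℝ V] {b : ι → Module.Dual ℝ V}
  {c : ι → ℝ}

lemma IsNonnegComb.coeff_nonneg (hb : LinearIndependent ℝ b)
    (h : IsNonnegComb b (∑ j, c j • b j)) (j : ι) : 0 ≤ c j := by
  obtain ⟨d, hd, heq⟩ := h
  have hcd : c = d := hb.fintypeLinearCombination_injective heq
  exact hcd ▸ hd j

lemma IsNonnegComb.abs_coeff_mul_le (hb : LinearIndependent ℝ b)
    (h : IsNonnegComb b (∑ j, c j • b j)) {ξ : V} (hξ : ξ ∈ coneFace b ∅) (j : ι) :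
    |c j| * b j ξ ≤ |(∑ j, c j • b j) ξ| := by
  have hterm : ∀ j ∈ Finset.univ, 0 ≤ c j * b j ξ := fun j _ =>
    mul_nonneg (h.coeff_nonneg hb j) (hξ.2 j (notMem_empty j)).le
  rw [abs_of_nonneg (h.coeff_nonneg hb j),
    abs_of_nonneg (h.nonneg (coneFace_subset_closedConeFace hξ))]
  simpa only [LinearMap.sum_apply, LinearMap.smul_apply, smul_eq_mul] using
    Finset.single_le_sum hterm (Finset.mem_univ j)

lemma abs_coeff_mul_le_abs_apply (hb : LinearIndependent ℝ b)
    (h : IsNonnegComb b (∑ j, c j • b j) ∨ IsNonnegComb b (-∑ j, c j • b j)) {ξ : V}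
    (hξ : ξ ∈ coneFace b ∅) (j : ι) : |c j| * b j ξ ≤ |(∑ j, c j • b j) ξ| := by
  rcases h with h | h
  · exact h.abs_coeff_mul_le hb hξ j
  · have hneg : -∑ j, c j • b j = ∑ j, (-c j) • b j := by
      ext v
      simp [LinearMap.sum_apply]
    rw [← abs_neg (c j), ← abs_neg ((∑ j, c j • b j) ξ), ← LinearMap.neg_apply, hneg]
    exact (hneg ▸ h).abs_coeff_mul_le hb hξ j

end SimplicialCone

lemma finite_of_separated {A : Set ℝ} {c η M : ℝ} (hη : 0 < η) (hM : ∀ s ∈ A, |s| ≤ M)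
    (hsep : ∀ s ∈ A, ∀ s' ∈ A, |c * (s - s')| < η → s = s') : A.Finite := by
  have hmaps : MapsTo (fun s => ⌊c * s / η⌋) A (Icc ⌊-(|c| * M / η)⌋ ⌊|c| * M / η⌋) := by
    intro s hs
    have habs : |c * s / η| ≤ |c| * M / η := by
      rw [abs_div, abs_mul, abs_of_pos hη]
      exact div_le_div_of_nonneg_right (mul_le_mul_of_nonneg_left (hM s hs) (abs_nonneg c)) hη.le
    exact ⟨Int.floor_le_floor (abs_le.1 habs).1, Int.floor_le_floor (abs_le.1 habs).2⟩
  refine Finite.of_injOn hmaps (fun s hs s' hs' hfloor => hsep s hs s' hs' ?_) (finite_Icc _ _)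
  have hlt := Int.abs_sub_lt_one_of_floor_eq_floor hfloor
  rwa [← sub_div, abs_div, abs_of_pos hη, div_lt_one hη, ← mul_sub] at hlt

namespace ModelApartment

open VectorialDatum SimpleRoots

variable {ι V : Type*} [Fintype ι] [AddCommGroup V] [Module ℝ V] {𝔸 : ModelApartment ι V}
  {x : V} {γ : Module.Dual ℝ V} {u : V ≃ₗ[ℝ] V} {i j : ι} {t : ℝ}

variable (𝔸) in
/-- A point is special if it lies on a wall in the direction of each simple root. The stabilizer of
such a point in the affine Weyl group maps onto `W^v`. -/
def IsSpecial (x : V) : Prop := ∀ i, affWall (𝔸.root i) (-𝔸.root i x) ∈ 𝔸.walls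

variable (𝔸) in
/-- The values `t` such that `γ` takes the value `γ x + t` on a wall of direction `ker γ`. -/
def wallOffsets (x : V) (γ : Module.Dual ℝ V) : Set ℝ := {t | affWall γ (-γ x - t) ∈ 𝔸.walls}

lemma mem_wallOffsets : t ∈ 𝔸.wallOffsets x γ ↔ affWall γ (-γ x - t) ∈ 𝔸.walls := Iff.rfl

lemma exists_isSpecial (𝔸 : ModelApartment ι V) : ∃ x, 𝔸.IsSpecial x := by
  have hwall : ∀ i, ∃ k, affWall (𝔸.root i) k ∈ 𝔸.walls := fun i => by
    obtain ⟨M, hM, k, rfl⟩ := (𝔸.walls_infinite _ (𝔸.root_mem_realRoots i)).nonempty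
    exact ⟨k, hM⟩
  choose k hk using hwall
  obtain ⟨x, hx⟩ := exists_forall_dual_apply_eq 𝔸.root_free fun i => -k i
  exact ⟨x, fun i => by rw [hx, neg_neg]; exact hk i⟩

lemma isRootPair_simple (i : ι) : 𝔸.IsRootPair (𝔸.root i) (𝔸.coroot i) :=
  ⟨1, one_mem _, i, rfl, rfl⟩

lemma IsSpecial.exists_weyl (hx : 𝔸.IsSpecial x) (hu : u ∈ 𝔸.vWeyl) :
    ∃ w ∈ 𝔸.weyl, w x = x ∧ ∀ z v, w (z + v) = w z + u v := by
  induction hu using Subgroup.closure_induction with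
  | mem g hg =>
    obtain ⟨i, rfl⟩ := hg
    refine ⟨wallReflection (isRootPair_simple i) _, wallReflection_mem_weyl _ (hx i), ?_,
      fun z v => ?_⟩
    · rw [wallReflection_apply, add_neg_cancel, zero_smul, sub_zero]
    · rw [wallReflection_apply, wallReflection_apply, refl_apply, map_add]
      module
  | one => exact ⟨1, one_mem _, rfl, fun _ _ => rfl⟩
  | mul u u' _ _ ih ih' =>
    obtain ⟨w, hw, hwx, hwu⟩ := ih
    obtain ⟨w', hw', hwx', hwu'⟩ := ih'
    refine ⟨w * w', mul_mem hw hw', by rw [Equiv.Perm.mul_apply, hwx', hwx], fun z v => ?_⟩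
    rw [Equiv.Perm.mul_apply, hwu', hwu]
    rfl
  | inv u _ ih =>
    obtain ⟨w, hw, hwx, hwu⟩ := ih
    exact ⟨w⁻¹, inv_mem hw, w.symm_apply_eq.2 hwx.symm, inv_apply_add_of_linear_part hwu⟩

lemma IsSpecial.wallOffsets_act (hx : 𝔸.IsSpecial x) (hu : u ∈ 𝔸.vWeyl)
    (γ : Module.Dual ℝ V) : 𝔸.wallOffsets x (act u γ) = 𝔸.wallOffsets x γ := by
  obtain ⟨w, hw, hwx, hwu⟩ := hx.exists_weyl hu
  ext t
  have hparam : -act u γ x - t + (act u γ x - γ x) = -γ x - t := by ring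
  rw [mem_wallOffsets, mem_wallOffsets, affWall_act_mem_walls_iff hw hwu γ x, hwx, hparam]

lemma IsSpecial.zero_mem_wallOffsets (hx : 𝔸.IsSpecial x) (hγ : γ ∈ 𝔸.realRoots) :
    0 ∈ 𝔸.wallOffsets x γ := by
  obtain ⟨a, u, hu, i, rfl, rfl⟩ := hγ
  rw [hx.wallOffsets_act hu, mem_wallOffsets, sub_zero]
  exact hx i

lemma IsSpecial.neg_apply_mem_wallParams (hx : 𝔸.IsSpecial x) (hγ : γ ∈ 𝔸.realRoots) :
    -γ x ∈ 𝔸.wallParams γ := by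
  have hzero := hx.zero_mem_wallOffsets hγ
  rw [mem_wallOffsets, sub_zero] at hzero
  exact Or.inr hzero

lemma IsSpecial.neg_mem_wallOffsets (hx : 𝔸.IsSpecial x) (ht : t ∈ 𝔸.wallOffsets x (𝔸.root i)) :
    -t ∈ 𝔸.wallOffsets x (𝔸.root i) := by
  have hparam : -(-𝔸.root i) x - t = -(-𝔸.root i x - -t) := by
    rw [LinearMap.neg_apply]
    ring
  rwa [← hx.wallOffsets_act (𝔸.refl_mem i), act_refl_root, mem_wallOffsets, hparam,
    affWall_neg] at ht

lemma IsSpecial.exists_pos_mem_wallOffsets (hx : 𝔸.IsSpecial x) (i : ι) :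
    ∃ t ∈ 𝔸.wallOffsets x (𝔸.root i), 0 < t := by
  obtain ⟨t, ht, hne⟩ : ∃ t ∈ 𝔸.wallOffsets x (𝔸.root i), t ≠ 0 := by
    by_contra! hzero
    refine 𝔸.walls_infinite _ (𝔸.root_mem_realRoots i)
      ((finite_singleton (affWall (𝔸.root i) (-𝔸.root i x))).subset ?_)
    rintro _ ⟨hM, k, rfl⟩
    have hk := hzero (-𝔸.root i x - k) (by rwa [mem_wallOffsets, sub_sub_cancel])
    rw [mem_singleton_iff, sub_eq_zero.1 hk]
  rcases lt_or_gt_of_ne hne with hneg | hpos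
  · exact ⟨-t, hx.neg_mem_wallOffsets ht, neg_pos.2 hneg⟩
  · exact ⟨t, ht, hpos⟩

lemma IsSpecial.exists_translation_mem_weyl (hx : 𝔸.IsSpecial x)
    (ht : t ∈ 𝔸.wallOffsets x (𝔸.root j)) : ∃ τ ∈ 𝔸.weyl, ∀ z, τ z = z + t • 𝔸.coroot j := by
  refine ⟨wallReflection (isRootPair_simple j) (-𝔸.root j x - t) *
      wallReflection (isRootPair_simple j) (-𝔸.root j x),
    mul_mem (wallReflection_mem_weyl _ ht) (wallReflection_mem_weyl _ (hx j)), fun z => ?_⟩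
  simp only [Equiv.Perm.mul_apply, wallReflection_apply, map_sub, map_smul, smul_eq_mul,
    𝔸.root_coroot]
  module

lemma IsSpecial.mul_coroot_mem_stabilizer (hx : 𝔸.IsSpecial x)
    (ht : t ∈ 𝔸.wallOffsets x (𝔸.root j)) (γ : Module.Dual ℝ V) :
    t * γ (𝔸.coroot j) ∈ AddAction.stabilizer ℝ (𝔸.wallOffsets x γ) := by
  obtain ⟨τ, hτ, hτ_apply⟩ := hx.exists_translation_mem_weyl ht
  have hlinear : ∀ z v, τ (z + v) = τ z + (1 : V ≃ₗ[ℝ] V) v := fun z v => by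
    rw [hτ_apply, hτ_apply, LinearEquiv.coe_one, id]
    abel
  refine AddAction.mem_stabilizer_set.2 fun s => ?_
  have htranslate := affWall_act_mem_walls_iff hτ hlinear γ 0 (-γ x - (t * γ (𝔸.coroot j) + s))
  have hparam : -γ x - (t * γ (𝔸.coroot j) + s) + (γ (0 + t • 𝔸.coroot j) - γ 0) = -γ x - s := by
    rw [zero_add, map_smul, map_zero, smul_eq_mul]
    ring
  rw [hτ_apply] at htranslate
  change affWall γ _ ∈ 𝔸.walls ↔ affWall γ (_ + (γ _ - γ 0)) ∈ 𝔸.walls at htranslate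
  rwa [hparam] at htranslate

lemma IsSpecial.exists_coeff_refl_mul (hx : 𝔸.IsSpecial x) {s : ι → ℝ}
    (hs : ∀ j, s j ∈ 𝔸.wallOffsets x (𝔸.root j)) (hu : u ∈ 𝔸.vWeyl) (m : ι) {c : ι → ℝ}
    (hc : ∀ j, s j * c j ∈ AddAction.stabilizer ℝ (𝔸.wallOffsets x (𝔸.root i)))
    (hcu : act u (𝔸.root i) = 𝔸.root i + ∑ j, c j • 𝔸.root j) :
    ∃ d : ι → ℝ, (∀ j, s j * d j ∈ AddAction.stabilizer ℝ (𝔸.wallOffsets x (𝔸.root i))) ∧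
      act (𝔸.refl m * u) (𝔸.root i) = 𝔸.root i + ∑ j, d j • 𝔸.root j := by
  classical
  refine ⟨fun j => c j - Pi.single (M := fun _ => ℝ) m (act u (𝔸.root i) (𝔸.coroot m)) j,
    fun j => ?_, ?_⟩
  · rcases eq_or_ne j m with rfl | hj
    · have hstep := hx.mul_coroot_mem_stabilizer (hs j) (act u (𝔸.root i))
      rw [hx.wallOffsets_act hu] at hstep
      simpa only [Pi.single_eq_same, mul_sub] using sub_mem (hc j) hstep
    · simpa only [Pi.single_eq_of_ne hj, sub_zero] using hc j
  · ext v
    have hcuv := LinearMap.congr_fun hcu v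
    simp only [act_mul, act_refl, LinearMap.sub_apply, LinearMap.add_apply, LinearMap.sum_apply,
      LinearMap.smul_apply, smul_eq_mul, sub_mul, Finset.sum_sub_distrib, Pi.single_apply, ite_mul,
      zero_mul, Finset.sum_ite_eq', Finset.mem_univ, if_true] at hcuv ⊢
    rw [hcuv, add_sub_assoc]

lemma IsSpecial.exists_coeff (hx : 𝔸.IsSpecial x) {s : ι → ℝ}
    (hs : ∀ j, s j ∈ 𝔸.wallOffsets x (𝔸.root j)) (i : ι) (hu : u ∈ 𝔸.vWeyl) :
    ∃ c : ι → ℝ, (∀ j, s j * c j ∈ AddAction.stabilizer ℝ (𝔸.wallOffsets x (𝔸.root i))) ∧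
      act u (𝔸.root i) = 𝔸.root i + ∑ j, c j • 𝔸.root j := by
  classical
  induction hu using Subgroup.closure_induction_left with
  | one =>
    refine ⟨0, fun j => ?_, ?_⟩
    · rw [Pi.zero_apply, mul_zero]
      exact zero_mem _
    · simp only [Pi.zero_apply, zero_smul, Finset.sum_const_zero, add_zero]
      rfl
  | mul_left g hg u hu ih =>
    obtain ⟨m, rfl⟩ := hg
    obtain ⟨c, hc, hcu⟩ := ih
    exact hx.exists_coeff_refl_mul hs hu m hc hcu
  | inv_mul_cancel g hg u hu ih =>
    obtain ⟨m, rfl⟩ := hg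
    obtain ⟨c, hc, hcu⟩ := ih
    exact 𝔸.refl_inv m ▸ hx.exists_coeff_refl_mul hs hu m hc hcu

lemma IsSpecial.eq_zero_of_mem_stabilizer (hx : 𝔸.IsSpecial x) {η : ℝ}
    (hη : ∀ t ∈ 𝔸.wallOffsets x (𝔸.root i), 0 < t → η ≤ t)
    (ht : t ∈ AddAction.stabilizer ℝ (𝔸.wallOffsets x (𝔸.root i))) (hlt : |t| < η) : t = 0 := by
  have hmem := (AddAction.mem_stabilizer_set.1 ht 0).2
    (hx.zero_mem_wallOffsets (𝔸.root_mem_realRoots i))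
  rw [vadd_eq_add, add_zero] at hmem
  rcases lt_trichotomy t 0 with hneg | hzero | hpos
  · rw [abs_of_neg hneg] at hlt
    exact (hlt.not_ge (hη _ (hx.neg_mem_wallOffsets hmem) (neg_pos.2 hneg))).elim
  · exact hzero
  · rw [abs_of_pos hpos] at hlt
    exact (hlt.not_ge (hη _ hmem hpos)).elim

lemma IsSpecial.finite_bounded_orbit_of_mem_chamber (hx : 𝔸.IsSpecial x) {η : ℝ}
    (hη0 : 0 < η) (hη : ∀ t ∈ 𝔸.wallOffsets x (𝔸.root i), 0 < t → η ≤ t) {ξ : V}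
    (hξ : ξ ∈ coneFace 𝔸.root ∅) (N : ℝ) :
    {γ : Module.Dual ℝ V | (∃ u ∈ 𝔸.vWeyl, γ = act u (𝔸.root i)) ∧ |γ ξ| ≤ N}.Finite := by
  classical
  choose s hs hs0 using hx.exists_pos_mem_wallOffsets
  let e : ι → ℝ := Pi.single i 1
  let A : ι → Set ℝ := fun j =>
    {r | s j * (r - e j) ∈ AddAction.stabilizer ℝ (𝔸.wallOffsets x (𝔸.root i)) ∧
      |r| ≤ N / 𝔸.root j ξ}
  have hA : ∀ j, (A j).Finite := fun j => by
    refine finite_of_separated (c := s j) hη0 (fun r hr => hr.2) fun r hr r' hr' hlt => ?_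
    have hdiff := sub_mem hr.1 hr'.1
    rw [← mul_sub, sub_sub_sub_cancel_right] at hdiff
    have hzero := hx.eq_zero_of_mem_stabilizer hη hdiff hlt
    exact sub_eq_zero.1 ((mul_eq_zero.1 hzero).resolve_left (hs0 j).ne')
  refine ((Finite.pi hA).image fun c => ∑ j, c j • 𝔸.root j).subset ?_
  rintro γ ⟨⟨u, hu, rfl⟩, hN⟩
  obtain ⟨c, hc, hcu⟩ := hx.exists_coeff hs i hu
  have hsum : ∑ j, (e j + c j) • 𝔸.root j = act u (𝔸.root i) := by
    simp [hcu, e, add_smul, Finset.sum_add_distrib, Pi.single_apply]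
  have hsign := 𝔸.pos_or_neg _ (act_mem_realRoots (𝔸.root_mem_realRoots i) hu)
  rw [← hsum] at hsign hN
  refine ⟨fun j => e j + c j, fun j _ => ⟨by simpa using hc j, ?_⟩, hsum⟩
  rw [le_div_iff₀ (hξ.2 j (notMem_empty j))]
  exact (abs_coeff_mul_le_abs_apply 𝔸.root_free hsign hξ j).trans hN

lemma IsSpecial.finite_bounded_orbit (hx : 𝔸.IsSpecial x) {η : ℝ} (hη0 : 0 < η)
    (hη : ∀ t ∈ 𝔸.wallOffsets x (𝔸.root i), 0 < t → η ≤ t) {ε : ℤˣ} {w : V ≃ₗ[ℝ] V}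
    (hw : w ∈ 𝔸.vWeyl) {ξ : V} (hξ : ξ ∈ coneFace (𝔸.chamberRoot ε w) ∅) (N : ℝ) :
    {γ : Module.Dual ℝ V | (∃ u ∈ 𝔸.vWeyl, γ = act u (𝔸.root i)) ∧ |γ ξ| ≤ N}.Finite := by
  refine ((hx.finite_bounded_orbit_of_mem_chamber hη0 hη (mem_coneFace_chamberRoot.1 hξ)
    N).image (act w)).subset ?_
  rintro γ ⟨⟨u, hu, rfl⟩, hN⟩
  refine ⟨act w⁻¹ (act u (𝔸.root i)), ⟨⟨w⁻¹ * u, mul_mem (inv_mem hw) hu, rfl⟩, ?_⟩,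
    act_act_inv _ _⟩
  have hsign : |((ε : ℤ) : ℝ)| = 1 := by
    rcases Int.units_eq_one_or ε with rfl | rfl <;> simp
  rwa [map_smul, act_apply_apply w⁻¹ (act u (𝔸.root i)) ξ, smul_eq_mul, abs_mul, hsign, one_mul]

end ModelApartment

/-! ## Chambers at a special point -/

lemma isOpen_coneFace_empty {ι V : Type*} [Finite ι] [NormedAddCommGroup V] [NormedSpace ℝ V]
    [FiniteDimensional ℝ V] (b : ι → Module.Dual ℝ V) : IsOpen (coneFace b ∅) := by
  have hinter : coneFace b ∅ = ⋂ i, {v | 0 < b i v} := by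
    ext v
    simp [coneFace]
  rw [hinter]
  exact isOpen_iInter_of_finite fun i =>
    isOpen_lt continuous_const (b i).continuous_of_finiteDimensional

namespace VectorialDatum

open SimpleRoots

variable {ι V : Type*} [Fintype ι] [AddCommGroup V] [Module ℝ V] {D : VectorialDatum ι V} {ε : ℤˣ}
  {w : V ≃ₗ[ℝ] V} {i : ι}

lemma chamberRoot_mul_refl (ε : ℤˣ) (w : V ≃ₗ[ℝ] V) (i : ι) :
    D.chamberRoot ε (w * D.refl i) i = -D.chamberRoot ε w i := by
  ext v
  simp [chamberRoot, act_mul, act_refl_root, act_neg]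

lemma exists_reflection_chamberRoot (ε : ℤˣ) (hw : w ∈ D.vWeyl) (i : ι) :
    ∃ ρ ∈ D.vWeyl, (∀ v, D.chamberRoot ε w i (ρ v) = -D.chamberRoot ε w i v) ∧
      ∀ v, D.chamberRoot ε w i v = 0 → ρ v = v := by
  have hconj : ∀ v, w⁻¹ ((w * D.refl i * w⁻¹) v) = D.refl i (w⁻¹ v) := fun v =>
    w.symm_apply_apply _
  refine ⟨w * D.refl i * w⁻¹, mul_mem (mul_mem hw (D.refl_mem i)) (inv_mem hw), fun v => ?_,
    fun v hv => (w⁻¹ : V ≃ₗ[ℝ] V).injective ?_⟩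
  · rw [chamberRoot_apply, hconj, refl_apply, smul_sub, map_sub, map_smul, map_smul, map_smul,
      D.root_coroot, chamberRoot_apply, map_smul]
    simp only [smul_eq_mul]
    ring
  · have hroot : D.root i (w⁻¹ v) = 0 := by
      have hzero := congrArg (((ε : ℤ) : ℝ) • ·) hv
      simp only [chamberRoot_apply, ← map_smul, sign_smul_smul, smul_zero] at hzero
      exact hzero
    rw [hconj, refl_apply, hroot, zero_smul, sub_zero]

lemma eq_chamberRoot_of_apply_eq_zero (hw : w ∈ D.vWeyl) {γ : Module.Dual ℝ V} (hγ : γ ∈ D.roots)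
    (hcomb : IsNonnegComb (D.chamberRoot ε w) γ) {ξ : V}
    (hξ : ξ ∈ coneFace (D.chamberRoot ε w) {i}) (hzero : γ ξ = 0) : γ = D.chamberRoot ε w i := by
  obtain ⟨c, hc, hsum⟩ := hcomb
  have hmultiple : γ = c i • D.chamberRoot ε w i := by
    rw [hsum]
    refine Finset.sum_eq_single i (fun j _ hj => ?_) fun hi => (hi (Finset.mem_univ i)).elim
    rw [coeff_eq_zero_of_mem_coneFace hc hξ (by rw [← hsum, hzero]) hj, zero_smul]
  have hreal := chamberRoot_mem_realRoots ε hw i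
  rcases hγ with hγ | hγ
  · rw [hmultiple] at hγ ⊢
    exact D.reduced _ hreal _ (hc i) hγ
  · exact (D.imag_disjoint _ hγ _ hreal _ hmultiple).elim

end VectorialDatum

namespace ModelApartment

open VectorialDatum SimpleRoots

variable {ι V : Type*} [Fintype ι] [NormedAddCommGroup V] [NormedSpace ℝ V]
  [FiniteDimensional ℝ V] {𝔸 : ModelApartment ι V} {F G : Set V} {x y ξ : V}
  {α β γ : Module.Dual ℝ V} {k : Module.Dual ℝ V → WithTop ℝ} {o : Set (Module.Dual ℝ V)}
  {ε : ℤˣ} {w : V ≃ₗ[ℝ] V} {i : ι} {t : ℝ}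

lemma apply_le_of_facet_le (hF : 𝔸.IsVFacet F) (hle : 𝔸.facet x F ≤ 𝔸.facet y G)
    (hγ : γ ∈ 𝔸.roots) (hwall : -γ x - t ∈ 𝔸.wallParams γ) (ht : 0 < t) : γ y ≤ γ x + t := by
  by_contra! hlt
  have hy : {z | 0 < γ z + (-γ x - t)} ∈ 𝔸.facet y G :=
    openHalfSpace_mem_facet hγ hwall (openHalfSpace_mem_localFacet_of_pos (by linarith))
  have hx := nonneg_of_mem_localFacet hF (localFacet_le_facet x F (hle hy))
    fun z (hz : 0 < γ z + (-γ x - t)) => hz.le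
  linarith

lemma eventually_halfSpace_of_facet_le (hF : 𝔸.IsVFacet F) (hG : 𝔸.IsVFacet G)
    (hle : 𝔸.facet x F ≤ 𝔸.facet y G) (hk : 𝔸.IsAdmissible k)
    (hmem : 𝔸.halfSpaceInter k o ∈ localFacet x F) (hβ : β ∈ 𝔸.roots) :
    ∀ᶠ z in localFacet y G, ∀ r : ℝ, k β = r → 0 ≤ β z + r ∧ (β ∈ o → 0 < β z + r) := by
  cases hkβ : k β with
  | top => exact Eventually.of_forall fun z r hr => (WithTop.top_ne_coe hr).elim
  | coe r =>
    simp only [WithTop.coe_inj, forall_eq']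
    have hr := hk β hβ r hkβ
    have hclosed : ∀ᶠ z in localFacet y G, 0 ≤ β z + r :=
      localFacet_le_facet y G (halfSpace_mem_of_facet_le hF hG hle hβ hr
        (mem_of_superset hmem fun z hz => (hz β hβ r hkβ).1))
    exact hclosed.and <| eventually_imp_distrib_left.2 fun ho =>
      localFacet_le_facet y G (openHalfSpace_mem_of_facet_le hF hG hle hβ hr
        (mem_of_superset hmem fun z hz => (hz β hβ r hkβ).2 ho))

lemma IsSpecial.eventually_sub_mem_chamber (hx : 𝔸.IsSpecial x) (hw : w ∈ 𝔸.vWeyl)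
    (hG : 𝔸.IsVFacet G) (hle : 𝔸.facet x (coneFace (𝔸.chamberRoot ε w) ∅) ≤ 𝔸.facet y G) :
    ∀ᶠ z in localFacet y G, z - x ∈ coneFace (𝔸.chamberRoot ε w) ∅ := by
  have hpos : ∀ᶠ z in localFacet y G, ∀ i,
      0 < 𝔸.chamberRoot ε w i z + -𝔸.chamberRoot ε w i x := by
    refine eventually_all.2 fun i => ?_
    have hreal := chamberRoot_mem_realRoots (D := 𝔸.toVectorialDatum) ε hw i
    refine localFacet_le_facet y G (openHalfSpace_mem_of_facet_le
      ⟨ε, ∅, isFacetOfType_coneFace ε hw ∅⟩ hG hle (Or.inl hreal)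
      (hx.neg_apply_mem_wallParams hreal) ?_)
    rw [mem_localFacet_iff]
    filter_upwards [self_mem_nhdsWithin] with η hη
    rw [map_add]
    linarith [hη.2 i (notMem_empty i)]
  filter_upwards [hpos] with z hz
  exact ⟨fun i hi => hi.elim, fun i _ => by rw [map_sub]; linarith [hz i]⟩

lemma IsSpecial.exists_finite_orbit_apply_le (hx : 𝔸.IsSpecial x) (hw : w ∈ 𝔸.vWeyl)
    (hle : 𝔸.facet x (coneFace (𝔸.chamberRoot ε w) ∅) ≤ 𝔸.facet y G)
    (hξ : ξ ∈ coneFace (𝔸.chamberRoot ε w) ∅) (i : ι) :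
    ∃ B : Set (Module.Dual ℝ V), B.Finite ∧ ∀ u ∈ 𝔸.vWeyl, act u (𝔸.root i) ∉ B →
      0 < act u (𝔸.root i) ξ →
        act u (𝔸.root i) y ≤ act u (𝔸.root i) x + act u (𝔸.root i) ξ / 2 := by
  have hgap : ∀ u ∈ 𝔸.vWeyl, ∀ t ∈ 𝔸.wallOffsets x (𝔸.root i), 0 < t →
      act u (𝔸.root i) y ≤ act u (𝔸.root i) x + t := fun u hu t ht ht0 => by
    rw [← hx.wallOffsets_act hu] at ht
    exact apply_le_of_facet_le ⟨ε, ∅, isFacetOfType_coneFace ε hw ∅⟩ hle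
      (Or.inl (act_mem_realRoots (𝔸.root_mem_realRoots i) hu)) (Or.inr ht) ht0
  by_cases hdiscrete : ∃ η : ℝ, 0 < η ∧ ∀ t ∈ 𝔸.wallOffsets x (𝔸.root i), 0 < t → η ≤ t
  · obtain ⟨η, hη0, hη⟩ := hdiscrete
    obtain ⟨t, ht, ht0⟩ := hx.exists_pos_mem_wallOffsets i
    refine ⟨_, hx.finite_bounded_orbit hη0 hη hw hξ (2 * t), fun u hu hB hpos => ?_⟩
    have hlarge : 2 * t < act u (𝔸.root i) ξ := by
      rw [← abs_of_pos hpos]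
      exact not_le.1 fun hN => hB ⟨⟨u, hu, rfl⟩, hN⟩
    linarith [hgap u hu t ht ht0]
  · refine ⟨∅, finite_empty, fun u hu _ hpos => ?_⟩
    push Not at hdiscrete
    obtain ⟨t, ht, ht0, hlt⟩ := hdiscrete _ (half_pos hpos)
    linarith [hgap u hu t ht ht0]

lemma IsSpecial.exists_finite_apply_le (hx : 𝔸.IsSpecial x) (hw : w ∈ 𝔸.vWeyl)
    (hle : 𝔸.facet x (coneFace (𝔸.chamberRoot ε w) ∅) ≤ 𝔸.facet y G)
    (hξ : ξ ∈ coneFace (𝔸.chamberRoot ε w) ∅) :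
    ∃ B : Set (Module.Dual ℝ V), B.Finite ∧
      ∀ γ ∈ 𝔸.roots, γ ∉ B → 0 < γ ξ → γ y ≤ γ x + γ ξ / 2 := by
  choose B hB hBle using hx.exists_finite_orbit_apply_le hw hle hξ
  refine ⟨⋃ i, B i, finite_iUnion hB, fun γ hγ hγB hpos => ?_⟩
  rcases hγ with ⟨_, u, hu, i, rfl, -⟩ | hγ
  · exact hBle i u hu (fun hmem => hγB (mem_iUnion.2 ⟨i, hmem⟩)) hpos
  · exact apply_le_of_facet_le ⟨ε, ∅, isFacetOfType_coneFace ε hw ∅⟩ hle (Or.inr hγ) (Or.inl hγ)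
      (half_pos hpos)

/- Infinitely many roots occur here. Only finitely many of them can be treated one at a time; for
the others, a wall of their direction separates `y` from `x + ξ` well enough to give a uniform
bound. -/
lemma IsSpecial.facet_eq_of_le (hx : 𝔸.IsSpecial x) (hw : w ∈ 𝔸.vWeyl) (hG : 𝔸.IsVFacet G)
    (hle : 𝔸.facet x (coneFace (𝔸.chamberRoot ε w) ∅) ≤ 𝔸.facet y G) :
    𝔸.facet x (coneFace (𝔸.chamberRoot ε w) ∅) = 𝔸.facet y G := by
  refine le_antisymm hle ?_
  rintro S ⟨k, o, hk, hmem, hS⟩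
  refine ⟨k, o, hk, ?_, hS⟩
  have hC : 𝔸.IsVFacet (coneFace (𝔸.chamberRoot ε w) ∅) := ⟨ε, ∅, isFacetOfType_coneFace ε hw ∅⟩
  obtain ⟨_, hxξ, ξ, hξ, rfl⟩ : (𝔸.halfSpaceInter k o ∩
      (fun v => x + v) '' coneFace (𝔸.chamberRoot ε w) ∅).Nonempty := by
    have := localFacet_neBot hC x
    exact Filter.nonempty_of_mem (inter_mem hmem self_mem_nhdsWithin)
  obtain ⟨B, hB, hBle⟩ := hx.exists_finite_apply_le hw hle hξ
  have hexceptional : ∀ᶠ z in localFacet y G, ∀ γ ∈ B, -γ ∈ 𝔸.roots → ∀ r : ℝ, k (-γ) = r →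
      0 ≤ (-γ) z + r ∧ (-γ ∈ o → 0 < (-γ) z + r) :=
    (eventually_all_finite hB).2 fun γ _ => eventually_imp_distrib_left.2 fun hγ =>
      eventually_halfSpace_of_facet_le hC hG hle hk hmem hγ
  have hnear : ∀ᶠ z in 𝓝 y,
      (1 / 2 : ℝ) • ξ - (z - y) ∈ coneFace (𝔸.chamberRoot ε w) ∅ := by
    have hcont : Continuous fun z => (1 / 2 : ℝ) • ξ - (z - y) := by fun_prop
    refine hcont.continuousAt.eventually_mem ((isOpen_coneFace_empty _).mem_nhds ?_)
    rw [sub_self, sub_zero]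
    exact smul_mem_coneFace one_half_pos hξ
  filter_upwards [hx.eventually_sub_mem_chamber hw hG hle, hexceptional,
    mem_nhdsWithin_of_mem_nhds hnear] with z hchamber hexceptional hnear
  intro β hβ r hr
  rcases isNonnegComb_chamberRoot_or_neg hβ ε hw with hcomb | hcomb
  · have hβx : 0 ≤ β x + r := nonneg_of_mem_localFacet hC hmem fun z hz => (hz β hβ r hr).1
    have hβz := pos_of_mem_coneFace_empty hβ hcomb hchamber
    rw [map_sub] at hβz
    have hpos : 0 < β z + r := by linarith
    exact ⟨hpos.le, fun _ => hpos⟩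
  · by_cases hβB : -β ∈ B
    · simpa only [neg_neg, hβ, hr, true_imp_iff, WithTop.coe_inj, forall_eq'] using
        hexceptional (-β) hβB
    · have hγ := neg_mem_roots hβ
      have hbound := hBle (-β) hγ hβB (pos_of_mem_coneFace_empty hγ hcomb hξ)
      have hβz := pos_of_mem_coneFace_empty hγ hcomb hnear
      have hβξ := (hxξ β hβ r hr).1
      simp only [LinearMap.neg_apply, map_sub, map_smul, smul_eq_mul, map_add] at hbound hβz hβξ
      have hpos : 0 < β z + r := by linarith
      exact ⟨hpos.le, fun _ => hpos⟩

lemma closure_halfSpaceInter_subset : closure (𝔸.halfSpaceInter k o) ⊆ 𝔸.halfSpaceInter k ∅ :=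
  closure_minimal (fun _ hz α hα r hr => ⟨(hz α hα r hr).1, fun h => h.elim⟩)
    (isClosed_halfSpaceInter k)

/- There may be infinitely many roots, but the reflection in the panel maps each root that is
positive at `ξ` to a root that is positive on the whole chamber. -/
lemma eventually_apply_lt_of_mem_panel (hw : w ∈ 𝔸.vWeyl)
    (hξ : ξ ∈ coneFace (𝔸.chamberRoot ε w) {i}) :
    ∀ᶠ η in 𝓝[coneFace (𝔸.chamberRoot ε w) ∅] (0 : V), ∀ γ ∈ 𝔸.roots, 0 < γ ξ → γ η < γ ξ := by
  obtain ⟨ρ, hρ, hρ_root, hρ_fixes⟩ :=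
    exists_reflection_chamberRoot (D := 𝔸.toVectorialDatum) ε hw i
  have hρξ : ρ ξ = ξ := hρ_fixes ξ (hξ.1 i rfl)
  have hnear : ∀ᶠ η in 𝓝 (0 : V), ∀ j, j ≠ i → 0 < 𝔸.chamberRoot ε w j (ξ - ρ η) := by
    refine eventually_all.2 fun j => eventually_imp_distrib_left.2 fun hj => ?_
    have hcont : Continuous fun η => 𝔸.chamberRoot ε w j (ξ - ρ η) :=
      (𝔸.chamberRoot ε w j).continuous_of_finiteDimensional.comp
        (continuous_const.sub ρ.toLinearMap.continuous_of_finiteDimensional)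
    exact (hcont.tendsto 0).eventually_const_lt (by rw [map_zero, sub_zero]; exact hξ.2 j hj)
  filter_upwards [mem_nhdsWithin_of_mem_nhds hnear, self_mem_nhdsWithin] with η hnear hη γ hγ hγξ
  have hmem : ξ - ρ η ∈ coneFace (𝔸.chamberRoot ε w) ∅ := by
    refine ⟨fun j hj => hj.elim, fun j _ => ?_⟩
    rcases eq_or_ne j i with rfl | hj
    · rw [map_sub, hρ_root, hξ.1 j rfl, zero_sub, neg_neg]
      exact hη.2 j (notMem_empty j)
    · exact hnear j hj
  have hρ_apply : ∀ v, act ρ γ (ρ v) = γ v := act_apply_apply ρ γ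
  have hcomb : IsNonnegComb (𝔸.chamberRoot ε w) (act ρ γ) := by
    refine (isNonnegComb_chamberRoot_or_neg (act_mem_roots hγ hρ) ε hw).resolve_right fun hneg => ?_
    have hle := hneg.nonneg (coneFace_subset_closedConeFace hξ)
    rw [LinearMap.neg_apply, ← hρξ, hρ_apply] at hle
    linarith
  have hpos := pos_of_mem_coneFace_empty (act_mem_roots hγ hρ) hcomb hmem
  rw [← hρξ, ← map_sub, hρ_apply, map_sub] at hpos
  exact sub_pos.1 hpos

lemma halfSpaceInter_mem_localFacet_chamber (hw : w ∈ 𝔸.vWeyl)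
    (hξ : ξ ∈ coneFace (𝔸.chamberRoot ε w) {i}) (hx : x ∈ 𝔸.halfSpaceInter k ∅)
    (hxξ : x + ξ ∈ 𝔸.halfSpaceInter k ∅)
    (hpanel : ∀ r : ℝ, k (-𝔸.chamberRoot ε w i) = r → 0 < (-𝔸.chamberRoot ε w i) x + r) :
    𝔸.halfSpaceInter k o ∈ localFacet x (coneFace (𝔸.chamberRoot ε w) ∅) := by
  have hnear : ∀ᶠ η in 𝓝 (0 : V), ∀ r : ℝ, k (-𝔸.chamberRoot ε w i) = r →
      0 < (-𝔸.chamberRoot ε w i) (x + η) + r := by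
    cases hk : k (-𝔸.chamberRoot ε w i) with
    | top => exact Eventually.of_forall fun η r hr => (WithTop.top_ne_coe hr).elim
    | coe r =>
      simp only [WithTop.coe_inj, forall_eq']
      have hcont : Continuous fun η => (-𝔸.chamberRoot ε w i) (x + η) + r :=
        (continuous_dual_add_const (-𝔸.chamberRoot ε w i) r).comp (continuous_const_add x)
      exact (hcont.tendsto 0).eventually_const_lt (by rw [add_zero]; exact hpanel r hk)
  rw [mem_localFacet_iff]
  filter_upwards [mem_nhdsWithin_of_mem_nhds hnear, eventually_apply_lt_of_mem_panel hw hξ,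
    self_mem_nhdsWithin] with η hnear hlt hη
  intro β hβ r hr
  suffices hpos : 0 < β (x + η) + r from ⟨hpos.le, fun _ => hpos⟩
  rcases isNonnegComb_chamberRoot_or_neg hβ ε hw with hcomb | hcomb
  · rw [map_add]
    linarith [pos_of_mem_coneFace_empty hβ hcomb hη, (hx β hβ r hr).1]
  · have hγ := neg_mem_roots hβ
    rcases (hcomb.nonneg (coneFace_subset_closedConeFace hξ)).eq_or_lt with hzero | hpos
    · obtain rfl : β = -𝔸.chamberRoot ε w i :=
        neg_eq_iff_eq_neg.1 (eq_chamberRoot_of_apply_eq_zero hw hγ hcomb hξ hzero.symm)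
      exact hnear r hr
    · have hβη := hlt (-β) hγ hpos
      have hβξ := (hxξ β hβ r hr).1
      simp only [LinearMap.neg_apply, map_add] at hβη hβξ ⊢
      linarith

lemma facet_le_of_le_closure (hw : w ∈ 𝔸.vWeyl) (hG : 𝔸.IsVFacet G)
    (hside : {z | 0 < 𝔸.chamberRoot ε w i z + -𝔸.chamberRoot ε w i x} ∈ 𝔸.facet y G)
    (hle : 𝔸.facet x (coneFace (𝔸.chamberRoot ε w) {i}) ≤ (𝔸.facet y G).lift' closure) :
    𝔸.facet x (coneFace (𝔸.chamberRoot ε w) ∅) ≤ 𝔸.facet y G := by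
  rintro S ⟨k, o, hk, hmem, hS⟩
  refine ⟨k, o, hk, ?_, hS⟩
  have hF : 𝔸.IsVFacet (coneFace (𝔸.chamberRoot ε w) {i}) :=
    ⟨ε, {i}, isFacetOfType_coneFace ε hw {i}⟩
  have hG_mem : 𝔸.halfSpaceInter k o ∈ 𝔸.facet y G := ⟨k, o, hk, hmem, Subset.rfl⟩
  have hclosed : 𝔸.halfSpaceInter k ∅ ∈ localFacet x (coneFace (𝔸.chamberRoot ε w) {i}) :=
    mem_of_superset (localFacet_le_facet _ _ (hle (mem_lift' hG_mem)))
      closure_halfSpaceInter_subset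
  have hx : x ∈ 𝔸.halfSpaceInter k ∅ :=
    (isClosed_halfSpaceInter k).closure_subset (mem_closure_of_mem_localFacet hF hclosed)
  obtain ⟨_, hxξ, ξ, hξ, rfl⟩ : (𝔸.halfSpaceInter k ∅ ∩
      (fun v => x + v) '' coneFace (𝔸.chamberRoot ε w) {i}).Nonempty := by
    have := localFacet_neBot hF x
    exact Filter.nonempty_of_mem (inter_mem hclosed self_mem_nhdsWithin)
  refine halfSpaceInter_mem_localFacet_chamber hw hξ hx hxξ fun r hr => ?_
  have := facet_neBot hG y
  obtain ⟨z, hz, hz_side⟩ := Filter.nonempty_of_mem (inter_mem hG_mem hside)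
  have hneg := neg_mem_roots (Or.inl (chamberRoot_mem_realRoots (D := 𝔸.toVectorialDatum) ε hw i))
  have hz := (hz _ hneg r hr).1
  rw [Set.mem_ofPred_eq] at hz_side
  rw [LinearMap.neg_apply] at hz ⊢
  linarith

lemma IsSpecial.eq_or_eq_of_le_closure (hx : 𝔸.IsSpecial x) (hw : w ∈ 𝔸.vWeyl)
    (hG : 𝔸.IsVChamber G)
    (hle : 𝔸.facet x (coneFace (𝔸.chamberRoot ε w) {i}) ≤ (𝔸.facet y G).lift' closure) :
    𝔸.facet x (coneFace (𝔸.chamberRoot ε w) ∅) = 𝔸.facet y G ∨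
      𝔸.facet x (coneFace (𝔸.chamberRoot ε (w * 𝔸.refl i)) ∅) = 𝔸.facet y G := by
  obtain ⟨ε', hG⟩ := hG
  have hG_facet : 𝔸.IsVFacet G := ⟨ε', ∅, hG⟩
  obtain ⟨w', hw', rfl⟩ := isFacetOfType_iff.1 hG
  have hreal := chamberRoot_mem_realRoots (D := 𝔸.toVectorialDatum) ε hw i
  have hwall := hx.neg_apply_mem_wallParams hreal
  have hwr := mul_mem hw (𝔸.refl_mem i)
  rcases openHalfSpace_or_openHalfSpace_neg_mem_localFacet (ε := ε') hw' (Or.inl hreal) y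
    (-𝔸.chamberRoot ε w i x) with hside | hside
  · exact Or.inl (hx.facet_eq_of_le hw hG_facet
      (facet_le_of_le_closure hw hG_facet (openHalfSpace_mem_facet (Or.inl hreal) hwall hside) hle))
  · refine Or.inr (hx.facet_eq_of_le hwr hG_facet
      (facet_le_of_le_closure (i := i) hwr hG_facet ?_ ?_))
    · rw [chamberRoot_mul_refl]
      exact openHalfSpace_mem_facet (neg_mem_roots (Or.inl hreal)) (neg_mem_wallParams hwall) hside
    · have hrefl : 𝔸.refl i ∈ 𝔸.parabolic {i} := refl_mem_parabolic (mem_singleton i)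
      rwa [coneFace_chamberRoot_mul hrefl]

end ModelApartment

/-! ## Thickness of the building at infinity -/

lemma map_lift'_closure_le {X Y : Type*} [TopologicalSpace X] [TopologicalSpace Y] {f : X → Y}
    (hf : Continuous f) (𝓕 : Filter X) :
    map f (𝓕.lift' closure) ≤ (map f 𝓕).lift' closure := by
  intro S hS
  obtain ⟨T, hT, hTS⟩ := (mem_lift'_sets (monotone_closure Y)).1 hS
  exact (mem_lift'_sets (monotone_closure X)).2
    ⟨f ⁻¹' T, hT, (hf.closure_preimage_subset T).trans (preimage_mono hTS)⟩

/-- The germ at `y` of the half-open segment `]y, y + ξ]`, as in (MA2). -/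
def segmentGerm {V : Type*} [NormedAddCommGroup V] [NormedSpace ℝ V] (y ξ : V) : Filter V :=
  𝓝[(fun t : ℝ => y + t • ξ) '' Ioc 0 1] y

open VectorialDatum in
lemma VectorialDatum.IsVChamber.exists_ne_zero {ι V : Type*} [Fintype ι] [Nonempty ι]
    [AddCommGroup V] [Module ℝ V] {D : VectorialDatum ι V} {C : Set V} (hC : D.IsVChamber C) :
    ∃ ξ ∈ C, ξ ≠ 0 := by
  obtain ⟨ε, hC⟩ := hC
  obtain ⟨ξ, hξ⟩ := IsVFacet.nonempty ⟨ε, ∅, hC⟩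
  refine ⟨ξ, hξ, ?_⟩
  rintro rfl
  obtain ⟨w, -, rfl⟩ := isFacetOfType_iff.1 hC
  simpa using hξ.2 (Classical.arbitrary ι) (notMem_empty _)

namespace ModelApartment

open VectorialDatum SimpleRoots

variable {ι V : Type*} [Fintype ι] [NormedAddCommGroup V] [NormedSpace ℝ V]
  {𝔸 : ModelApartment ι V} {F : Set V} {x ξ : V} {ε : ℤˣ} {w : V ≃ₗ[ℝ] V} {i : ι}

lemma isPreorderedIntervalGerm_segmentGerm (hF : 𝔸.IsVFacet F) (hξ : ξ ∈ F) (hξ0 : ξ ≠ 0) (y : V) :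
    𝔸.IsPreorderedIntervalGerm (segmentGerm y ξ) := by
  refine ⟨y, y + ξ, by simpa using hξ0, ?_, by rw [add_sub_cancel_left, segmentGerm]⟩
  obtain ⟨ε, J, w, hw, rfl⟩ := hF
  obtain ⟨v, hv, rfl⟩ := hξ
  have hcone : w v ∈ 𝔸.titsCone := ⟨J, _, ⟨w, hw, rfl⟩, v, hv, by simp⟩
  rcases Int.units_eq_one_or ε with rfl | rfl
  · exact Or.inl (by simpa using hcone)
  · exact Or.inr (by simpa using hcone)

lemma segmentGerm_le_localFacet (hF : 𝔸.IsVFacet F) (hξ : ξ ∈ F) (y : V) :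
    segmentGerm y ξ ≤ localFacet y F :=
  nhdsWithin_mono _ <| image_subset_iff.2 fun t ht => ⟨t • ξ, hF.smul_mem ht.1 hξ, rfl⟩

lemma IsSpecial.isPanel_facet (hx : 𝔸.IsSpecial x) (hw : w ∈ 𝔸.vWeyl) (i : ι) :
    𝔸.IsPanel (𝔸.facet x (coneFace (𝔸.chamberRoot ε w) {i})) := by
  have hwall := hx.zero_mem_wallOffsets
    (chamberRoot_mem_realRoots (D := 𝔸.toVectorialDatum) ε hw i)
  refine ⟨x, _, ⟨ε, i, isFacetOfType_coneFace ε hw {i}⟩, ⟨_, hwall, ?_, fun v hv => ?_⟩, rfl⟩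
  · simp [affWall]
  · simp [affWall, hv.1 i rfl]

variable [FiniteDimensional ℝ V]

lemma mem_of_halfSpaceInter_mem_facet {k : Module.Dual ℝ V → WithTop ℝ} (hF : 𝔸.IsVFacet F)
    (h : 𝔸.halfSpaceInter k ∅ ∈ 𝔸.facet x F) : x ∈ 𝔸.halfSpaceInter k ∅ :=
  (isClosed_halfSpaceInter k).closure_subset
    (mem_closure_of_mem_localFacet hF (localFacet_le_facet x F h))

lemma exists_isClosed_of_mem_cl_segmentGerm (hF : 𝔸.IsVFacet F) (hξ : ξ ∈ F) {S : Set V}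
    (hS : S ∈ 𝔸.cl (segmentGerm x ξ)) : ∃ E, IsClosed E ∧ E ∈ 𝔸.facet x F ∧ E ⊆ S := by
  obtain ⟨k, hk, hE, hS⟩ := hS
  refine ⟨_, isClosed_halfSpaceInter k, ⟨k, ∅, hk, ?_, Subset.rfl⟩, hS⟩
  have hlim := tendsto_add_smul_nhdsGT_zero x ξ
  have hmem : ∀ᶠ t : ℝ in 𝓝[>] 0, x + t • ξ ∈ 𝔸.halfSpaceInter k ∅ := by
    refine (tendsto_nhdsWithin_iff.2 ⟨hlim, ?_⟩).eventually hE
    filter_upwards [Ioc_mem_nhdsGT one_pos] with t ht using ⟨t, ht, rfl⟩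
  obtain ⟨t, ht, ht0⟩ := (hmem.and self_mem_nhdsWithin).exists
  exact halfSpaceInter_mem_localFacet hF (hF.smul_mem ht0 hξ)
    ((isClosed_halfSpaceInter k).mem_of_tendsto hlim hmem) ht

lemma sectorFaceGerm_eq_of_isFacetOfType_empty (hF : 𝔸.IsFacetOfType ε ∅ F) (x y : V) :
    sectorFaceGerm x F = sectorFaceGerm y F := by
  have hF' : 𝔸.IsVFacet F := ⟨ε, ∅, hF⟩
  obtain ⟨ζ, hζ⟩ := hF'.nonempty
  obtain ⟨t, ht0, ht⟩ : ∃ t : ℝ, 0 < t ∧ x - y + t • ζ ∈ F := by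
    obtain ⟨w, -, rfl⟩ := isFacetOfType_iff.1 hF
    have hpos : ∀ᶠ t : ℝ in atTop, ∀ i, 0 < 𝔸.chamberRoot ε w i (x - y + t • ζ) := by
      refine eventually_all.2 fun i => ?_
      simp only [map_add, map_smul, smul_eq_mul]
      exact (tendsto_atTop_add_const_left _ _
        (tendsto_id.atTop_mul_const (hζ.2 i (notMem_empty i)))).eventually_gt_atTop 0
    obtain ⟨t, ht, ht0⟩ := (hpos.and (eventually_gt_atTop 0)).exists
    exact ⟨t, ht0, fun i hi => hi.elim, fun i _ => ht i⟩
  rw [← sectorFaceGerm_add hF' (subset_closure (hF'.smul_mem ht0 hζ)) (x := x),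
    ← sectorFaceGerm_add hF' (subset_closure ht) (x := y)]
  congr 1
  abel

lemma map_lift'_closure_facet_le {s : Equiv.Perm V} (hs : s ∈ 𝔸.weyl) {u : V ≃ₗ[ℝ] V}
    (hu : u ∈ 𝔸.vWeyl) (hsu : ∀ x v, s (x + v) = s x + u v) :
    map s ((𝔸.facet x F).lift' closure) ≤ (𝔸.facet (s x) (u '' F)).lift' closure := by
  rw [← map_facet hs hu hsu]
  exact map_lift'_closure_le (continuous_of_linear_part hsu) _

lemma IsSpecial.exists_weyl_map_facet_eq (hx : 𝔸.IsSpecial x) (hw : w ∈ 𝔸.vWeyl) (ε : ℤˣ) (i : ι) :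
    ∃ s ∈ 𝔸.weyl, s x = x ∧ ∀ J,
      map s (𝔸.facet x (coneFace (𝔸.chamberRoot ε w) J)) =
        𝔸.facet x (coneFace (𝔸.chamberRoot ε (w * 𝔸.refl i)) J) ∧
      map s (sectorFaceGerm x (coneFace (𝔸.chamberRoot ε w) J)) =
        sectorFaceGerm x (coneFace (𝔸.chamberRoot ε (w * 𝔸.refl i)) J) := by
  have hρ : w * 𝔸.refl i * w⁻¹ ∈ 𝔸.vWeyl := mul_mem (mul_mem hw (𝔸.refl_mem i)) (inv_mem hw)
  obtain ⟨s, hs, hsx, hs_linear⟩ := hx.exists_weyl hρ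
  refine ⟨s, hs, hsx, fun J => ?_⟩
  have himage : ⇑(w * 𝔸.refl i * w⁻¹) '' coneFace (𝔸.chamberRoot ε w) J =
      coneFace (𝔸.chamberRoot ε (w * 𝔸.refl i)) J := by
    rw [image_coneFace_chamberRoot, inv_mul_cancel_right]
  rw [map_facet hs hρ hs_linear, map_sectorFaceGerm ⟨ε, J, isFacetOfType_coneFace ε hw J⟩ hρ
    hs_linear, hsx, himage]
  exact ⟨rfl, rfl⟩

end ModelApartment

namespace AffineHovel

open ModelApartment VectorialDatum SimpleRoots

variable {ι V : Type*} [Fintype ι] [NormedAddCommGroup V] [NormedSpace ℝ V] [FiniteDimensional ℝ V]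
  {𝔸 : ModelApartment ι V} {X : Type*} {H : AffineHovel 𝔸 X} {F C : Set V} {x y ξ : V}
  {f g h : V → X} {ε : ℤˣ} {w : V ≃ₗ[ℝ] V} {i : ι} {J J' : Set ι} {P R 𝔠 : Filter X}

lemma exists_chart_fixing_facet (hg : g ∈ H.charts) (hh : h ∈ H.charts) (hF : 𝔸.IsVFacet F)
    (hξ : ξ ∈ F) (hξ0 : ξ ≠ 0) (hr : range h ∈ map g (𝔸.facet y F)) :
    ∃ h' ∈ H.charts, range h' = range h ∧
      ∃ E, IsClosed E ∧ E ∈ 𝔸.facet y F ∧ ∀ z ∈ E, h' z = g z := by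
  have hle := (segmentGerm_le_localFacet hF hξ y).trans (localFacet_le_facet (𝔸 := 𝔸) y F)
  obtain ⟨-, h', hh', hr', hfix⟩ := H.ma2 g hg _
    (Or.inr (Or.inl (isPreorderedIntervalGerm_segmentGerm hF hξ hξ0 y))) h hh (map_mono hle hr)
  obtain ⟨E, hE, hEF, hsub⟩ := exists_isClosed_of_mem_cl_segmentGerm hF hξ hfix
  exact ⟨h', hh', hr', E, hE, hEF, hsub⟩

lemma IsChamberDominating.exists_chart [Nonempty ι] (h𝔠 : H.IsChamberDominating P 𝔠)
    (hf : f ∈ H.charts) {R : Filter V} (hR : 𝔸.IsSplayedChimneyGerm R) :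
    ∃ h ∈ H.charts, range h ∈ map f R ∧ ∃ y C, 𝔸.IsVChamber C ∧ map h (𝔸.facet y C) = 𝔠 ∧
      P ≤ map h ((𝔸.facet y C).lift' closure) := by
  obtain ⟨g, hg, _, ⟨y, C, hC, rfl⟩, rfl, hle⟩ := h𝔠
  obtain ⟨ξ, hξ, hξ0⟩ := hC.exists_ne_zero
  have hC_facet : 𝔸.IsVFacet C := hC.imp fun _ hC => ⟨∅, hC⟩
  obtain ⟨h, hh, hR_mem, hC_mem⟩ := H.ma3 f hf g hg R (𝔸.facet y C) hR
    (Or.inl ⟨_, _, hC_facet, rfl⟩)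
  obtain ⟨h', hh', hrange, E, hE, hEC, hfix⟩ :=
    exists_chart_fixing_facet hg hh hC_facet hξ hξ0 hC_mem
  have hE_closure : E ∈ (𝔸.facet y C).lift' closure := hE.closure_eq ▸ mem_lift' hEC
  refine ⟨h', hh', hrange ▸ hR_mem, y, C, hC, map_congr (mem_of_superset hEC hfix), ?_⟩
  exact hle.trans (map_congr (mem_of_superset hE_closure hfix)).ge

lemma IsChamberDominating.exists_chart_fixing_germ [Nonempty ι]
    (h𝔠 : H.IsChamberDominating (map f (𝔸.facet x F)) 𝔠) (hf : f ∈ H.charts)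
    (hF : 𝔸.IsSphericalFacet ε F) :
    ∃ h ∈ H.charts, map h (𝔸.facet x F) = map f (𝔸.facet x F) ∧
      map h (sectorFaceGerm x F) = map f (sectorFaceGerm x F) ∧ h x = f x ∧
      ∃ y C, 𝔸.IsVChamber C ∧ map h (𝔸.facet y C) = 𝔠 ∧
        𝔸.facet x F ≤ (𝔸.facet y C).lift' closure := by
  have hF' := hF.isVFacet
  have hR := isSplayedChimneyGerm_chimneyGerm hF hF' x
  obtain ⟨h₁, hh₁, hR_mem, y, C, ⟨ε', hC⟩, h𝔠, hle⟩ := h𝔠.exists_chart hf hR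
  obtain ⟨-, h, hh, hrange, k, -, hk, hfix⟩ := H.ma4 f hf _ (𝔸.facet x F) hR
    (Or.inl ⟨_, _, hF', rfl⟩) h₁ hh₁ hR_mem (hle range_mem_map)
  have hfacet : map h (𝔸.facet x F) = map f (𝔸.facet x F) :=
    map_congr (mem_of_superset hk.2 hfix)
  obtain ⟨s, hs, rfl⟩ := exists_weyl_of_range_eq hh hh₁ hrange.symm
  obtain ⟨u, hu, hsu⟩ := exists_linear_of_mem_weyl hs
  refine ⟨h, hh, hfacet,
    map_congr (mem_of_superset (sectorFaceGerm_le_chimneyGerm hF' hF' hk.1) hfix),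
    hfix (mem_of_halfSpaceInter_mem_facet hF' hk.2), s y, u '' C, ⟨ε', hC.image hu⟩, ?_, ?_⟩
  · rw [← map_facet hs hu hsu, map_map, h𝔠]
  · rw [← hfacet, ← map_map, map_le_map_iff (H.charts_injective h hh)] at hle
    exact hle.trans (map_lift'_closure_facet_le hs hu hsu)

lemma IsChamberDominating.exists_chart_map_facet_eq (hf : f ∈ H.charts) (hx : 𝔸.IsSpecial x)
    (hw : w ∈ 𝔸.vWeyl)
    (h𝔠 : H.IsChamberDominating (map f (𝔸.facet x (coneFace (𝔸.chamberRoot ε w) {i}))) 𝔠) :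
    ∃ h ∈ H.charts, map h (𝔸.facet x (coneFace (𝔸.chamberRoot ε w) ∅)) = 𝔠 ∧
      map h (𝔸.facet x (coneFace (𝔸.chamberRoot ε w) {i})) =
        map f (𝔸.facet x (coneFace (𝔸.chamberRoot ε w) {i})) ∧
      map h (sectorFaceGerm x (coneFace (𝔸.chamberRoot ε w) {i})) =
        map f (sectorFaceGerm x (coneFace (𝔸.chamberRoot ε w) {i})) ∧ h x = f x := by
  have : Nonempty ι := ⟨i⟩
  obtain ⟨h, hh, hfacet, hgerm, hhx, y, C, hC, rfl, hle⟩ := h𝔠.exists_chart_fixing_germ hf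
    ⟨{i}, isSpherical_singleton i, isFacetOfType_coneFace ε hw {i}⟩
  rcases hx.eq_or_eq_of_le_closure hw hC hle with hsame | hopposite
  · exact ⟨h, hh, by rw [hsame], hfacet, hgerm, hhx⟩
  · obtain ⟨s, hs, hsx, hmap⟩ := hx.exists_weyl_map_facet_eq hw ε i
    have hpanel : coneFace (𝔸.chamberRoot ε (w * 𝔸.refl i)) {i} =
        coneFace (𝔸.chamberRoot ε w) {i} :=
      coneFace_chamberRoot_mul (refl_mem_parabolic (mem_singleton i))
    refine ⟨h ∘ s, ((H.charts_orbit h hh _).2 ⟨s, hs, rfl⟩).1, ?_, ?_, ?_, ?_⟩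
    · rw [← map_map, (hmap ∅).1, hopposite]
    · rw [← map_map, (hmap {i}).1, hpanel, hfacet]
    · rw [← map_map, (hmap {i}).2, hpanel, hgerm]
    · rw [Function.comp_apply, hsx, hhx]

lemma map_sectorFaceGerm_eq_of_atInfinity_eq {hg : g ∈ H.charts} {hh : h ∈ H.charts}
    (hC : 𝔸.IsFacetOfType ε ∅ C) {hC_spherical : 𝔸.IsSphericalFacet ε C}
    (heq : atInfinity hg hC_spherical = atInfinity hh hC_spherical) (x : V) :
    map h (sectorFaceGerm x C) = map g (sectorFaceGerm x C) := by
  rw [← toInfinity_faceGerm hg x hC_spherical, ← toInfinity_faceGerm hh x hC_spherical,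
    toInfinity_eq_iff] at heq
  obtain ⟨k, hk, a, b, K, hK, hgK, hhK⟩ := heq
  change map g (sectorFaceGerm x C) = _ at hgK
  change map h (sectorFaceGerm x C) = _ at hhK
  have hK_chamber : 𝔸.IsFacetOfType ε ∅ K := by
    obtain ⟨u, hu, rfl, -⟩ :=
      directions_unique hk hg hK hK hC_spherical hC_spherical hgK.symm hgK.symm
    exact hC.image hu
  rw [hhK, hgK, sectorFaceGerm_eq_of_isFacetOfType_empty hK_chamber b a]

lemma map_facet_eq_of_map_sectorFaceGerm_eq (hg : g ∈ H.charts) (hh : h ∈ H.charts)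
    (hF : 𝔸.IsVFacet F) (hC : 𝔸.IsSphericalFacet ε C)
    (hfacet : map g (𝔸.facet x F) = map h (𝔸.facet x F)) (hx : g x = h x)
    (hgerm : map h (sectorFaceGerm x C) = map g (sectorFaceGerm x C)) :
    map g (𝔸.facet x C) = map h (𝔸.facet x C) := by
  have hC' := hC.isVFacet
  obtain ⟨ξ, -, hmem, -⟩ := exists_chart_fixing_sectorFace hg hh hC (hgerm ▸ range_mem_map)
  obtain ⟨-, h', hh', hrange, k, hk, hk_mem, hfix⟩ := H.ma4 g hg _ (𝔸.facet x F)
    (isSplayedChimneyGerm_chimneyGerm hC hC' (x + ξ)) (Or.inl ⟨_, _, hF, rfl⟩) h hh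
    (map_mono (chimneyGerm_le_cl_sectorFace hC') hmem) (hfacet ▸ range_mem_map)
  have hxk := mem_of_halfSpaceInter_mem_facet hF hk_mem.2
  obtain ⟨ξ', -, hshortened⟩ :=
    (mem_sectorFaceGerm hC').1 (sectorFaceGerm_le_chimneyGerm hC' hC' hk_mem.1)
  have hsector : ∀ v ∈ C, x + v ∈ 𝔸.halfSpaceInter k ∅ := fun v hv =>
    add_mem_halfSpaceInter hC' hv (fun t ht => hshortened _ (hC'.smul_mem ht hv)) hxk
      (subset_closure hv)
  obtain ⟨v, hv⟩ := hC'.nonempty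
  have hfacet' : map h' (𝔸.facet x C) = map g (𝔸.facet x C) :=
    map_congr ⟨k, ∅, hk, halfSpaceInter_mem_localFacet hC' hv hxk (hsector v hv), hfix⟩
  have hgerm' : map h' (sectorFaceGerm x C) = map h (sectorFaceGerm x C) := by
    rw [hgerm]
    refine map_congr ((mem_sectorFaceGerm hC').2 ⟨0, hC'.zero_mem_closure, fun v hv => ?_⟩)
    rw [add_zero]
    exact hfix (hsector v hv)
  obtain ⟨s, hs, rfl⟩ := exists_weyl_of_range_eq hh hh' hrange
  obtain ⟨u, hu, hsu⟩ := exists_linear_of_mem_weyl hs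
  have hsx : s x = x := H.charts_injective h hh ((hfix hxk).trans hx)
  rw [← map_map, map_sectorFaceGerm hC' hu hsu] at hgerm'
  have huC : u '' C = C :=
    direction_unique (hC.image hu) hC (map_injective (H.charts_injective h hh) hgerm')
  rw [← hfacet', ← map_map, map_facet hs hu hsu, hsx, huC]

lemma leInfinity_atInfinity_coneFace_iff {hf : f ∈ H.charts} (hw : w ∈ 𝔸.vWeyl)
    {hF : 𝔸.IsSphericalFacet ε (coneFace (𝔸.chamberRoot ε w) J)}
    {hG : 𝔸.IsSphericalFacet ε (coneFace (𝔸.chamberRoot ε w) J')} :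
    H.leInfinity ε (atInfinity hf hF) (atInfinity hf hG) ↔ J' ⊆ J := by
  rw [leInfinity_atInfinity_iff, closure_coneFace_chamberRoot,
    coneFace_subset_closedConeFace_iff hw hw, inv_mul_cancel]
  exact and_iff_right (one_mem _)

lemma isBuildingChamber_atInfinity {hf : f ∈ H.charts} {hC_spherical : 𝔸.IsSphericalFacet ε C}
    (hC : 𝔸.IsFacetOfType ε ∅ C) :
    IsBuildingChamber (H.leInfinity ε) (atInfinity hf hC_spherical) := by
  intro d hd
  obtain ⟨g, hg, F, hF, G, hG, hCF, rfl⟩ := exists_common_chart (atInfinity hf hC_spherical) d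
  rw [hCF, leInfinity_atInfinity_iff] at hd
  rw [hCF, atInfinity_eq_iff]
  obtain ⟨J, -, hFJ⟩ := id hF
  obtain ⟨J', -, hGJ⟩ := id hG
  obtain rfl : J = ∅ := by
    rw [← typeAtInfinity_eq (hf := hg) (hF := hF) hFJ, ← hCF, typeAtInfinity_eq hC]
  obtain ⟨u, hu, rfl⟩ := isFacetOfType_iff.1 hFJ
  obtain ⟨u', hu', rfl⟩ := isFacetOfType_iff.1 hGJ
  rw [closure_coneFace_chamberRoot, coneFace_subset_closedConeFace_iff hu hu'] at hd
  exact ((coneFace_chamberRoot_eq_iff hu hu').2 ⟨hd.1, subset_empty_iff.1 hd.2⟩).symm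

lemma exists_eq_atInfinity_of_isBuildingPanel {p : H.Infinity ε}
    (hp : IsBuildingPanel (H.leInfinity ε) p) :
    ∃ f, ∃ hf : f ∈ H.charts, ∃ w ∈ 𝔸.vWeyl, ∃ i,
      ∃ hF : 𝔸.IsSphericalFacet ε (coneFace (𝔸.chamberRoot ε w) {i}), p = atInfinity hf hF := by
  obtain ⟨f, hf, F, hF, rfl⟩ := exists_eq_atInfinity p
  obtain ⟨J, -, hFJ⟩ := id hF
  obtain ⟨i, hi⟩ : J.Nonempty := nonempty_iff_ne_empty.2 fun hJ =>
    hp.1 (isBuildingChamber_atInfinity (hJ ▸ hFJ))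
  obtain ⟨w, hw, rfl⟩ := isFacetOfType_iff.1 hFJ
  have hG : 𝔸.IsSphericalFacet ε (coneFace (𝔸.chamberRoot ε w) {i}) :=
    ⟨{i}, isSpherical_singleton i, isFacetOfType_coneFace ε hw {i}⟩
  have hC : 𝔸.IsSphericalFacet ε (coneFace (𝔸.chamberRoot ε w) ∅) :=
    ⟨∅, isSpherical_empty, isFacetOfType_coneFace ε hw ∅⟩
  refine ⟨f, hf, w, hw, i, hG, (hp.2 _ ?_ fun hchamber => ?_).symm⟩
  · exact (leInfinity_atInfinity_coneFace_iff hw).2 (singleton_subset_iff.2 hi)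
  · have heq := hchamber (atInfinity hf hC)
      ((leInfinity_atInfinity_coneFace_iff hw).2 (empty_subset _))
    exact singleton_ne_empty i ((coneFace_chamberRoot_eq_iff hw hw).1 (atInfinity_eq_iff.1 heq)).2

variable (ε) in
lemma IsThick.isThickBuilding_infinity (hH : H.IsThick) : IsThickBuilding (H.leInfinity ε) := by
  intro p hp
  obtain ⟨f, hf, w, hw, i, hF, rfl⟩ := exists_eq_atInfinity_of_isBuildingPanel hp
  obtain ⟨x, hx⟩ := 𝔸.exists_isSpecial
  obtain ⟨𝔠, hinj, hdom⟩ := hH f hf _ (hx.isPanel_facet hw i)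
  choose h hh hchamber hfacet hgerm hhx using fun j => (hdom j).exists_chart_map_facet_eq hf hx hw
  have hC := isFacetOfType_coneFace (D := 𝔸.toVectorialDatum) ε hw ∅
  have hC_spherical : 𝔸.IsSphericalFacet ε (coneFace (𝔸.chamberRoot ε w) ∅) :=
    ⟨∅, isSpherical_empty, hC⟩
  refine ⟨fun j => atInfinity (hh j) hC_spherical, fun j l hjl => hinj ?_, fun j =>
    ⟨isBuildingChamber_atInfinity hC, ?_⟩⟩
  · rw [← hchamber j, ← hchamber l]
    exact map_facet_eq_of_map_sectorFaceGerm_eq (hh j) (hh l) hF.isVFacet hC_spherical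
      ((hfacet j).trans (hfacet l).symm) ((hhx j).trans (hhx l).symm)
      (map_sectorFaceGerm_eq_of_atInfinity_eq hC hjl x)
  · have hpanel : atInfinity hf hF = atInfinity (hh j) hF := by
      rw [← toInfinity_faceGerm hf x hF]
      exact toInfinity_eq_atInfinity (hh j) hF (hgerm j).symm
    rw [hpanel]
    exact (leInfinity_atInfinity_coneFace_iff hw).2 (empty_subset _)

end AffineHovel

theorem mainTheorem2 {ι V X : Type*} [Fintype ι] [NormedAddCommGroup V] [NormedSpace ℝ V]
    [FiniteDimensional ℝ V] [Nonempty X] (𝔸 : ModelApartment ι V) (H : AffineHovel 𝔸 X) (ε : ℤˣ) :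
    Equivalence (H.Parallel ε) ∧
    (∀ 𝔉 𝔊 : H.FaceGerm ε,
      H.leInfinity ε (H.toInfinity ε 𝔊) (H.toInfinity ε 𝔉) ↔ H.Dominates ε 𝔉 𝔊) ∧
    IsCombinatorialBuilding 𝔸.cs (H.leInfinity ε) (H.apartmentsAtInfinity ε) ∧
    (H.IsThick → IsThickBuilding (H.leInfinity ε)) :=
  ⟨H.parallel_equivalence ε, fun _ _ => AffineHovel.leInfinity_toInfinity_iff,
    ⟨_, H.isTypedBuilding_infinity ε⟩, fun hthick => hthick.isThickBuilding_infinity ε⟩
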